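/- **Setting.** Let $d\ge 1$, $\beta>0$, $\alpha<0$, $a>b>0$, $\mu\in\mathbb R$. Put $q_k=(4\pi\beta)^{-d/2}k^{-(1+d/2)}$ and $\overline q^{(s)}=\sum_{k\ge1}q_ke^{\beta sk}$. For a box $\Lambda\subset\mathbb R^d$ and $m\in\mathbb N$ let $\mathsf Q_\Lambda$ be the law of cycle counts $(|\Lambda|\lambda_k)_{k\ge1}$ (finitely supported sequences in $\mathbb N_0$) given by $$\mathsf Q_\Lambda(\lambda=x)=e^{-|\Lambda|\overline q^{(\alpha)}}\prod_{k\ge1}\frac{(|\Lambda|q_ke^{\beta\alpha k})^{|\Lambda|x_k}}{(|\Lambda|x_k)!},$$ let $$H_\Lambda(\lambda)=|\Lambda|\Big(-(\mu-\alpha)\sum_kk\lambda_k+\tfrac a2\Big(\sum_kk\lambda_k\Big)^2-\tfrac b2\sum_{k\ge m}k^2\lambda_k^2\Big),$$ and let $\mathbb E_\Lambda$ be the expectation under the Gibbs distribution $d\mathsf P_\Lambda/d\mathsf Q_\Lambda=e^{-\beta H_\Lambda}/\int e^{-\beta H_\Lambda}d\mathsf Q_\Lambda$. The limit $\Lambda\uparrow\mathbb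 R^d$ is taken along sequences of centred boxes with $|\Lambda|\to\infty$ and cut-offs $m=m_\Lambda\to\infty$ with $m_\Lambda/|\Lambda|\to\kappa\in[0,\infty]$. Define $$\varrho^{(\kappa)}(\mu)=\lim_{\Lambda\uparrow\mathbb R^d}\mathbb E_\Lambda\Big[\sum_{k\ge m_\Lambda}k\lambda_k\Big],\qquad \Delta^{(\kappa)}(\mu)=\lim_{K\to\infty}\lim_{\Lambda\uparrow\mathbb R^d}\mathbb E_\Lambda\Big[\sum_{k>K}k\lambda_k\Big].$$ Let $p_0(\beta,s)=\overline q^{(s)}/\beta$ (which is $+\infty$ for $s>0$), $f_0(\beta,x)=\sup_{s\in\mathbb R}\{sx-p_0(\beta,s)\}$, and let $\varrho_c=(4\pi\beta)^{-d/2}\zeta(d/2)$ if $d\ge3$ and $\varrho_c=+\infty$ if $d=1,2$ (so that $(\mu/a-\varrho_c)_+=0$ then). Let $\mathbb K(\kappa)=\mathbb R_+\times(\{0\}\cup[\kappa,\infty))$, and let $I^{(\kappa)}(x,y)=f_0(\beta,x)-\mu(x+y)+\frac a2(x+y)^2-\frac b2y^2+p^{(\kappa)}$ on $\mathbb K(\kappa)$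 and $I^{(\kappa)}=+\infty$ elsewhere, where $p^{(\kappa)}$ is the constant that makes $\inf I^{(\kappa)}=0$. For $\kappa\in[0,\infty)$ the transition chemical potential $\mu^*_\kappa$ is the real number such that $I^{(\kappa)}$ has zeroes for every $\mu\ne\mu^*_\kappa$, all of them with second component $0$ if $\mu<\mu^*_\kappa$, and all of them with positive second component if $\mu>\mu^*_\kappa$; write $\mu^*=\mu^*_0$. Let $s_\beta(x)=0$ for $x\ge\varrho_c$ and let $s_\beta(x)$ be the unique $s<0$ with $p_0'(\beta,s)=x$ for $0<x<\varrho_c$; let $\mu_t=\inf_{s<0}\{a\,p_0'(\beta,s)-\frac{a-b}bs\}$; for $\mu\ge\mu_t$ let $\tilde x_2(\mu)$ be the minimal solution $x>0$ of $s_\beta(x)=-\frac b{a-b}(\mu-ax)$; and let $\mu_r=\mu_r(\kappa)=\inf\{s\ge\mu_t:\tilde x_2(s)\le\frac1a(s-\kappa(a-b))\}$. **Theorem (Condensate Density).** The transition potentials $\mu^*_\kappa$, $\kappa\in[0,\infty)$, exist, and the following holds. The values of all limits, and the potentials $\mu^*_\kappa,\hat\mu^*_\kappa$ below, do not depend on the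 chosen sequence of boxes and cut-offs, only on $\kappa$ and the parameters of the model. (a) *$\kappa=0$:* for $\mu\ne\mu^*$ the limits $\Delta^{(0)}(\mu)$ and $\varrho^{(0)}(\mu)$ exist and $\Delta^{(0)}(\mu)=\varrho^{(0)}(\mu)$. At every $\mu\in\mathbb R$ and along every admissible sequence, if one of the two limits exists, then so does the other and they are equal. *$\kappa=\infty$:* $\Delta^{(\infty)}(\mu)$ exists and equals $\big(\frac\mu a-\varrho_c\big)_+$ for every $\mu\in\mathbb R$. *$\kappa\in(0,\infty)$:* there is $\hat\mu^*_\kappa\in[\mu^*_\kappa,\max\{\mu^*_\kappa,\mu_r\}]$ such that $\Delta^{(\kappa)}(\mu)$ exists for all $\mu\neq\hat\mu^*_\kappa$, $\varrho^{(\kappa)}(\mu)$ exists for all $\mu>\hat\mu^*_\kappa$, and $$\Delta^{(\kappa)}(\mu)=\begin{cases}\big(\frac\mu a-\varrho_c\big)_+&\text{for }\mu<\hat\mu^*_\kappa,\\ \varrho^{(\kappa)}(\mu)&\text{for }\mu>\hat\mu^*_\kappa.\end{cases}$$ (b) Let $\mu\in\mathbb R$, $a>0$ and $\kappa\in[0,\infty)$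 be fixed. Then $\Delta^{(\kappa)}(\mu)$ exists for all $b<a$ close enough to $a$, and $\Delta^{(\kappa)}(\mu)\sim\big(\frac\mu{a-b}\big)_+$ as $b\uparrow a$ (for $\mu\le0$ this means that $\Delta^{(\kappa)}(\mu)=0$ for $b$ close to $a$). (c) Let $a>b>0$ and $\kappa\in[0,\infty)$ be fixed. Then $\Delta^{(\kappa)}(\mu)$ exists for all large $\mu$, and $\Delta^{(\kappa)}(\mu)\sim\frac\mu{a-b}$ as $\mu\to\infty$. -/

import Mathlib

open MeasureTheory Filter Topology Asymptotics
open scoped ENNReal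

noncomputable section

namespace CycleHYL

/-! ## The ideal Bose gas -/

/-- The weight `q_k = (4πβ)^{-d/2} k^{-(1+d/2)}` of cycles of length `k ≥ 1`. -/
def cycleWeight (d : ℕ) (β : ℝ) (k : ℕ+) : ℝ :=
  1 / ((4 * Real.pi * β) ^ ((d : ℝ) / 2) * (k : ℝ) ^ (1 + (d : ℝ) / 2))

/-- `q̄^{(α)} = ∑_k q_k e^{βαk}`. The series converges exactly for `α ≤ 0`. -/
def totalWeight (d : ℕ) (β α : ℝ) : ℝ :=
  ∑' k : ℕ+, cycleWeight d β k * Real.exp (β * α * k)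

/-- Pressure `p₀(β,s) = q̄^{(s)} / β` of the ideal Bose gas, used only for `s ≤ 0`; for `s > 0` the
series diverges, that is, `p₀ = +∞`. -/
def idealPressure (d : ℕ) (β s : ℝ) : ℝ :=
  1 / β * totalWeight d β s

/-- Free energy `f₀(β,x) = sup_s (s x - p₀(β,s))` of the ideal Bose gas, for `x ≥ 0`. The supremum
is over the effective domain `s ≤ 0` of `p₀`, as `p₀(β,s) = +∞` for `s > 0`. -/
def freeEnergy (d : ℕ) (β x : ℝ) : ℝ :=
  ⨆ s : Set.Iic (0 : ℝ), ((s : ℝ) * x - idealPressure d β s)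

/-- Critical density of the ideal Bose gas: `(4πβ)^{-d/2} ζ(d/2)` for `d ≥ 3`, and `+∞` for
`d = 1, 2`. -/
def criticalDensity (d : ℕ) (β : ℝ) : EReal :=
  if 3 ≤ d then
    ((1 / (4 * Real.pi * β) ^ ((d : ℝ) / 2) * ∑' k : ℕ+, 1 / (k : ℝ) ^ ((d : ℝ) / 2) : ℝ) : EReal)
  else ⊤

/-- `(μ/a - ϱ_c)_+`. It is finite, as `ϱ_c ≥ 0`, and it is `0` if `ϱ_c = +∞`. -/
def meanFieldExcess (d : ℕ) (β a μ : ℝ) : ℝ :=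
  (max (((μ / a : ℝ) : EReal) - criticalDensity d β) 0).toReal

/-! ## The reference process and the Gibbs distribution in a box of volume `V` -/

/-- Cycle counts: `n k` is the number of cycles of length `k`, and `λ_k = n k / V`. Sequences of
counts with `∑ λ_k < ∞` are finitely supported. -/
abbrev Counts : Type := ℕ+ →₀ ℕ

instance : MeasurableSpace Counts := ⊤

/-- Law of the cycle counts in the ideal gas:
`Q(n) = e^{-V q̄^{(α)}} ∏_k (V q_k e^{βαk})^{n_k} / n_k!`. -/
def referenceMeasure (d : ℕ) (β α V : ℝ) : Measure Counts :=
  Measure.sum fun n : Counts =>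
    ENNReal.ofReal (Real.exp (-(V * totalWeight d β α)) *
      n.prod fun k j => (V * cycleWeight d β k * Real.exp (β * α * k)) ^ j / (j.factorial : ℝ)) •
      Measure.dirac n

/-- Density of particles in cycles of length greater than `K`: `D_K = ∑_{k > K} k λ_k`. -/
def densityAbove (V : ℝ) (K : ℕ) (n : Counts) : ℝ :=
  n.sum fun k j => if K < (k : ℕ) then (k : ℝ) * ((j : ℝ) / V) else 0

/-- Density of particles in cycles of length at least `m`: `∑_{k ≥ m} k λ_k`. -/
def densityFrom (V : ℝ) (m : ℕ) (n : Counts) : ℝ :=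
  n.sum fun k j => if m ≤ (k : ℕ) then (k : ℝ) * ((j : ℝ) / V) else 0

/-- Total particle density `∑_k k λ_k`. -/
def totalDensity (V : ℝ) (n : Counts) : ℝ :=
  n.sum fun k j => (k : ℝ) * ((j : ℝ) / V)

/-- `∑_{k ≥ m} k² λ_k²`. -/
def counterTerm (V : ℝ) (m : ℕ) (n : Counts) : ℝ :=
  n.sum fun k j => if m ≤ (k : ℕ) then (k : ℝ) ^ 2 * ((j : ℝ) / V) ^ 2 else 0

/-- Hamiltonian of the spatial cycle HYL model. -/
def hamiltonian (α a b μ V : ℝ) (m : ℕ) (n : Counts) : ℝ :=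
  V * (-(μ - α) * totalDensity V n + a / 2 * totalDensity V n ^ 2 - b / 2 * counterTerm V m n)

/-- The Gibbs distribution `dP/dQ = e^{-βH} / E_Q[e^{-βH}]`. -/
def gibbsMeasure (d : ℕ) (β α a b μ V : ℝ) (m : ℕ) : Measure Counts :=
  (referenceMeasure d β α V).tilted fun n => -β * hamiltonian α a b μ V m n

/-! ## The thermodynamic limit -/

/-- A sequence of centred boxes `Λ_n` in `ℝ^d` (with side lengths `side n i`) with volumes tending
to infinity, together with cut-offs `m_n → ∞` such that `m_n / |Λ_n| → κ ∈ [0,∞]`. -/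
structure ThermoSeq (d : ℕ) (κ : ℝ≥0∞) where
  side : ℕ → Fin d → ℝ
  cutoff : ℕ → ℕ
  side_pos : ∀ n i, 0 < side n i
  tendsto_volume : Tendsto
    (fun n => (volume (Set.Icc (fun i => -(side n i) / 2) (fun i => side n i / 2))).toReal)
    atTop atTop
  tendsto_cutoff : Tendsto cutoff atTop atTop
  tendsto_ratio : Tendsto
    (fun n => (cutoff n : ℝ≥0∞) /
      volume (Set.Icc (fun i => -(side n i) / 2) (fun i => side n i / 2)))
    atTop (𝓝 κ)

/-- The volume `|Λ_n|`. -/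
def ThermoSeq.vol {d : ℕ} {κ : ℝ≥0∞} (S : ThermoSeq d κ) (n : ℕ) : ℝ :=
  (volume (Set.Icc (fun i => -(S.side n i) / 2) (fun i => S.side n i / 2))).toReal

/-- The Gibbs distribution in the `n`-th box. -/
def ThermoSeq.gibbs {d : ℕ} {κ : ℝ≥0∞} (S : ThermoSeq d κ) (β α a b μ : ℝ) (n : ℕ) :
    Measure Counts :=
  gibbsMeasure d β α a b μ (S.vol n) (S.cutoff n)

/-- `ϱ^{(κ)}(μ) = lim_Λ E_Λ[∑_{k ≥ m_Λ} k λ_k]` exists along `S` and equals `r`. -/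
def HasLongCycleDensity {d : ℕ} {κ : ℝ≥0∞} (S : ThermoSeq d κ) (β α a b μ r : ℝ) : Prop :=
  (∀ n, Integrable (densityFrom (S.vol n) (S.cutoff n)) (S.gibbs β α a b μ n)) ∧
  Tendsto (fun n => ∫ c, densityFrom (S.vol n) (S.cutoff n) c ∂(S.gibbs β α a b μ n))
    atTop (𝓝 r)

/-- `Δ^{(κ)}(μ) = lim_K lim_Λ E_Λ[D_K]` exists along `S` (the inner limit for every `K`) and
equals `r`. -/
def HasCondensateDensity {d : ℕ} {κ : ℝ≥0∞} (S : ThermoSeq d κ) (β α a b μ r : ℝ) : Prop :=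
  (∀ n K, Integrable (densityAbove (S.vol n) K) (S.gibbs β α a b μ n)) ∧
  ∃ D : ℕ → ℝ,
    (∀ K, Tendsto (fun n => ∫ c, densityAbove (S.vol n) K c ∂(S.gibbs β α a b μ n))
      atTop (𝓝 (D K))) ∧
    Tendsto D atTop (𝓝 r)

/-! ## The rate function and the transition chemical potentials -/

/-- The set `𝕂(κ) = ℝ_+ × ({0} ∪ [κ,∞))`. -/
def rateDomain (κ : ℝ≥0∞) : Set (ℝ × ℝ) :=
  {z | 0 ≤ z.1 ∧ 0 ≤ z.2 ∧ (z.2 = 0 ∨ κ ≤ ENNReal.ofReal z.2)}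

/-- `f₀(β,x) - μ(x+y) + (a/2)(x+y)² - (b/2)y²`. -/
def rateEnergy (d : ℕ) (β a b μ : ℝ) (z : ℝ × ℝ) : ℝ :=
  freeEnergy d β z.1 - μ * (z.1 + z.2) + a / 2 * (z.1 + z.2) ^ 2 - b / 2 * z.2 ^ 2

/-- The pressure `p^{(κ)} = sup_{(x,y) ∈ 𝕂(κ)} {μ(x+y) - (a/2)(x+y)² + (b/2)y² - f₀(β,x)}`. -/
def pressure (d : ℕ) (β a b μ : ℝ) (κ : ℝ≥0∞) : ℝ :=
  ⨆ z : rateDomain κ, -rateEnergy d β a b μ z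

open Classical in
/-- The rate function `I^{(κ)}` of the pair empirical particle density. -/
def rateFunction (d : ℕ) (β a b μ : ℝ) (κ : ℝ≥0∞) (z : ℝ × ℝ) : EReal :=
  if z ∈ rateDomain κ then ((rateEnergy d β a b μ z + pressure d β a b μ κ : ℝ) : EReal) else ⊤

/-- The zeroes of the rate function. -/
def rateZeroes (d : ℕ) (β a b μ : ℝ) (κ : ℝ≥0∞) : Set (ℝ × ℝ) :=
  {z | rateFunction d β a b μ κ z = 0}

/-- `ν` is the transition chemical potential `μ*_κ` (with `μ*_0 = μ*`): below `ν` all zeroes of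
the rate function have second component `0`, above `ν` all of them have positive second component
(and zeroes exist, so there is at most one such `ν`). -/
def IsTransitionPotential (d : ℕ) (β a b : ℝ) (κ : ℝ≥0∞) (ν : ℝ) : Prop :=
  (∀ μ < ν, (rateZeroes d β a b μ κ).Nonempty ∧ ∀ z ∈ rateZeroes d β a b μ κ, z.2 = 0) ∧
  (∀ μ > ν, (rateZeroes d β a b μ κ).Nonempty ∧ ∀ z ∈ rateZeroes d β a b μ κ, 0 < z.2)

open Classical in
/-- The function `s_β` on `(0,∞)`: `0` for `x ≥ ϱ_c`, and for `x < ϱ_c` the unique solution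
`s < 0` of `p₀'(β,s) = x` (the supremum is over a one-point set). -/
def sBeta (d : ℕ) (β x : ℝ) : ℝ :=
  if criticalDensity d β ≤ (x : EReal) then 0
  else sSup {s : ℝ | s < 0 ∧ deriv (idealPressure d β) s = x}

/-- `μ_t = inf_{s<0} {a p₀'(β,s) - ((a-b)/b) s}`. -/
def muT (d : ℕ) (β a b : ℝ) : ℝ :=
  ⨅ s : Set.Iio (0 : ℝ), (a * deriv (idealPressure d β) s - (a - b) / b * s)

/-- `x̃₂(μ)`, for `μ ≥ μ_t`: the minimal solution of `s_β(x) = -(b/(a-b)) (μ - a x)`. -/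
def xTwo (d : ℕ) (β a b μ : ℝ) : ℝ :=
  sInf {x : ℝ | 0 < x ∧ sBeta d β x = -(b / (a - b)) * (μ - a * x)}

/-- `μ_r = inf {s ≥ μ_t : x̃₂(s) ≤ (s - κ(a-b))/a}`. -/
def muR (d : ℕ) (β a b κ : ℝ) : ℝ :=
  sInf {s : ℝ | muT d β a b ≤ s ∧ xTwo d β a b s ≤ 1 / a * (s - κ * (a - b))}

end CycleHYL

end

noncomputable section

namespace CycleHYL

/-! ### Cycle weights -/

section Weights

variable {d : ℕ} {β : ℝ}

/-! The reference parameter α cancels from the Gibbs weights, and what remains is a Laplace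
principle for the pair (x, y) of densities of particles in short cycles (k < m) and long cycles (k ≥
m), with ρ = x + y. A Chernoff bound tilted on the short cycles only produces f₀(x), and the counter
term is at most y², so the pair has weight at most exp(-βV E(x, y)) up to e^{o(V)}, where E is
`rateEnergy` (`sum_gibbsWeight_mul_le`). A single configuration, with about V q_k e^{βsk} cycles of
each length k ≤ K and one macroscopic cycle, matches this at a minimiser
(`IsGroundState.eventually_le_partitionFunction`). Since y is 0 or at least m/V, the domain 𝕂(κ)
appears in the limit, and the pair concentrates on the minimisers of E over it
(`tendsto_integral_gibbs_zero`).

For fixed y, minimising over x is the mean-field ideal gas at chemical potential t = μ - ay: the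
minimiser satisfies ax = t - s(t), where s(t) ≤ 0 is conjugate to x. The reduced energy of y has
derivative -s(μ - ay) - by. As s is strictly concave where it is negative, at most one minimiser has
y > 0 (`IsGroundState.not_two_positive`). Raising μ favours long cycles
(`reducedEnergy_zero_lt_of_lt`), hence there is one transition.

Adding one cycle of fixed length k < m changes the weight explicitly, so E[n_k] = V q_k
E[e^{βk(μ-aρ)}] up to a factor tending to 1. Hence E[D_K] is asymptotically the expectation of a
continuous function of (x, y), namely ρ - ∑_{k≤K} k q_k e^{βk(μ-aρ)} (`saturatedExcess`). At a
minimiser with y > 0 the value μ - aρ = s is negative, the sum tends to x, and the excess tends to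
y. At a minimiser with y = 0 the excess tends to (μ/a - ϱ_c)_+. So for κ > 0 the regime changes
exactly at μ*_κ, and for κ = ∞ only y = 0 is admissible. For κ = 0 every y > 0 competes, which rules
out an excess at y = 0; the excess then tends to y at all minimisers, and as there are at most two
of them, Δ and ϱ agree even at the transition (`exists_affine_saturatedExcess`).

The asymptotics in (b) for μ > 0 and in (c) come from comparing a minimiser with (0, μ/(a-b)), which
confines y to within √(2p₀(β,0)/(a-b)) of μ/(a-b). For μ ≤ 0 all minimisers have y = 0. -/

lemma cycleWeight_pos (hβ : 0 < β) (k : ℕ+) : 0 < cycleWeight d β k := by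
  have : (0 : ℝ) < (k : ℝ) := by exact_mod_cast k.pos
  unfold cycleWeight
  positivity

lemma summable_cycleWeight (hd : 1 ≤ d) : Summable (cycleWeight d β) := by
  have hd' : (1 : ℝ) ≤ d := by exact_mod_cast hd
  have h : Summable fun n : ℕ => 1 / (n : ℝ) ^ (1 + (d : ℝ) / 2) :=
    Real.summable_one_div_nat_rpow.mpr (by linarith)
  have h2 := (h.comp_injective PNat.coe_injective).mul_left (1 / (4 * Real.pi * β) ^ ((d : ℝ) / 2))
  refine h2.congr fun k => ?_
  simp only [Function.comp, cycleWeight]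
  rw [one_div_mul_one_div]

lemma summable_cycleWeight_mul_exp (hd : 1 ≤ d) (hβ : 0 < β) {s : ℝ} (hs : s ≤ 0) :
    Summable fun k : ℕ+ => cycleWeight d β k * Real.exp (β * s * k) := by
  refine Summable.of_nonneg_of_le (fun k => ?_) (fun k => ?_) (summable_cycleWeight (β := β) hd)
  · have := cycleWeight_pos (d := d) hβ k
    positivity
  · have h1 : Real.exp (β * s * k) ≤ 1 := by
      rw [Real.exp_le_one_iff]
      have : (0 : ℝ) ≤ (k : ℝ) := by positivity
      have : β * s ≤ 0 := by nlinarith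
      nlinarith
    have := cycleWeight_pos (d := d) hβ k
    nlinarith

end Weights

/-! ### Sums over cycle counts -/

/-- The product `∏ k, (c k) ^ n k / (n k)!`. -/
def poissonWeight (c : ℕ+ → ℝ) (n : Counts) : ℝ :=
  n.prod fun k j => c k ^ j / (j.factorial : ℝ)

lemma poissonWeight_nonneg {c : ℕ+ → ℝ} (hc : ∀ k, 0 ≤ c k) (n : Counts) :
    0 ≤ poissonWeight c n :=
  Finset.prod_nonneg fun k _ => div_nonneg (pow_nonneg (hc k) _) (by positivity)

lemma poissonWeight_pos {c : ℕ+ → ℝ} (hc : ∀ k, 0 < c k) (n : Counts) :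
    0 < poissonWeight c n :=
  Finset.prod_pos fun k _ => div_pos (pow_pos (hc k) _) (by positivity)

lemma sum_pow_div_factorial_le_exp {x : ℝ} (hx : 0 ≤ x) (B : ℕ) :
    ∑ j ∈ Finset.range B, x ^ j / (j.factorial : ℝ) ≤ Real.exp x :=
  Real.sum_le_exp_of_nonneg hx B

/-- Any finite set of configurations lies in a box with finitely many cycle lengths and bounded
counts. On the box the sum factorises into truncated exponential series. -/
lemma sum_poissonWeight_le {c : ℕ+ → ℝ} (hc : ∀ k, 0 ≤ c k) (hs : Summable c)
    (T : Finset Counts) : ∑ n ∈ T, poissonWeight c n ≤ Real.exp (∑' k, c k) := by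
  set S : Finset ℕ+ := T.biUnion fun n => n.support with hS
  set B : ℕ := (T.sup fun n => S.sup fun k => n k) + 1 with hB
  have hsub : T ⊆ S.finsupp fun _ => Finset.range B := by
    intro n hn
    rw [Finset.mem_finsupp_iff]
    refine ⟨fun k hk => Finset.mem_biUnion.mpr ⟨n, hn, hk⟩, fun k hk => ?_⟩
    rw [Finset.mem_range, hB, Nat.lt_succ_iff]
    exact (Finset.le_sup (f := fun k => n k) hk).trans
      (Finset.le_sup (f := fun n : Counts => S.sup fun k => n k) hn)
  calc ∑ n ∈ T, poissonWeight c n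
      ≤ ∑ n ∈ S.finsupp fun _ => Finset.range B, poissonWeight c n :=
        Finset.sum_le_sum_of_subset_of_nonneg hsub fun n _ _ => poissonWeight_nonneg hc n
    _ = ∑ n ∈ S.finsupp fun _ => Finset.range B, ∏ k ∈ S, c k ^ n k / ((n k).factorial : ℝ) := by
        refine Finset.sum_congr rfl fun n hn => ?_
        exact Finsupp.prod_of_support_subset n (Finset.mem_finsupp_iff.mp hn).1 _ (by simp)
    _ = ∏ k ∈ S, ∑ j ∈ Finset.range B, c k ^ j / (j.factorial : ℝ) := by
        rw [Finset.prod_sum, Finset.finsupp, Finset.sum_map]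
        refine Finset.sum_congr (by congr!) fun p _ => ?_
        rw [← Finset.prod_attach]
        refine Finset.prod_congr rfl fun k _ => ?_
        simp [Finsupp.indicator_of_mem k.2]
    _ ≤ ∏ k ∈ S, Real.exp (c k) :=
        Finset.prod_le_prod
          (fun k _ => Finset.sum_nonneg fun j _ => div_nonneg (pow_nonneg (hc k) _) (by positivity))
          fun k _ => sum_pow_div_factorial_le_exp (hc k) B
    _ = Real.exp (∑ k ∈ S, c k) := (Real.exp_sum _ _).symm
    _ ≤ Real.exp (∑' k, c k) := Real.exp_le_exp.mpr (hs.sum_le_tsum _ fun k _ => hc k)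

lemma poissonWeight_mul (c e : ℕ+ → ℝ) (n : Counts) :
    poissonWeight (fun k => c k * e k) n = poissonWeight c n * n.prod fun k j => e k ^ j := by
  unfold poissonWeight Finsupp.prod
  rw [← Finset.prod_mul_distrib]
  refine Finset.prod_congr rfl fun k _ => ?_
  simp only [mul_pow]
  ring

lemma prod_exp_pow (h : ℕ+ → ℝ) (n : Counts) :
    (n.prod fun k j => Real.exp (h k) ^ j) = Real.exp (n.sum fun k j => h k * j) := by
  unfold Finsupp.prod Finsupp.sum
  rw [Real.exp_sum]
  refine Finset.prod_congr rfl fun k _ => ?_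
  simp only [← Real.exp_nat_mul, mul_comm]

/-- The Gibbs weight of a configuration with respect to counting measure. -/
def gibbsWeight (d : ℕ) (β a b μ V : ℝ) (m : ℕ) (n : Counts) : ℝ :=
  poissonWeight (fun k => V * cycleWeight d β k) n *
    Real.exp (β * V * (μ * totalDensity V n - a / 2 * totalDensity V n ^ 2
      + b / 2 * counterTerm V m n))

lemma gibbsWeight_pos {d : ℕ} {β a b μ V : ℝ} (hβ : 0 < β) (hV : 0 < V) (m : ℕ) (n : Counts) :
    0 < gibbsWeight d β a b μ V m n :=
  mul_pos (poissonWeight_pos (fun k => mul_pos hV (cycleWeight_pos hβ k)) n) (Real.exp_pos _)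

/-- The partition function. -/
def partitionFunction (d : ℕ) (β a b μ V : ℝ) (m : ℕ) : ℝ :=
  ∑' n, gibbsWeight d β a b μ V m n

/-- The factors e^{βαk} multiply to e^{βαVρ}, which the shift μ - α in the Hamiltonian undoes. Only
a constant prefactor depends on α, and it drops out of Gibbs expectations. -/
lemma reference_mul_exp_hamiltonian {d : ℕ} {β α a b μ V : ℝ} (hV : 0 < V) (m : ℕ) (n : Counts) :
    Real.exp (-(V * totalWeight d β α)) *
      (n.prod fun k j => (V * cycleWeight d β k * Real.exp (β * α * k)) ^ j / (j.factorial : ℝ)) *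
      Real.exp (-β * hamiltonian α a b μ V m n) =
    Real.exp (-(V * totalWeight d β α)) * gibbsWeight d β a b μ V m n := by
  have h1 : (n.prod fun k j =>
      (V * cycleWeight d β k * Real.exp (β * α * k)) ^ j / (j.factorial : ℝ)) =
      poissonWeight (fun k => V * cycleWeight d β k) n *
        Real.exp (β * α * V * totalDensity V n) := by
    have := poissonWeight_mul (fun k => V * cycleWeight d β k)
      (fun k : ℕ+ => Real.exp (β * α * k)) n
    rw [prod_exp_pow] at this
    unfold poissonWeight at this ⊢
    rw [this]
    congr 2
    unfold totalDensity
    simp only [Finsupp.sum]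
    rw [Finset.mul_sum]
    refine Finset.sum_congr rfl fun k _ => ?_
    field_simp
  rw [h1, gibbsWeight, mul_assoc, mul_assoc, ← Real.exp_add]
  congr 3
  unfold hamiltonian
  ring

/-! ### Gibbs expectations as quotients of series -/

section Expectation

variable {d : ℕ} {β α a b μ V : ℝ} {m : ℕ}

lemma toReal_reference_coeff (hβ : 0 < β) (hV : 0 < V) (n : Counts) :
    (ENNReal.ofReal (Real.exp (-(V * totalWeight d β α)) *
      n.prod fun k j => (V * cycleWeight d β k * Real.exp (β * α * k)) ^ j /
        (j.factorial : ℝ))).toReal =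
    Real.exp (-(V * totalWeight d β α)) *
      n.prod fun k j => (V * cycleWeight d β k * Real.exp (β * α * k)) ^ j /
        (j.factorial : ℝ) := by
  refine ENNReal.toReal_ofReal (mul_nonneg (Real.exp_pos _).le ?_)
  exact poissonWeight_nonneg (c := fun k => V * cycleWeight d β k * Real.exp (β * α * k))
    (fun k => by have := cycleWeight_pos (d := d) hβ k; positivity) n

lemma integrable_exp_hamiltonian_smul (hβ : 0 < β) (hV : 0 < V) {g : Counts → ℝ}
    (hg : Summable fun n => gibbsWeight d β a b μ V m n * |g n|) :
    Integrable (fun n => Real.exp (-β * hamiltonian α a b μ V m n) • g n)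
      (referenceMeasure d β α V) := by
  refine integrable_sum_dirac (fun n => ENNReal.ofReal_ne_top) ?_
  refine (hg.mul_left (Real.exp (-(V * totalWeight d β α)))).congr fun n => ?_
  rw [toReal_reference_coeff hβ hV, norm_smul, Real.norm_eq_abs, Real.norm_eq_abs, Real.abs_exp,
    ← mul_assoc, ← mul_assoc, reference_mul_exp_hamiltonian hV]

lemma integral_exp_hamiltonian_smul (hβ : 0 < β) (hV : 0 < V) (g : Counts → ℝ) :
    ∫ n, Real.exp (-β * hamiltonian α a b μ V m n) • g n ∂(referenceMeasure d β α V) =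
      Real.exp (-(V * totalWeight d β α)) * ∑' n, gibbsWeight d β a b μ V m n * g n := by
  unfold referenceMeasure
  rw [integral_sum_dirac (fun n => ENNReal.ofReal_ne_top), ← tsum_mul_left]
  refine tsum_congr fun n => ?_
  rw [toReal_reference_coeff hβ hV, smul_eq_mul, smul_eq_mul, ← mul_assoc, ← mul_assoc,
    reference_mul_exp_hamiltonian hV]

lemma integrable_gibbs (hβ : 0 < β) (hV : 0 < V)
    (hZ : Summable (gibbsWeight d β a b μ V m)) {g : Counts → ℝ}
    (hg : Summable fun n => gibbsWeight d β a b μ V m n * |g n|) :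
    Integrable g (gibbsMeasure d β α a b μ V m) := by
  unfold gibbsMeasure
  rw [integrable_tilted_iff]
  · exact integrable_exp_hamiltonian_smul hβ hV hg
  · have := integrable_exp_hamiltonian_smul (α := α) hβ hV (g := fun _ => 1) (by simpa using hZ)
    simpa using this

lemma integral_gibbs (hβ : 0 < β) (hV : 0 < V) (g : Counts → ℝ) :
    ∫ n, g n ∂(gibbsMeasure d β α a b μ V m) =
      (∑' n, gibbsWeight d β a b μ V m n * g n) / partitionFunction d β a b μ V m := by
  unfold gibbsMeasure
  rw [integral_tilted]
  have hZ := integral_exp_hamiltonian_smul (d := d) (α := α) (a := a) (b := b) (μ := μ) (m := m)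
    hβ hV (fun _ => 1)
  simp only [smul_eq_mul, mul_one] at hZ
  have hg := integral_exp_hamiltonian_smul (d := d) (α := α) (a := a) (b := b) (μ := μ) (m := m)
    hβ hV g
  simp only [div_eq_inv_mul, smul_eq_mul, mul_assoc]
  rw [hZ, integral_const_mul]
  simp only [smul_eq_mul] at hg
  rw [hg, partitionFunction, mul_inv, mul_assoc, inv_mul_eq_div,
    inv_mul_eq_div]
  have := Real.exp_pos (-(V * totalWeight d β α))
  field_simp

end Expectation

/-! ### Short and long cycles -/

/-- The number of particles in cycles of length less than `m`. -/
def shortMass (m : ℕ) (n : Counts) : ℕ :=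
  n.sum fun k j => if (k : ℕ) < m then (k : ℕ) * j else 0

/-- The number of particles in cycles of length at least `m`. -/
def longMass (m : ℕ) (n : Counts) : ℕ :=
  n.sum fun k j => if m ≤ (k : ℕ) then (k : ℕ) * j else 0

lemma totalDensity_eq (V : ℝ) (m : ℕ) (n : Counts) :
    totalDensity V n = (shortMass m n : ℝ) / V + (longMass m n : ℝ) / V := by
  simp only [totalDensity, shortMass, longMass, Finsupp.sum, ← add_div, ← Nat.cast_add,
    ← Finset.sum_add_distrib]
  push_cast
  rw [Finset.sum_div]
  refine Finset.sum_congr rfl fun k _ => ?_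
  by_cases h : (k : ℕ) < m
  · simp [h, not_le.mpr h, mul_div_assoc]
  · simp [h, not_lt.mp h, mul_div_assoc]

lemma densityFrom_eq (V : ℝ) (m : ℕ) (n : Counts) :
    densityFrom V m n = (longMass m n : ℝ) / V := by
  simp only [densityFrom, longMass, Finsupp.sum]
  push_cast
  rw [Finset.sum_div]
  refine Finset.sum_congr rfl fun k _ => ?_
  by_cases h : m ≤ (k : ℕ)
  · simp [h, mul_div_assoc]
  · simp [h]

lemma totalDensity_nonneg {V : ℝ} (hV : 0 < V) (n : Counts) : 0 ≤ totalDensity V n := by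
  rw [totalDensity_eq V 0]; positivity

/-- A single long cycle already holds m particles. This gap becomes the constraint y = 0 or y ≥ κ in
the limit. -/
lemma le_longMass (m : ℕ) (n : Counts) : longMass m n = 0 ∨ m ≤ longMass m n := by
  by_cases h : ∃ k ∈ n.support, m ≤ (k : ℕ)
  · right
    obtain ⟨k, hk, hm⟩ := h
    have hk' : 1 ≤ n k := Nat.one_le_iff_ne_zero.mpr (Finsupp.mem_support_iff.mp hk)
    calc m ≤ (k : ℕ) * n k := hm.trans (Nat.le_mul_of_pos_right _ hk')
      _ = if m ≤ (k : ℕ) then (k : ℕ) * n k else 0 := by simp [hm]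
      _ ≤ longMass m n :=
        Finset.single_le_sum (f := fun k : ℕ+ => if m ≤ (k : ℕ) then (k : ℕ) * n k else 0)
          (fun _ _ => Nat.zero_le _) hk
  · left
    push Not at h
    exact Finset.sum_eq_zero fun k hk => by simp [h k hk]

/-- A sum of squares of nonnegative numbers is at most the square of their sum. Nothing is lost if
only one long length is occupied, which is why one macroscopic cycle suffices in the lower bound. -/
lemma counterTerm_le {V : ℝ} (hV : 0 < V) (m : ℕ) (n : Counts) :
    counterTerm V m n ≤ ((longMass m n : ℝ) / V) ^ 2 := by
  rw [← densityFrom_eq]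
  have h : counterTerm V m n = n.sum fun k j =>
      (if m ≤ (k : ℕ) then (k : ℝ) * ((j : ℝ) / V) else 0) ^ 2 := by
    simp only [counterTerm, Finsupp.sum]
    refine Finset.sum_congr rfl fun k _ => ?_
    split_ifs <;> ring
  rw [h]
  refine Finset.sum_sq_le_sq_sum_of_nonneg fun k _ => ?_
  split_ifs <;> positivity

/-- `∑_{k ≥ m} q_k`. -/
def tailWeight (d : ℕ) (β : ℝ) (m : ℕ) : ℝ :=
  ∑' k : ℕ+, if m ≤ (k : ℕ) then cycleWeight d β k else 0

lemma tendsto_tailWeight {d : ℕ} {β : ℝ} (hd : 1 ≤ d) (hβ : 0 < β) :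
    Tendsto (tailWeight d β) atTop (𝓝 0) := by
  have h := tendsto_tsum_of_dominated_convergence (𝓕 := atTop)
    (f := fun (m : ℕ) (k : ℕ+) => if m ≤ (k : ℕ) then cycleWeight d β k else 0)
    (g := fun _ => 0) (bound := cycleWeight d β) (summable_cycleWeight hd) ?_ ?_
  · rw [tsum_zero] at h
    exact h
  · intro k
    refine tendsto_const_nhds.congr' ?_
    filter_upwards [eventually_gt_atTop (k : ℕ)] with m hm
    simp [not_le.mpr hm]
  · refine Eventually.of_forall fun m k => ?_
    have := cycleWeight_pos (d := d) hβ k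
    split_ifs
    · rw [Real.norm_eq_abs, abs_of_pos this]
    · simpa using this.le

/-! ### Exponential upper bounds -/

section Bounds

variable {d : ℕ} {β a b μ V : ℝ} {m : ℕ}

lemma beta_mul_idealPressure (hβ : 0 < β) (s : ℝ) :
    β * idealPressure d β s = totalWeight d β s := by
  unfold idealPressure
  field_simp

/-- Chernoff bound: the short cycles are tilted by e^{βsk}, which is constant on the fiber. The long
cycles stay untilted and cost only V `tailWeight`, which is o(V) once m → ∞. -/
lemma sum_poissonWeight_fiber_le_exp (hd : 1 ≤ d) (hβ : 0 < β) (hV : 0 < V) {M L : ℕ}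
    (T : Finset Counts) (hT : ∀ n ∈ T, shortMass m n = M ∧ longMass m n = L) {s : ℝ} (hs : s ≤ 0) :
    ∑ n ∈ T, poissonWeight (fun k => V * cycleWeight d β k) n ≤
      Real.exp (-(β * V * (s * (M / V) - idealPressure d β s)) + V * tailWeight d β m) := by
  set h : ℕ+ → ℝ := fun k => if (k : ℕ) < m then β * s * k else 0 with hh
  have hq := fun k => cycleWeight_pos (d := d) hβ k
  have hle : ∀ k, V * cycleWeight d β k * Real.exp (h k) ≤
      V * (cycleWeight d β k * Real.exp (β * s * k)) +
        V * (if m ≤ (k : ℕ) then cycleWeight d β k else 0) := by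
    intro k
    have := hq k
    by_cases hk : (k : ℕ) < m
    · simp [hh, hk, not_le.mpr hk, mul_assoc]
    · simp only [hh, hk, not_lt.mp hk, if_true, if_false, Real.exp_zero, mul_one]
      have : 0 ≤ V * (cycleWeight d β k * Real.exp (β * s * k)) := by positivity
      linarith
  have hpos : ∀ k, 0 ≤ V * cycleWeight d β k * Real.exp (h k) := fun k => by
    have := hq k; positivity
  have hs1 := (summable_cycleWeight_mul_exp hd hβ hs).mul_left V
  have hs2 : Summable fun k : ℕ+ => if m ≤ (k : ℕ) then cycleWeight d β k else 0 :=
    Summable.of_nonneg_of_le (fun k => by have := (hq k).le; split_ifs <;> simp [this])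
      (fun k => by have := (hq k).le; split_ifs <;> [exact le_rfl; exact this]) (summable_cycleWeight (β := β) hd)
  have hsum := Summable.of_nonneg_of_le hpos hle (hs1.add (hs2.mul_left V))
  have key := sum_poissonWeight_le hpos hsum T
  have htsum : ∑' k, V * cycleWeight d β k * Real.exp (h k) ≤
      V * totalWeight d β s + V * tailWeight d β m := by
    refine (hsum.tsum_le_tsum hle (hs1.add (hs2.mul_left V))).trans_eq ?_
    rw [hs1.tsum_add (hs2.mul_left V), tsum_mul_left, tsum_mul_left]
    rfl
  have heq : ∑ n ∈ T, poissonWeight (fun k => V * cycleWeight d β k * Real.exp (h k)) n =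
      (∑ n ∈ T, poissonWeight (fun k => V * cycleWeight d β k) n) * Real.exp (β * s * M) := by
    rw [Finset.sum_mul]
    refine Finset.sum_congr rfl fun n hn => ?_
    rw [poissonWeight_mul (fun k => V * cycleWeight d β k), prod_exp_pow]
    congr 2
    rw [← (hT n hn).1, shortMass, Finsupp.sum, Finsupp.sum]
    push_cast
    rw [Finset.mul_sum]
    refine Finset.sum_congr rfl fun k _ => ?_
    simp only [hh]
    split_ifs <;> ring
  rw [heq] at key
  have h2 := key.trans (Real.exp_le_exp.mpr htsum)
  rw [← le_div_iff₀ (Real.exp_pos _), ← Real.exp_sub] at h2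
  refine h2.trans_eq ?_
  congr 1
  rw [← beta_mul_idealPressure hβ]
  field_simp
  ring

/-- The preceding bound holds for every s ≤ 0. Taking logarithms turns it into an upper bound on
each member of the supremum defining the free energy. -/
lemma sum_poissonWeight_fiber_le (hd : 1 ≤ d) (hβ : 0 < β) (hV : 0 < V) {M L : ℕ}
    (T : Finset Counts) (hT : ∀ n ∈ T, shortMass m n = M ∧ longMass m n = L) :
    ∑ n ∈ T, poissonWeight (fun k => V * cycleWeight d β k) n ≤
      Real.exp (-(β * V * freeEnergy d β (M / V)) + V * tailWeight d β m) := by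
  set S := ∑ n ∈ T, poissonWeight (fun k => V * cycleWeight d β k) n with hS
  have hS0 : 0 ≤ S := Finset.sum_nonneg fun n _ =>
    poissonWeight_nonneg (fun k => (mul_pos hV (cycleWeight_pos hβ k)).le) n
  rcases hS0.eq_or_lt with h | h
  · rw [← h]; exact (Real.exp_pos _).le
  have hβV : 0 < β * V := mul_pos hβ hV
  have hf : freeEnergy d β (M / V) ≤ (V * tailWeight d β m - Real.log S) / (β * V) := by
    refine ciSup_le fun s => ?_
    have h1 := sum_poissonWeight_fiber_le_exp (m := m) hd hβ hV T hT s.2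
    rw [← hS, ← Real.log_le_iff_le_exp h] at h1
    rw [le_div_iff₀ hβV]
    nlinarith
  rw [le_div_iff₀ hβV] at hf
  rw [← Real.log_le_iff_le_exp h]
  nlinarith

/-- The free energy is added so that the energy can be written as `rateEnergy`; it cancels against
the entropy bound on the fibers. -/
lemma gibbsWeight_le (hβ : 0 < β) (hV : 0 < V) (hb : 0 ≤ b) (n : Counts) :
    gibbsWeight d β a b μ V m n ≤ poissonWeight (fun k => V * cycleWeight d β k) n *
      Real.exp (β * V * (freeEnergy d β (shortMass m n / V) -
        rateEnergy d β a b μ (shortMass m n / V, longMass m n / V))) := by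
  unfold gibbsWeight
  refine mul_le_mul_of_nonneg_left (Real.exp_le_exp.mpr ?_)
    (poissonWeight_nonneg (fun k => (mul_pos hV (cycleWeight_pos hβ k)).le) n)
  refine mul_le_mul_of_nonneg_left ?_ (mul_pos hβ hV).le
  have := mul_le_mul_of_nonneg_left (counterTerm_le hV m n) (by positivity : 0 ≤ b / 2)
  rw [totalDensity_eq V m]
  simp only [rateEnergy]
  linarith

/-- Exponential upper bound on the total Gibbs weight of configurations of large energy. -/
lemma sum_gibbsWeight_mul_le (hd : 1 ≤ d) (hβ : 0 < β) (hV : 0 < V) (hb : 0 ≤ b) {e η : ℝ}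
    (hη : 0 < η) (T : Finset Counts)
    (hT : ∀ n ∈ T, e + η * (1 + totalDensity V n) ≤
      rateEnergy d β a b μ (shortMass m n / V, longMass m n / V)) :
    ∑ n ∈ T, gibbsWeight d β a b μ V m n * (1 + totalDensity V n) ≤
      Real.exp (-(β * V * e) + V * tailWeight d β m) *
        (2 / (β * η * V) * Real.exp (-(β * η / 2 * V)) *
          ((1 - Real.exp (-(β * η / 2)))⁻¹ ^ 2)) := by
  classical
  set r := Real.exp (-(β * η / 2)) with hr
  have hr0 : 0 < r := Real.exp_pos _
  have hr1 : r < 1 := by rw [hr, Real.exp_lt_one_iff]; simp; positivity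
  set φ : Counts → ℕ × ℕ := fun n => (shortMass m n, longMass m n) with hφ
  set A := Real.exp (-(β * V * e) + V * tailWeight d β m) *
        (2 / (β * η * V) * Real.exp (-(β * η / 2 * V))) with hA
  have hA0 : 0 < A := by positivity
  have hfib : ∀ p ∈ T.image φ, ∑ n ∈ T with φ n = p,
      gibbsWeight d β a b μ V m n * (1 + totalDensity V n) ≤ A * (r ^ p.1 * r ^ p.2) := by
    intro p hp
    obtain ⟨n₀, hn₀, rfl⟩ := Finset.mem_image.mp hp
    have hE := hT n₀ hn₀
    set x : ℝ := (shortMass m n₀ : ℝ) / V with hx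
    set y : ℝ := (longMass m n₀ : ℝ) / V with hy
    have hx0 : 0 ≤ x := by positivity
    have hy0 : 0 ≤ y := by positivity
    rw [totalDensity_eq V m] at hE
    have h1 : ∑ n ∈ T with φ n = φ n₀, gibbsWeight d β a b μ V m n * (1 + totalDensity V n) ≤
        (∑ n ∈ T with φ n = φ n₀, poissonWeight (fun k => V * cycleWeight d β k) n) *
          (Real.exp (β * V * (freeEnergy d β x - rateEnergy d β a b μ (x, y))) * (1 + (x + y))) := by
      rw [Finset.sum_mul]
      refine Finset.sum_le_sum fun n hn => ?_
      have hn' := (Finset.mem_filter.mp hn).2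
      have e1 : shortMass m n = shortMass m n₀ := congrArg Prod.fst hn'
      have e2 : longMass m n = longMass m n₀ := congrArg Prod.snd hn'
      have := gibbsWeight_le (d := d) (a := a) (μ := μ) (m := m) hβ hV hb n
      rw [totalDensity_eq V m, e1, e2, ← mul_assoc]
      rw [e1, e2] at this
      exact mul_le_mul_of_nonneg_right this (by positivity)
    have h2 := sum_poissonWeight_fiber_le (d := d) (β := β) (m := m) (M := shortMass m n₀)
      (L := longMass m n₀) hd hβ hV {n ∈ T | φ n = φ n₀} (fun n hn => by
        have hn' := (Finset.mem_filter.mp hn).2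
        exact ⟨congrArg Prod.fst hn', congrArg Prod.snd hn'⟩)
    refine h1.trans ((mul_le_mul_of_nonneg_right h2 (by positivity)).trans ?_)
    rw [← mul_assoc, ← Real.exp_add]
    -- The energy surplus on this fiber gives e^{-2t}. One factor e^{-t} absorbs 1 + x + y by t + 1
    -- ≤ e^t; the other is e^{-βηV/2} times a geometric weight, summable over all pairs of particle
    -- numbers.
    set t := β * η * V / 2 * (1 + (x + y)) with ht
    have h3 : 1 + (x + y) ≤ 2 / (β * η * V) * Real.exp t := by
      have := Real.add_one_le_exp t
      have h4 : 1 + (x + y) = 2 / (β * η * V) * t := by rw [ht]; field_simp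
      rw [h4]
      exact mul_le_mul_of_nonneg_left (by linarith) (by positivity)
    have h5 : -(β * V * freeEnergy d β x) + V * tailWeight d β m +
        β * V * (freeEnergy d β x - rateEnergy d β a b μ (x, y)) ≤
        (-(β * V * e) + V * tailWeight d β m) + (-(2 * t)) := by
      have := mul_le_mul_of_nonneg_left hE (mul_pos hβ hV).le
      have h6 : 2 * t = β * V * (η * (1 + (x + y))) := by rw [ht]; ring
      rw [h6]
      linarith
    calc _ ≤ Real.exp ((-(β * V * e) + V * tailWeight d β m) + (-(2 * t))) *
          (2 / (β * η * V) * Real.exp t) :=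
          mul_le_mul (Real.exp_le_exp.mpr h5) h3 (by positivity) (Real.exp_pos _).le
      _ = A * (r ^ (φ n₀).1 * r ^ (φ n₀).2) := by
          rw [hA, hr, ← Real.exp_nat_mul, ← Real.exp_nat_mul, ← Real.exp_add, Real.exp_add,
            mul_mul_mul_comm, mul_assoc (Real.exp (-(β * V * e) + V * tailWeight d β m)),
            mul_assoc (Real.exp (-(β * V * e) + V * tailWeight d β m)),
            mul_assoc (2 / (β * η * V)), ← Real.exp_add, ← Real.exp_add]
          congr 3
          simp only [hφ]
          rw [ht, hx, hy]
          field_simp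
          ring
  have hgeo := summable_geometric_of_lt_one hr0.le hr1
  have hprod : Summable fun p : ℕ × ℕ => r ^ p.1 * r ^ p.2 :=
    hgeo.mul_of_nonneg hgeo (fun _ => by positivity) (fun _ => by positivity)
  calc ∑ n ∈ T, gibbsWeight d β a b μ V m n * (1 + totalDensity V n)
      = ∑ p ∈ T.image φ, ∑ n ∈ T with φ n = p,
        gibbsWeight d β a b μ V m n * (1 + totalDensity V n) :=
        (Finset.sum_fiberwise_of_maps_to (fun n hn => Finset.mem_image_of_mem φ hn) _).symm
    _ ≤ ∑ p ∈ T.image φ, A * (r ^ p.1 * r ^ p.2) := Finset.sum_le_sum hfib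
    _ = A * ∑ p ∈ T.image φ, r ^ p.1 * r ^ p.2 := (Finset.mul_sum _ _ _).symm
    _ ≤ A * ∑' p : ℕ × ℕ, r ^ p.1 * r ^ p.2 :=
        mul_le_mul_of_nonneg_left (hprod.sum_le_tsum _ fun p _ => by positivity) hA0.le
    _ = _ := by
        rw [← hgeo.tsum_mul_tsum hgeo hprod, tsum_geometric_of_lt_one hr0.le hr1, hA]
        ring

end Bounds

/-! ### Adding one cycle -/

section Mecke

variable {d : ℕ} {β a b μ V : ℝ} {m : ℕ}

lemma erase_add_single (n : Counts) (k : ℕ+) :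
    Finsupp.erase k (n + Finsupp.single k 1) = Finsupp.erase k n := by
  ext i
  by_cases h : i = k
  · simp [h]
  · simp [Finsupp.erase_ne h]

/-- The counter term does not see lengths below m, so only the quadratic mean-field term reacts. The
term k²/(2V) is the interaction of the new cycle with itself. -/
lemma gibbsWeight_add_single (hV : 0 < V) (n : Counts) {k : ℕ+} (hk : (k : ℕ) < m) :
    gibbsWeight d β a b μ V m (n + Finsupp.single k 1) * ((n + Finsupp.single k 1 : Counts) k : ℝ) =
      V * cycleWeight d β k * (gibbsWeight d β a b μ V m n *
        Real.exp (β * k * (μ - a * totalDensity V n) - β * a * k ^ 2 / (2 * V))) := by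
  have hp : poissonWeight (fun k => V * cycleWeight d β k) (n + Finsupp.single k 1) *
      ((n + Finsupp.single k 1 : Counts) k : ℝ) =
      V * cycleWeight d β k * poissonWeight (fun k => V * cycleWeight d β k) n := by
    unfold poissonWeight
    rw [← Finsupp.mul_prod_erase' (n + Finsupp.single k 1) k _ (by simp),
      ← Finsupp.mul_prod_erase' n k _ (by simp), erase_add_single]
    simp only [Finsupp.coe_add, Pi.add_apply, Finsupp.single_eq_same, Nat.factorial_succ]
    push_cast
    have : ((n k).factorial : ℝ) ≠ 0 := by positivity
    field_simp
    ring
  have ht : totalDensity V (n + Finsupp.single k 1) = totalDensity V n + k / V := by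
    unfold totalDensity
    rw [← Finsupp.add_sum_erase' (n + Finsupp.single k 1) k _ (by simp),
      ← Finsupp.add_sum_erase' n k _ (by simp), erase_add_single]
    simp only [Finsupp.coe_add, Pi.add_apply, Finsupp.single_eq_same]
    push_cast
    ring
  have hc : counterTerm V m (n + Finsupp.single k 1) = counterTerm V m n := by
    unfold counterTerm
    rw [← Finsupp.add_sum_erase' (n + Finsupp.single k 1) k _ (by simp),
      ← Finsupp.add_sum_erase' n k _ (by simp), erase_add_single]
    simp [not_le.mpr hk]
  have he : Real.exp (β * V * (μ * (totalDensity V n + k / V) -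
      a / 2 * (totalDensity V n + k / V) ^ 2 + b / 2 * counterTerm V m n)) =
      Real.exp (β * V * (μ * totalDensity V n - a / 2 * totalDensity V n ^ 2 +
        b / 2 * counterTerm V m n)) *
      Real.exp (β * k * (μ - a * totalDensity V n) - β * a * k ^ 2 / (2 * V)) := by
    rw [← Real.exp_add]
    congr 1
    field_simp
    ring
  unfold gibbsWeight
  rw [ht, hc, he, mul_right_comm, hp]
  ring

/-- Mecke's identity: configurations without a cycle of length k contribute nothing on the left, and
all others arise uniquely by adding one. -/
lemma tsum_gibbsWeight_mul_count (hV : 0 < V) {k : ℕ+} (hk : (k : ℕ) < m) :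
    ∑' n, gibbsWeight d β a b μ V m n * (n k : ℝ) =
      V * cycleWeight d β k * ∑' n, gibbsWeight d β a b μ V m n *
        Real.exp (β * k * (μ - a * totalDensity V n) - β * a * k ^ 2 / (2 * V)) := by
  have hinj : Function.Injective fun n : Counts => n + Finsupp.single k 1 :=
    fun n n' h => add_right_cancel h
  rw [← hinj.tsum_eq, ← tsum_mul_left]
  · exact tsum_congr fun n => gibbsWeight_add_single hV n hk
  · intro n hn
    have h0 : n k ≠ 0 := by
      intro h
      simp [h] at hn
    refine ⟨n - Finsupp.single k 1, ?_⟩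
    have : Finsupp.single k 1 ≤ n := by
      rw [Finsupp.single_le_iff]
      omega
    exact tsub_add_cancel_of_le this

end Mecke

/-! ### Conjugate pairs of the ideal gas -/

/-- The density `k q_k e^{βsk}` of particles in cycles of length `k`. -/
def cycleDensity (d : ℕ) (β s : ℝ) (k : ℕ+) : ℝ :=
  k * cycleWeight d β k * Real.exp (β * s * k)

/-- `s` is a subgradient of the free energy at `x`. -/
structure IsConjugate (d : ℕ) (β s x : ℝ) : Prop where
  nonpos : s ≤ 0
  sum_le : ∀ F : Finset ℕ+, ∑ k ∈ F, cycleDensity d β s k ≤ x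
  hasSum : s < 0 → HasSum (cycleDensity d β s) x

section Conjugate

variable {d : ℕ} {β : ℝ}

lemma one_le_cast (k : ℕ+) : (1 : ℝ) ≤ (k : ℝ) := by exact_mod_cast one_le

lemma cycleDensity_pos (hβ : 0 < β) (s : ℝ) (k : ℕ+) : 0 < cycleDensity d β s k := by
  have := cycleWeight_pos (d := d) hβ k
  have := one_le_cast k
  unfold cycleDensity
  positivity

lemma cycleDensity_mono (hβ : 0 < β) (k : ℕ+) : Monotone fun s => cycleDensity d β s k := by
  intro s s' h
  have := cycleWeight_pos (d := d) hβ k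
  have := one_le_cast k
  simp only [cycleDensity]
  gcongr

lemma summable_cycleDensity (hd : 1 ≤ d) (hβ : 0 < β) {s : ℝ} (hs : s < 0) :
    Summable (cycleDensity d β s) := by
  have hc : 0 < -(β * s) := by nlinarith
  refine Summable.of_nonneg_of_le (fun k => (cycleDensity_pos hβ s k).le) (fun k => ?_)
    ((summable_cycleWeight (β := β) hd).mul_left (1 / (-(β * s))))
  have hq := cycleWeight_pos (d := d) hβ k
  have h1 : -(β * s) * k ≤ Real.exp (-(β * s) * k) := by
    linarith [Real.add_one_le_exp (-(β * s) * k)]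
  have h2 : Real.exp (-(β * s) * k) * Real.exp (β * s * k) = 1 := by
    rw [← Real.exp_add]; simp
  have h3 : (k : ℝ) * Real.exp (β * s * k) ≤ 1 / (-(β * s)) := by
    rw [le_div_iff₀ hc]
    have := mul_le_mul_of_nonneg_right h1 (Real.exp_pos (β * s * k)).le
    rw [h2] at this
    linarith
  unfold cycleDensity
  calc k * cycleWeight d β k * Real.exp (β * s * k)
      = (k * Real.exp (β * s * k)) * cycleWeight d β k := by ring
    _ ≤ _ := mul_le_mul_of_nonneg_right h3 hq.le

lemma idealPressure_nonneg (hβ : 0 < β) (s : ℝ) : 0 ≤ idealPressure d β s := by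
  unfold idealPressure totalWeight
  have : ∀ k : ℕ+, 0 ≤ cycleWeight d β k * Real.exp (β * s * k) := fun k => by
    have := cycleWeight_pos (d := d) hβ k; positivity
  exact mul_nonneg (by positivity) (tsum_nonneg this)

lemma le_freeEnergy (hβ : 0 < β) {s x : ℝ} (hs : s ≤ 0) (hx : 0 ≤ x) :
    s * x - idealPressure d β s ≤ freeEnergy d β x := by
  refine le_ciSup (f := fun s : Set.Iic (0 : ℝ) => (s : ℝ) * x - idealPressure d β s)
    ⟨0, ?_⟩ (⟨s, hs⟩ : Set.Iic (0 : ℝ))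
  rintro _ ⟨⟨r, hr⟩, rfl⟩
  have := idealPressure_nonneg (d := d) hβ r
  have : r * x ≤ 0 := mul_nonpos_of_nonpos_of_nonneg hr hx
  dsimp only
  linarith

lemma freeEnergy_zero_le (hβ : 0 < β) : freeEnergy d β 0 ≤ 0 :=
  ciSup_le fun s => by
    have := idealPressure_nonneg (d := d) hβ s
    linarith

lemma IsConjugate.nonneg {s x : ℝ} (h : IsConjugate d β s x) : 0 ≤ x := by
  simpa using h.sum_le ∅

/-- Termwise this is the tangent inequality for the exponential. For r ≤ s the factor r - s is
nonpositive, so a density exceeding the series is harmless. For r > s one has s < 0, and the density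
equals the series. -/
lemma IsConjugate.tangent (hd : 1 ≤ d) (hβ : 0 < β) {s x : ℝ} (h : IsConjugate d β s x) {r : ℝ}
    (hr : r ≤ 0) : r * x - idealPressure d β r ≤ s * x - idealPressure d β s := by
  have hterm : ∀ k : ℕ+, β * (r - s) * cycleDensity d β s k ≤
      cycleWeight d β k * Real.exp (β * r * k) - cycleWeight d β k * Real.exp (β * s * k) := by
    intro k
    have hq := cycleWeight_pos (d := d) hβ k
    have h1 := Real.add_one_le_exp (β * (r - s) * k)
    have h2 : Real.exp (β * r * k) = Real.exp (β * s * k) * Real.exp (β * (r - s) * k) := by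
      rw [← Real.exp_add]; ring_nf
    rw [h2, cycleDensity]
    have h3 := mul_le_mul_of_nonneg_left h1
      (mul_pos hq (Real.exp_pos (β * s * k))).le
    nlinarith
  have hsum := (summable_cycleWeight_mul_exp hd hβ hr).hasSum.sub
    (summable_cycleWeight_mul_exp hd hβ h.nonpos).hasSum
  have key : β * (r - s) * x ≤ totalWeight d β r - totalWeight d β s := by
    rcases le_or_gt r s with hrs | hrs
    · refine ge_of_tendsto hsum (Eventually.of_forall fun F => ?_)
      calc β * (r - s) * x ≤ β * (r - s) * ∑ k ∈ F, cycleDensity d β s k :=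
            mul_le_mul_of_nonpos_left (h.sum_le F) (by nlinarith)
        _ = ∑ k ∈ F, β * (r - s) * cycleDensity d β s k := Finset.mul_sum _ _ _
        _ ≤ _ := Finset.sum_le_sum fun k _ => hterm k
    · exact hasSum_le hterm ((h.hasSum (hrs.trans_le hr)).mul_left _) hsum
  rw [← beta_mul_idealPressure hβ, ← beta_mul_idealPressure hβ, ← mul_sub, mul_assoc] at key
  have := le_of_mul_le_mul_left key hβ
  linarith

lemma IsConjugate.freeEnergy_eq (hd : 1 ≤ d) (hβ : 0 < β) {s x : ℝ} (h : IsConjugate d β s x) :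
    freeEnergy d β x = s * x - idealPressure d β s :=
  le_antisymm (ciSup_le fun r => h.tangent hd hβ r.2) (le_freeEnergy hβ h.nonpos h.nonneg)

lemma IsConjugate.density_le (hβ : 0 < β) {s x s' x' : ℝ} (h : IsConjugate d β s x)
    (h' : IsConjugate d β s' x') (hs : s < s') : x ≤ x' :=
  le_of_tendsto (h.hasSum (hs.trans_le h'.nonpos)) (Eventually.of_forall fun F =>
    (Finset.sum_le_sum fun k _ => cycleDensity_mono hβ k hs.le).trans (h'.sum_le F))

/-- If t/a is at least the saturation density, s = 0 works and the surplus is condensate. Otherwise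
the intermediate value theorem solves a ρ(s) + s = t for some s < 0. In particular
`effectivePotential` never takes its default value. -/
lemma exists_isConjugate (hd : 1 ≤ d) (hβ : 0 < β) {a : ℝ} (ha : 0 < a) (t : ℝ) :
    ∃ s, IsConjugate d β s ((t - s) / a) := by
  by_cases h : ∀ F : Finset ℕ+, ∑ k ∈ F, cycleDensity d β 0 k ≤ t / a
  · exact ⟨0, le_rfl, by simpa using h, fun h0 => absurd h0 (lt_irrefl _)⟩
  push Not at h
  obtain ⟨F, hF⟩ := h
  -- Below -1 the density is at most its value at -1, so this choice makes a ρ(s₁) + s₁ ≤ t.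
  set s₁ := min (-1) (t - a * ∑' k, cycleDensity d β (-1) k) with hs₁
  have hs₁1 : s₁ ≤ -1 := min_le_left _ _
  have hcont : Continuous fun s => a * ∑ k ∈ F, cycleDensity d β s k + s := by
    unfold cycleDensity; fun_prop
  -- Only a finite partial sum is compared near 0, since the full series may diverge there.
  have hev : ∀ᶠ s in 𝓝[<] (0 : ℝ), t < a * ∑ k ∈ F, cycleDensity d β s k + s := by
    refine (hcont.tendsto 0).mono_left nhdsWithin_le_nhds |>.eventually_const_lt ?_
    rw [div_lt_iff₀ ha] at hF
    linarith
  obtain ⟨s₂, hs₂t, hs₂1, hs₂0⟩ :=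
    (hev.and (Ioo_mem_nhdsLT (by norm_num : (-1 : ℝ) < 0))).exists
  have hcts : ContinuousOn (fun s => a * ∑' k, cycleDensity d β s k + s) (Set.Icc s₁ s₂) := by
    refine ((continuousOn_const.mul ?_).add continuousOn_id)
    refine continuousOn_tsum (fun k => ?_) (summable_cycleDensity (d := d) hd hβ hs₂0) ?_
    · unfold cycleDensity; fun_prop
    · intro k s hs
      rw [Real.norm_eq_abs, abs_of_pos (cycleDensity_pos hβ s k)]
      exact cycleDensity_mono hβ k hs.2
  have h1 : a * ∑' k, cycleDensity d β s₁ k + s₁ ≤ t := by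
    have : ∑' k, cycleDensity d β s₁ k ≤ ∑' k, cycleDensity d β (-1) k :=
      (summable_cycleDensity hd hβ (by linarith)).tsum_le_tsum
        (fun k => cycleDensity_mono hβ k hs₁1) (summable_cycleDensity hd hβ (by norm_num))
    have h2 : s₁ ≤ t - a * ∑' k, cycleDensity d β (-1) k := min_le_right _ _
    nlinarith
  have h2 : t ≤ a * ∑' k, cycleDensity d β s₂ k + s₂ := by
    have := (summable_cycleDensity (d := d) hd hβ hs₂0).sum_le_tsum F
      fun k _ => (cycleDensity_pos hβ s₂ k).le
    nlinarith
  obtain ⟨s, hs, hst⟩ := intermediate_value_Icc (by linarith : s₁ ≤ s₂) hcts ⟨h1, h2⟩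
  have hs0 : s < 0 := hs.2.trans_lt hs₂0
  have hsum := (summable_cycleDensity (d := d) hd hβ hs0)
  have hval : ∑' k, cycleDensity d β s k = (t - s) / a := by
    rw [eq_div_iff ha.ne']
    dsimp only at hst
    linarith
  refine ⟨s, hs0.le, fun F => ?_, fun _ => hval ▸ hsum.hasSum⟩
  rw [← hval]
  exact hsum.sum_le_tsum F fun k _ => (cycleDensity_pos hβ s k).le

end Conjugate

/-! ### The mean-field gas -/

open Classical in
/-- The effective chemical potential `s ≤ 0` of the ideal gas with mean-field interaction at
chemical potential `t`. -/
def effectivePotential (d : ℕ) (β a t : ℝ) : ℝ :=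
  if h : ∃ s, IsConjugate d β s ((t - s) / a) then h.choose else 0

/-- The particle density of the ideal gas with mean-field interaction. -/
def meanFieldDensity (d : ℕ) (β a t : ℝ) : ℝ :=
  (t - effectivePotential d β a t) / a

/-- The pressure of the ideal gas with mean-field interaction. -/
def meanFieldPressure (d : ℕ) (β a t : ℝ) : ℝ :=
  idealPressure d β (effectivePotential d β a t) + (t - effectivePotential d β a t) ^ 2 / (2 * a)

section MeanField

variable {d : ℕ} {β a : ℝ}

lemma isConjugate_effectivePotential (hd : 1 ≤ d) (hβ : 0 < β) (ha : 0 < a) (t : ℝ) :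
    IsConjugate d β (effectivePotential d β a t) (meanFieldDensity d β a t) := by
  have h := exists_isConjugate hd hβ ha t
  rw [meanFieldDensity, effectivePotential, dif_pos h]
  exact h.choose_spec

lemma effectivePotential_nonpos (hd : 1 ≤ d) (hβ : 0 < β) (ha : 0 < a) (t : ℝ) :
    effectivePotential d β a t ≤ 0 :=
  (isConjugate_effectivePotential hd hβ ha t).nonpos

lemma mul_meanFieldDensity (ha : 0 < a) (t : ℝ) :
    a * meanFieldDensity d β a t = t - effectivePotential d β a t := by
  unfold meanFieldDensity; field_simp

/-- If s decreased, the conjugate density would not increase, whereas the density (t - s)/a would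
strictly increase. -/
lemma effectivePotential_mono (hd : 1 ≤ d) (hβ : 0 < β) (ha : 0 < a) :
    Monotone (effectivePotential d β a) := by
  intro t t' h
  by_contra! hlt
  have := (isConjugate_effectivePotential hd hβ ha t').density_le hβ
    (isConjugate_effectivePotential hd hβ ha t) hlt
  have h1 := mul_meanFieldDensity (d := d) (β := β) ha t
  have h2 := mul_meanFieldDensity (d := d) (β := β) ha t'
  nlinarith

lemma meanFieldDensity_mono (hd : 1 ≤ d) (hβ : 0 < β) (ha : 0 < a) :
    Monotone (meanFieldDensity d β a) := by
  intro t t' h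
  rcases (effectivePotential_mono hd hβ ha h).eq_or_lt with he | hl
  · unfold meanFieldDensity
    rw [he]
    gcongr
  · exact (isConjugate_effectivePotential hd hβ ha t).density_le hβ
      (isConjugate_effectivePotential hd hβ ha t') hl

lemma meanFieldDensity_sub_le (hd : 1 ≤ d) (hβ : 0 < β) (ha : 0 < a) {t t' : ℝ} (h : t ≤ t') :
    meanFieldDensity d β a t' - meanFieldDensity d β a t ≤ (t' - t) / a := by
  have := effectivePotential_mono (d := d) hd hβ ha h
  unfold meanFieldDensity
  rw [← sub_div]
  exact div_le_div_of_nonneg_right (by linarith) ha.le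

lemma abs_meanFieldDensity_sub_le (hd : 1 ≤ d) (hβ : 0 < β) (ha : 0 < a) (t t' : ℝ) :
    |meanFieldDensity d β a t' - meanFieldDensity d β a t| ≤ |t' - t| / a := by
  rcases le_total t t' with h | h
  · rw [abs_of_nonneg (sub_nonneg.mpr (meanFieldDensity_mono hd hβ ha h)),
      abs_of_nonneg (sub_nonneg.mpr h)]
    exact meanFieldDensity_sub_le hd hβ ha h
  · rw [abs_sub_comm, abs_sub_comm t',
      abs_of_nonneg (sub_nonneg.mpr (meanFieldDensity_mono hd hβ ha h)),
      abs_of_nonneg (sub_nonneg.mpr h)]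
    exact meanFieldDensity_sub_le hd hβ ha h

lemma continuous_meanFieldDensity (hd : 1 ≤ d) (hβ : 0 < β) (ha : 0 < a) :
    Continuous (meanFieldDensity d β a) := by
  refine (LipschitzWith.of_dist_le_mul (K := (1 / a).toNNReal) fun t t' => ?_).continuous
  rw [Real.dist_eq, Real.dist_eq, Real.coe_toNNReal _ (by positivity)]
  refine (abs_meanFieldDensity_sub_le hd hβ ha t' t).trans_eq ?_
  ring

/-- A negative s determines its density, and s together with the density determines t. -/
lemma effectivePotential_lt (hd : 1 ≤ d) (hβ : 0 < β) (ha : 0 < a) {t t' : ℝ} (h : t < t')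
    (hs : effectivePotential d β a t < 0) :
    effectivePotential d β a t < effectivePotential d β a t' := by
  refine (effectivePotential_mono hd hβ ha h.le).lt_of_ne fun he => ?_
  have h1 := (isConjugate_effectivePotential (d := d) hd hβ ha t).hasSum hs
  have h2 := (isConjugate_effectivePotential (d := d) hd hβ ha t').hasSum (he ▸ hs)
  rw [← he] at h2
  have := h1.unique h2
  have h1 := mul_meanFieldDensity (d := d) (β := β) ha t
  have h2 := mul_meanFieldDensity (d := d) (β := β) ha t'
  rw [this] at h1
  linarith

lemma convex_cycleDensity (hβ : 0 < β) (k : ℕ+) :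
    StrictConvexOn ℝ Set.univ fun s => cycleDensity d β s k := by
  refine ⟨convex_univ, fun x _ y _ hxy p r hp hr hpr => ?_⟩
  have hq := cycleWeight_pos (d := d) hβ k
  have hk := one_le_cast k
  have hne : β * x * k ≠ β * y * k := by
    intro h
    exact hxy (mul_left_cancel₀ hβ.ne' (mul_right_cancel₀ (by linarith) h))
  have := strictConvexOn_exp.2 (Set.mem_univ (β * x * k)) (Set.mem_univ (β * y * k)) hne hp hr hpr
  simp only [smul_eq_mul, cycleDensity] at this ⊢
  have h2 : β * (p * x + r * y) * k = p * (β * x * k) + r * (β * y * k) := by ring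
  rw [h2]
  have hpos : 0 < k * cycleWeight d β k := by positivity
  have := mul_lt_mul_of_pos_left this hpos
  linarith

/-- The effective potential is strictly concave where it is negative. -/
lemma effectivePotential_concave (hd : 1 ≤ d) (hβ : 0 < β) (ha : 0 < a) {t₁ t₂ p r : ℝ}
    (ht : t₁ ≠ t₂) (hp : 0 < p) (hr : 0 < r) (hpr : p + r = 1)
    (hs : effectivePotential d β a (p * t₁ + r * t₂) < 0) :
    p * effectivePotential d β a t₁ + r * effectivePotential d β a t₂ <
      effectivePotential d β a (p * t₁ + r * t₂) := by
  set s₁ := effectivePotential d β a t₁ with hs₁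
  set s₂ := effectivePotential d β a t₂ with hs₂
  set s := effectivePotential d β a (p * t₁ + r * t₂) with hs_def
  have c₁ := isConjugate_effectivePotential (d := d) hd hβ ha t₁
  have c₂ := isConjugate_effectivePotential (d := d) hd hβ ha t₂
  have c := isConjugate_effectivePotential (d := d) hd hβ ha (p * t₁ + r * t₂)
  rw [← hs₁] at c₁
  rw [← hs₂] at c₂
  rw [← hs_def] at c
  -- Where s is negative, t = s + a ρ(s) with ρ increasing and strictly convex, so its inverse is
  -- strictly concave. The contrary assumption bounds the density at s by the density at the convex
  -- combination σ.
  by_contra! hle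
  have hne : s₁ ≠ s₂ := by
    intro h
    have h1 : s ≤ s₁ := by
      have : p * s₁ + r * s₂ = s₁ := by rw [← h, ← add_mul, hpr, one_mul]
      linarith
    rcases ht.lt_or_gt with hlt | hlt
    · by_cases h0 : s₁ < 0
      · exact (effectivePotential_lt hd hβ ha hlt h0).ne h
      · have hp' : p = 1 - r := by linarith
        have : s₁ ≤ s := effectivePotential_mono hd hβ ha (by rw [hp']; nlinarith)
        linarith
    · by_cases h0 : s₁ < 0
      · exact (effectivePotential_lt hd hβ ha hlt (hs₂ ▸ h ▸ h0)).ne h.symm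
      · have hr' : r = 1 - p := by linarith
        have : s₂ ≤ s := effectivePotential_mono hd hβ ha (by rw [hr']; nlinarith)
        linarith
  set σ := p * s₁ + r * s₂ with hσ
  have hconv : ∀ k : ℕ+, cycleDensity d β σ k < p * cycleDensity d β s₁ k +
      r * cycleDensity d β s₂ k := fun k =>
    (convex_cycleDensity hβ k).2 (Set.mem_univ _) (Set.mem_univ _) hne hp hr hpr
  have e₁ := mul_meanFieldDensity (d := d) (β := β) ha t₁
  have e₂ := mul_meanFieldDensity (d := d) (β := β) ha t₂
  have e := mul_meanFieldDensity (d := d) (β := β) ha (p * t₁ + r * t₂)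
  rw [← hs₁] at e₁
  rw [← hs₂] at e₂
  rw [← hs_def] at e
  -- The strict gain is taken from k = 1 alone, so that it survives the limit over finite sets of
  -- lengths.
  set δ := p * cycleDensity d β s₁ 1 + r * cycleDensity d β s₂ 1 - cycleDensity d β σ 1 with hδ
  have hδ0 : 0 < δ := sub_pos.mpr (hconv 1)
  have hlim : meanFieldDensity d β a (p * t₁ + r * t₂) ≤
      p * meanFieldDensity d β a t₁ + r * meanFieldDensity d β a t₂ - δ := by
    refine le_of_tendsto (c.hasSum hs) ?_
    filter_upwards [eventually_ge_atTop {1}] with F hF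
    have h1F : (1 : ℕ+) ∈ F := hF (Finset.mem_singleton_self 1)
    have hsplit : ∑ k ∈ F, (p * cycleDensity d β s₁ k + r * cycleDensity d β s₂ k -
        cycleDensity d β σ k) ≥ δ :=
      Finset.single_le_sum (f := fun k => p * cycleDensity d β s₁ k + r * cycleDensity d β s₂ k -
        cycleDensity d β σ k) (fun k _ => (sub_pos.mpr (hconv k)).le) h1F
    rw [Finset.sum_sub_distrib, Finset.sum_add_distrib, ← Finset.mul_sum, ← Finset.mul_sum]
      at hsplit
    have hm : ∑ k ∈ F, cycleDensity d β s k ≤ ∑ k ∈ F, cycleDensity d β σ k :=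
      Finset.sum_le_sum fun k _ => cycleDensity_mono hβ k hle
    have := mul_le_mul_of_nonneg_left (c₁.sum_le F) hp.le
    have := mul_le_mul_of_nonneg_left (c₂.sum_le F) hr.le
    linarith
  have : a * meanFieldDensity d β a (p * t₁ + r * t₂) ≤
      p * (a * meanFieldDensity d β a t₁) + r * (a * meanFieldDensity d β a t₂) - a * δ := by
    nlinarith
  rw [e, e₁, e₂] at this
  have : 0 < a * δ := mul_pos ha hδ0
  have : σ = p * s₁ + r * s₂ := hσ
  linarith

/-- Completing the square: the variational formula for the mean-field pressure. -/
lemma neg_meanFieldPressure_le (hd : 1 ≤ d) (hβ : 0 < β) (ha : 0 < a) (t : ℝ) {x : ℝ}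
    (hx : 0 ≤ x) :
    -meanFieldPressure d β a t + a / 2 * (x - meanFieldDensity d β a t) ^ 2 ≤
      freeEnergy d β x - t * x + a / 2 * x ^ 2 := by
  have h := le_freeEnergy (d := d) hβ (effectivePotential_nonpos (d := d) hd hβ ha t) hx
  have : -meanFieldPressure d β a t + a / 2 * (x - meanFieldDensity d β a t) ^ 2 =
      effectivePotential d β a t * x - idealPressure d β (effectivePotential d β a t)
        - t * x + a / 2 * x ^ 2 := by
    unfold meanFieldPressure meanFieldDensity
    field_simp
    ring
  linarith

lemma freeEnergy_meanFieldDensity (hd : 1 ≤ d) (hβ : 0 < β) (ha : 0 < a) (t : ℝ) :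
    freeEnergy d β (meanFieldDensity d β a t) =
      -meanFieldPressure d β a t + t * meanFieldDensity d β a t
        - a / 2 * meanFieldDensity d β a t ^ 2 := by
  rw [(isConjugate_effectivePotential (d := d) hd hβ ha t).freeEnergy_eq hd hβ]
  unfold meanFieldPressure meanFieldDensity
  field_simp
  ring

lemma meanFieldPressure_subgradient (hd : 1 ≤ d) (hβ : 0 < β) (ha : 0 < a) (t t' : ℝ) :
    meanFieldPressure d β a t + meanFieldDensity d β a t * (t' - t) ≤
      meanFieldPressure d β a t' := by
  have h1 := neg_meanFieldPressure_le (d := d) hd hβ ha t'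
    (isConjugate_effectivePotential (d := d) hd hβ ha t).nonneg
  rw [freeEnergy_meanFieldDensity hd hβ ha] at h1
  have : 0 ≤ a / 2 * (meanFieldDensity d β a t - meanFieldDensity d β a t') ^ 2 := by positivity
  linarith

/-- The subgradient inequalities at both points, with the 1/a-Lipschitz bound on the density,
confine the remainder to [0, (t' - t)²/a]. -/
lemma hasDerivAt_meanFieldPressure (hd : 1 ≤ d) (hβ : 0 < β) (ha : 0 < a) (t : ℝ) :
    HasDerivAt (meanFieldPressure d β a) (meanFieldDensity d β a t) t := by
  rw [hasDerivAt_iff_isLittleO]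
  have hO : (fun t' => meanFieldPressure d β a t' - meanFieldPressure d β a t -
      (t' - t) • meanFieldDensity d β a t) =O[𝓝 t] fun t' => (t' - t) ^ 2 := by
    refine IsBigO.of_bound (1 / a) (Eventually.of_forall fun t' => ?_)
    have h1 := meanFieldPressure_subgradient (d := d) hd hβ ha t t'
    have h2 := meanFieldPressure_subgradient (d := d) hd hβ ha t' t
    have h3 := abs_meanFieldDensity_sub_le (d := d) hd hβ ha t t'
    rw [smul_eq_mul, Real.norm_eq_abs, Real.norm_eq_abs, abs_of_nonneg (by linarith),
      abs_of_nonneg (sq_nonneg (t' - t))]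
    calc _ ≤ (meanFieldDensity d β a t' - meanFieldDensity d β a t) * (t' - t) := by linarith
      _ ≤ |meanFieldDensity d β a t' - meanFieldDensity d β a t| * |t' - t| := by
          rw [← abs_mul]; exact le_abs_self _
      _ ≤ |t' - t| / a * |t' - t| := mul_le_mul_of_nonneg_right h3 (abs_nonneg _)
      _ = _ := by rw [← sq_abs (t' - t)]; ring
  refine hO.trans_isLittleO ?_
  have := (isLittleO_pow_sub_sub t (by norm_num : 1 < 2))
  simpa using this

end MeanField

/-! ### Minimizers of the rate energy -/

/-- The rate energy minimized over the density of short cycles. -/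
def reducedEnergy (d : ℕ) (β a b μ y : ℝ) : ℝ :=
  -meanFieldPressure d β a (μ - a * y) - μ * y + (a - b) / 2 * y ^ 2

/-- `z` minimizes the rate energy over the domain `𝕂(κ)`. -/
structure IsGroundState (d : ℕ) (β a b μ : ℝ) (κ : ℝ≥0∞) (z : ℝ × ℝ) : Prop where
  mem : z ∈ rateDomain κ
  le : ∀ w ∈ rateDomain κ, rateEnergy d β a b μ z ≤ rateEnergy d β a b μ w

section GroundStates

variable {d : ℕ} {β a b μ : ℝ} {κ : ℝ≥0∞}

lemma neg_idealPressure_zero_le (hβ : 0 < β) {x : ℝ} (hx : 0 ≤ x) :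
    -idealPressure d β 0 ≤ freeEnergy d β x := by
  simpa using le_freeEnergy (d := d) hβ le_rfl hx

lemma coercive_rateEnergy (hβ : 0 < β) (hb : 0 ≤ b) {x y : ℝ} (hx : 0 ≤ x) (hy : 0 ≤ y) :
    -idealPressure d β 0 - μ * (x + y) + (a - b) / 2 * (x + y) ^ 2 ≤
      rateEnergy d β a b μ (x, y) := by
  have h := neg_idealPressure_zero_le (d := d) hβ hx
  have h2 : b / 2 * y ^ 2 ≤ b / 2 * (x + y) ^ 2 := by
    have : y ^ 2 ≤ (x + y) ^ 2 := by gcongr; linarith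
    gcongr
  simp only [rateEnergy]
  linarith

/-- Completing the square turns quadratic coercivity into linear growth of any slope C; this serves
summability, existence of minimisers and compactness. -/
lemma linear_le_rateEnergy (hβ : 0 < β) (hb : 0 ≤ b) (hba : b < a) (C : ℝ) {x y : ℝ}
    (hx : 0 ≤ x) (hy : 0 ≤ y) :
    (-idealPressure d β 0 - C - (μ + C) ^ 2 / (2 * (a - b))) + C * (1 + (x + y)) ≤
      rateEnergy d β a b μ (x, y) := by
  refine le_trans ?_ (coercive_rateEnergy hβ hb hx hy)
  have hab : 0 < a - b := sub_pos.mpr hba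
  have h : 0 ≤ (a - b) / 2 * ((x + y) - (μ + C) / (a - b)) ^ 2 := by positivity
  have h2 : (a - b) / 2 * ((x + y) - (μ + C) / (a - b)) ^ 2 =
      (a - b) / 2 * (x + y) ^ 2 - (μ + C) * (x + y) + (μ + C) ^ 2 / (2 * (a - b)) := by
    field_simp
    ring
  linarith

lemma reducedEnergy_add_le (hd : 1 ≤ d) (hβ : 0 < β) (ha : 0 < a) {x : ℝ} (hx : 0 ≤ x) (y : ℝ) :
    reducedEnergy d β a b μ y + a / 2 * (x - meanFieldDensity d β a (μ - a * y)) ^ 2 ≤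
      rateEnergy d β a b μ (x, y) := by
  have := neg_meanFieldPressure_le (d := d) hd hβ ha (μ - a * y) hx
  simp only [rateEnergy, reducedEnergy]
  linarith

lemma rateEnergy_meanFieldDensity (hd : 1 ≤ d) (hβ : 0 < β) (ha : 0 < a) (y : ℝ) :
    rateEnergy d β a b μ (meanFieldDensity d β a (μ - a * y), y) = reducedEnergy d β a b μ y := by
  simp only [rateEnergy, reducedEnergy, freeEnergy_meanFieldDensity hd hβ ha]
  ring

lemma meanFieldDensity_nonneg (hd : 1 ≤ d) (hβ : 0 < β) (ha : 0 < a) (t : ℝ) :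
    0 ≤ meanFieldDensity d β a t :=
  (isConjugate_effectivePotential hd hβ ha t).nonneg

/-- By the chain rule the derivative is aX - μ + (a - b)y, where X is the mean-field density at μ -
ay. Inserting aX = μ - ay - s leaves -s - by. -/
lemma hasDerivAt_reducedEnergy (hd : 1 ≤ d) (hβ : 0 < β) (ha : 0 < a) (y : ℝ) :
    HasDerivAt (reducedEnergy d β a b μ)
      (-effectivePotential d β a (μ - a * y) - b * y) y := by
  have h1 : HasDerivAt (fun y => μ - a * y) (-(a * 1)) y :=
    ((hasDerivAt_id y).const_mul a).const_sub μ
  have h2 := (hasDerivAt_meanFieldPressure (d := d) hd hβ ha (μ - a * y)).comp y h1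
  have h3 := ((hasDerivAt_pow 2 y).const_mul ((a - b) / 2))
  have h4 := ((h2.neg.sub ((hasDerivAt_id y).const_mul μ)).add h3)
  convert! h4 using 1
  have := mul_meanFieldDensity (d := d) (β := β) ha (μ - a * y)
  push_cast
  nlinarith

lemma continuous_reducedEnergy (hd : 1 ≤ d) (hβ : 0 < β) (ha : 0 < a) :
    Continuous (reducedEnergy d β a b μ) :=
  continuous_iff_continuousAt.mpr fun y => (hasDerivAt_reducedEnergy hd hβ ha y).continuousAt

lemma IsGroundState.reduced_le (hd : 1 ≤ d) (hβ : 0 < β) (ha : 0 < a) {z : ℝ × ℝ}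
    (h : IsGroundState d β a b μ κ z) {y : ℝ} (hy : 0 ≤ y) (hκ : y = 0 ∨ κ ≤ ENNReal.ofReal y) :
    reducedEnergy d β a b μ z.2 ≤ reducedEnergy d β a b μ y := by
  have h1 := h.le (meanFieldDensity d β a (μ - a * y), y)
    ⟨meanFieldDensity_nonneg hd hβ ha _, hy, hκ⟩
  rw [rateEnergy_meanFieldDensity hd hβ ha] at h1
  have h2 := reducedEnergy_add_le (d := d) (b := b) (μ := μ) hd hβ ha h.mem.1 z.2
  have : 0 ≤ a / 2 * (z.1 - meanFieldDensity d β a (μ - a * z.2)) ^ 2 := by positivity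
  have h3 : rateEnergy d β a b μ z = rateEnergy d β a b μ (z.1, z.2) := rfl
  linarith

lemma IsGroundState.fst_eq (hd : 1 ≤ d) (hβ : 0 < β) (ha : 0 < a) {z : ℝ × ℝ}
    (h : IsGroundState d β a b μ κ z) : z.1 = meanFieldDensity d β a (μ - a * z.2) := by
  have h1 := h.le (meanFieldDensity d β a (μ - a * z.2), z.2)
    ⟨meanFieldDensity_nonneg hd hβ ha _, h.mem.2.1, h.mem.2.2⟩
  rw [rateEnergy_meanFieldDensity hd hβ ha] at h1
  have h2 := reducedEnergy_add_le (d := d) (b := b) (μ := μ) hd hβ ha h.mem.1 z.2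
  have h3 : rateEnergy d β a b μ z = rateEnergy d β a b μ (z.1, z.2) := rfl
  have h4 : a / 2 * (z.1 - meanFieldDensity d β a (μ - a * z.2)) ^ 2 ≤ 0 := by linarith
  have h5 : (z.1 - meanFieldDensity d β a (μ - a * z.2)) ^ 2 = 0 := by
    refine le_antisymm ?_ (sq_nonneg _)
    by_contra! hlt
    have : 0 < a / 2 * (z.1 - meanFieldDensity d β a (μ - a * z.2)) ^ 2 := by positivity
    linarith
  have := pow_eq_zero_iff (two_ne_zero) |>.mp h5
  linarith

lemma isGroundState_of_reduced (hd : 1 ≤ d) (hβ : 0 < β) (ha : 0 < a) {y : ℝ} (hy : 0 ≤ y)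
    (hκ : y = 0 ∨ κ ≤ ENNReal.ofReal y)
    (h : ∀ y', 0 ≤ y' → (y' = 0 ∨ κ ≤ ENNReal.ofReal y') →
      reducedEnergy d β a b μ y ≤ reducedEnergy d β a b μ y') :
    IsGroundState d β a b μ κ (meanFieldDensity d β a (μ - a * y), y) := by
  refine ⟨⟨meanFieldDensity_nonneg hd hβ ha _, hy, hκ⟩, fun w hw => ?_⟩
  rw [rateEnergy_meanFieldDensity hd hβ ha]
  have h1 := h w.2 hw.2.1 hw.2.2
  have h2 := reducedEnergy_add_le (d := d) (b := b) (μ := μ) hd hβ ha hw.1 w.2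
  have : 0 ≤ a / 2 * (w.1 - meanFieldDensity d β a (μ - a * w.2)) ^ 2 := by positivity
  have h3 : rateEnergy d β a b μ w = rateEnergy d β a b μ (w.1, w.2) := rfl
  linarith

/-- By coercivity the search reduces to a compact interval, in which {0} ∪ [κ, ∞) is closed and
nonempty; at κ = ∞ only 0 is left. -/
lemma exists_isGroundState (hd : 1 ≤ d) (hβ : 0 < β) (hb : 0 < b) (hba : b < a) (μ : ℝ)
    (κ : ℝ≥0∞) : ∃ z, IsGroundState d β a b μ κ z := by
  have ha := hb.trans hba
  have hlow : ∀ y, 0 ≤ y → (-idealPressure d β 0 - 1 - (μ + 1) ^ 2 / (2 * (a - b))) + y ≤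
      reducedEnergy d β a b μ y := by
    intro y hy
    have hX := meanFieldDensity_nonneg (d := d) hd hβ ha (μ - a * y)
    have := linear_le_rateEnergy (d := d) (μ := μ) hβ hb.le hba 1 hX hy
    rw [rateEnergy_meanFieldDensity hd hβ ha] at this
    linarith
  set e := -idealPressure d β 0 - 1 - (μ + 1) ^ 2 / (2 * (a - b)) with he
  set R := max 0 (reducedEnergy d β a b μ 0 - e) with hR
  have hclosed : IsClosed {y : ℝ | y = 0 ∨ κ ≤ ENNReal.ofReal y} :=
    (isClosed_eq continuous_id continuous_const).union
      (isClosed_le continuous_const ENNReal.continuous_ofReal)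
  obtain ⟨y, hy, hmin⟩ := (isCompact_Icc (a := 0) (b := R)).inter_right hclosed
    |>.exists_isMinOn ⟨0, ⟨le_rfl, le_max_left _ _⟩, Or.inl rfl⟩
      (continuous_reducedEnergy (d := d) (b := b) (μ := μ) hd hβ ha).continuousOn
  refine ⟨_, isGroundState_of_reduced hd hβ ha hy.1.1 hy.2 fun y' hy' hκ' => ?_⟩
  by_cases hyR : y' ≤ R
  · exact hmin ⟨⟨hy', hyR⟩, hκ'⟩
  · have h0 : reducedEnergy d β a b μ y ≤ reducedEnergy d β a b μ 0 :=
      hmin ⟨⟨le_rfl, le_max_left _ _⟩, Or.inl rfl⟩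
    have h1 := hlow y' hy'
    have h2 : reducedEnergy d β a b μ 0 - e ≤ R := le_max_right _ _
    linarith

/-- Let g(y) = -s(μ - ay) - by be the derivative of the reduced energy. The mean value theorem gives
ξ < z.2 with g(ξ) ≤ 0 and η between z.2 and w.2 with g(η) = 0. Also g(w.2) = 0, as w.2 is in the
interior of the admissible half-line, while z.2 may sit on its boundary κ. But s(μ - aη) = -bη < 0,
so strict concavity of s forces g(η) < 0. -/
lemma IsGroundState.not_two_positive (hd : 1 ≤ d) (hβ : 0 < β) (hb : 0 < b) (ha : 0 < a)
    {z w : ℝ × ℝ} (hz : IsGroundState d β a b μ κ z) (hw : IsGroundState d β a b μ κ w)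
    (hz0 : 0 < z.2) (hzw : z.2 < w.2) : False := by
  have hκz : κ ≤ ENNReal.ofReal z.2 := hz.mem.2.2.resolve_left hz0.ne'
  have hcont := continuous_reducedEnergy (d := d) (b := b) (μ := μ) hd hβ ha
  have hder := fun y => hasDerivAt_reducedEnergy (d := d) (b := b) (μ := μ) hd hβ ha y
  obtain ⟨ξ, hξ, hξe⟩ := exists_hasDerivAt_eq_slope _ _ hz0 hcont.continuousOn fun y _ => hder y
  have hξ0 : -effectivePotential d β a (μ - a * ξ) - b * ξ ≤ 0 := by
    rw [hξe]
    have := hz.reduced_le hd hβ ha le_rfl (Or.inl rfl)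
    exact div_nonpos_of_nonpos_of_nonneg (by linarith) (by linarith)
  obtain ⟨η, hη, hηe⟩ := exists_hasDerivAt_eq_slope _ _ hzw hcont.continuousOn fun y _ => hder y
  have heq : reducedEnergy d β a b μ w.2 = reducedEnergy d β a b μ z.2 :=
    le_antisymm (hw.reduced_le hd hβ ha hz.mem.2.1 hz.mem.2.2)
      (hz.reduced_le hd hβ ha hw.mem.2.1 hw.mem.2.2)
  rw [heq, sub_self, zero_div] at hηe
  have hmin : IsLocalMin (reducedEnergy d β a b μ) w.2 := by
    filter_upwards [lt_mem_nhds hzw] with y hy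
    exact hw.reduced_le hd hβ ha (hz0.trans hy).le
      (Or.inr (hκz.trans (ENNReal.ofReal_le_ofReal hy.le)))
  have hw0 := hmin.hasDerivAt_eq_zero (hder w.2)
  have hξw : ξ < w.2 := hξ.2.trans hzw
  have hξη : ξ < η := hξ.2.trans hη.1
  have hη0 : 0 < η := hξ.1.trans hξη
  set p := (w.2 - η) / (w.2 - ξ) with hp
  have hp0 : 0 < p := div_pos (sub_pos.mpr hη.2) (sub_pos.mpr hξw)
  have hp1 : 0 < 1 - p := by
    rw [hp, sub_pos, div_lt_one (sub_pos.mpr hξw)]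
    linarith
  have hcomb : η = p * ξ + (1 - p) * w.2 := by
    have : w.2 - ξ ≠ 0 := (sub_pos.mpr hξw).ne'
    rw [hp]
    field_simp
    ring
  have harg : p * (μ - a * ξ) + (1 - p) * (μ - a * w.2) = μ - a * η := by
    rw [hcomb]; ring
  have hne : μ - a * ξ ≠ μ - a * w.2 := by
    intro h
    have : a * ξ < a * w.2 := mul_lt_mul_of_pos_left hξw ha
    linarith
  have hbη : 0 < b * η := mul_pos hb hη0
  have hconc := effectivePotential_concave (d := d) hd hβ ha hne hp0 hp1 (by ring)
    (by rw [harg]; linarith)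
  rw [harg] at hconc
  have h1 := mul_le_mul_of_nonneg_left hξ0 hp0.le
  have h2 : (1 - p) * (-effectivePotential d β a (μ - a * w.2) - b * w.2) = 0 := by
    rw [hw0, mul_zero]
  have h3 : b * η = p * (b * ξ) + (1 - p) * (b * w.2) := by rw [hcomb]; ring
  linarith

lemma IsGroundState.eq_of_pos (hd : 1 ≤ d) (hβ : 0 < β) (hb : 0 < b) (ha : 0 < a)
    {z w : ℝ × ℝ} (hz : IsGroundState d β a b μ κ z) (hw : IsGroundState d β a b μ κ w)
    (hz0 : 0 < z.2) (hw0 : 0 < w.2) : z = w := by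
  have h2 : z.2 = w.2 := by
    rcases lt_trichotomy z.2 w.2 with h | h | h
    · exact (hz.not_two_positive hd hβ hb ha hw hz0 h).elim
    · exact h
    · exact (hw.not_two_positive hd hβ hb ha hz hw0 h).elim
  exact Prod.ext (by rw [hz.fst_eq hd hβ ha, hw.fst_eq hd hβ ha, h2]) h2

lemma IsGroundState.eq_of_zero (hd : 1 ≤ d) (hβ : 0 < β) (ha : 0 < a)
    {z : ℝ × ℝ} (hz : IsGroundState d β a b μ κ z) (hz0 : z.2 = 0) :
    z = (meanFieldDensity d β a μ, 0) :=
  Prod.ext (by rw [hz.fst_eq hd hβ ha, hz0]; simp) hz0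

lemma mem_rateZeroes_iff (hβ : 0 < β) (hb : 0 ≤ b) (hba : b < a) {z : ℝ × ℝ} :
    z ∈ rateZeroes d β a b μ κ ↔ IsGroundState d β a b μ κ z := by
  have hzero : (0 : ℝ × ℝ) ∈ rateDomain κ := ⟨le_rfl, le_rfl, Or.inl rfl⟩
  have hne : Nonempty (rateDomain κ) := ⟨⟨0, hzero⟩⟩
  -- Coercivity makes the supremum defining `pressure` genuine; an unbounded real supremum would
  -- default to 0.
  have hbdd : BddAbove (Set.range fun z : rateDomain κ => -rateEnergy d β a b μ z) := by
    refine ⟨-(-idealPressure d β 0 - 0 - (μ + 0) ^ 2 / (2 * (a - b))), ?_⟩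
    rintro _ ⟨⟨w, hw⟩, rfl⟩
    have := linear_le_rateEnergy (d := d) (μ := μ) hβ hb hba 0 hw.1 hw.2.1
    have h3 : rateEnergy d β a b μ w = rateEnergy d β a b μ (w.1, w.2) := rfl
    dsimp only
    linarith
  unfold rateZeroes rateFunction
  rw [Set.mem_ofPred_eq]
  split_ifs with h
  · rw [EReal.coe_eq_zero]
    constructor
    · intro h0
      refine ⟨h, fun w hw => ?_⟩
      have : -rateEnergy d β a b μ w ≤ pressure d β a b μ κ := le_ciSup hbdd ⟨w, hw⟩
      linarith
    · intro hg
      have h1 : -rateEnergy d β a b μ z ≤ pressure d β a b μ κ := le_ciSup hbdd ⟨z, h⟩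
      have h2 : pressure d β a b μ κ ≤ -rateEnergy d β a b μ z :=
        ciSup_le fun w => by have := hg.le w w.2; linarith
      linarith
  · exact ⟨fun h0 => absurd h0 (by simp), fun hg => absurd hg.mem h⟩

end GroundStates

/-! ### The transition potential -/

section Transition

variable {d : ℕ} {β a b μ : ℝ} {κ : ℝ≥0∞}

/-- If s vanishes at μ - ay, it also vanishes at μ. Both pressures are then explicit quadratics, and
the long cycles gain exactly by²/2. -/
lemma reducedEnergy_lt_of_effectivePotential_eq_zero (hd : 1 ≤ d) (hβ : 0 < β) (hb : 0 < b)
    (ha : 0 < a) {y : ℝ} (hy : 0 < y) (h : effectivePotential d β a (μ - a * y) = 0) :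
    reducedEnergy d β a b μ y < reducedEnergy d β a b μ 0 := by
  have h0 : effectivePotential d β a μ = 0 := by
    refine le_antisymm (effectivePotential_nonpos hd hβ ha _) ?_
    rw [← h]
    exact effectivePotential_mono hd hβ ha (by nlinarith)
  have : reducedEnergy d β a b μ 0 - reducedEnergy d β a b μ y = b / 2 * y ^ 2 := by
    unfold reducedEnergy meanFieldPressure
    rw [mul_zero, sub_zero, h, h0]
    field_simp
    ring
  have : 0 < b / 2 * y ^ 2 := by positivity
  linarith

/-- The energy difference D between 0 and y has μ-derivative (s(τ) - s(τ - ay))/a ≥ 0. It is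
strictly positive on the interval used: s(τ - ay) = 0 would give D(τ) > 0, against D(τ) ≤ D(μ) ≤ 0.
-/
lemma reducedEnergy_zero_lt_of_lt (hd : 1 ≤ d) (hβ : 0 < β) (hb : 0 < b) (ha : 0 < a)
    {μ' y : ℝ} (hμ : μ' < μ) (hy : 0 < y)
    (h : reducedEnergy d β a b μ 0 ≤ reducedEnergy d β a b μ y) :
    reducedEnergy d β a b μ' 0 < reducedEnergy d β a b μ' y := by
  set D : ℝ → ℝ := fun τ => reducedEnergy d β a b τ 0 - reducedEnergy d β a b τ y with hD
  have hder : ∀ τ, HasDerivAt D ((effectivePotential d β a τ -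
      effectivePotential d β a (τ - a * y)) / a) τ := by
    intro τ
    have h1 := hasDerivAt_meanFieldPressure (d := d) hd hβ ha τ
    have h2 := (hasDerivAt_meanFieldPressure (d := d) hd hβ ha (τ - a * y)).comp τ
      ((hasDerivAt_id τ).sub_const (a * y))
    have h3 := (((h1.neg.add h2).add ((hasDerivAt_id τ).mul_const y)).sub_const
      ((a - b) / 2 * y ^ 2))
    convert! h3 using 1
    · ext τ
      simp [hD, reducedEnergy]
      ring
    · simp only [meanFieldDensity, one_mul]
      field_simp
      ring
  have hmono : Monotone D := by
    refine monotone_of_deriv_nonneg (fun τ => (hder τ).differentiableAt) fun τ => ?_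
    rw [(hder τ).deriv]
    refine div_nonneg (sub_nonneg.mpr (effectivePotential_mono hd hβ ha ?_)) ha.le
    nlinarith
  have hDμ : D μ ≤ 0 := sub_nonpos.mpr h
  obtain ⟨τ, hτ, hτe⟩ := exists_hasDerivAt_eq_slope D _ hμ
    (fun τ _ => (hder τ).continuousAt.continuousWithinAt) fun τ _ => hder τ
  rw [eq_div_iff (sub_pos.mpr hμ).ne'] at hτe
  have hay : 0 < a * y := mul_pos ha hy
  have hneg : effectivePotential d β a (τ - a * y) < 0 := by
    refine (effectivePotential_nonpos hd hβ ha _).lt_of_ne fun h0 => ?_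
    have := reducedEnergy_lt_of_effectivePotential_eq_zero hd hβ hb ha hy h0
    have h2 : D τ ≤ D μ := hmono hτ.2.le
    have h3 : 0 < D τ := sub_pos.mpr this
    linarith
  have hlt := effectivePotential_lt (d := d) hd hβ ha (by linarith : τ - a * y < τ) hneg
  have hpos : 0 < (effectivePotential d β a τ - effectivePotential d β a (τ - a * y)) / a *
      (μ - μ') := mul_pos (div_pos (sub_pos.mpr hlt) ha) (sub_pos.mpr hμ)
  have : D μ' < 0 := by linarith
  exact sub_neg.mp this

/-- The derivative -s - by equals aX - μ + (a - b)y with X ≥ 0, which is positive for μ ≤ 0 and y >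
0. -/
lemma reducedEnergy_zero_lt_of_nonpos (hd : 1 ≤ d) (hβ : 0 < β) (hb : 0 < b) (hba : b < a)
    (hμ : μ ≤ 0) {y : ℝ} (hy : 0 < y) :
    reducedEnergy d β a b μ 0 < reducedEnergy d β a b μ y := by
  have ha := hb.trans hba
  have hder := fun y => hasDerivAt_reducedEnergy (d := d) (b := b) (μ := μ) hd hβ ha y
  refine strictMonoOn_of_deriv_pos (convex_Ici (0 : ℝ))
    (continuous_reducedEnergy hd hβ ha).continuousOn (fun x hx => ?_) Set.self_mem_Ici hy.le hy
  rw [interior_Ici] at hx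
  have hx : 0 < x := hx
  rw [(hder x).deriv]
  have h1 := mul_meanFieldDensity (d := d) (β := β) ha (μ - a * x)
  have h2 := mul_nonneg ha.le (meanFieldDensity_nonneg (d := d) hd hβ ha (μ - a * x))
  have h3 : b * x < a * x := mul_lt_mul_of_pos_right hba hx
  linarith

/-! ### Ground states in the strongly condensing regime -/

lemma rateEnergy_zero_le (hβ : 0 < β) (hba : b < a) :
    rateEnergy d β a b μ (0, μ / (a - b)) ≤ -(μ ^ 2 / (2 * (a - b))) := by
  have hab : 0 < a - b := sub_pos.mpr hba
  have h : rateEnergy d β a b μ (0, μ / (a - b)) =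
      freeEnergy d β 0 - μ ^ 2 / (2 * (a - b)) := by
    simp only [rateEnergy]
    field_simp
    ring
  have := freeEnergy_zero_le (d := d) hβ
  linarith

lemma mem_rateDomain_candidate (hba : b < a) (hμ : 0 ≤ μ) (hκ : κ ≤ ENNReal.ofReal (μ / (a - b))) :
    ((0 : ℝ), μ / (a - b)) ∈ rateDomain κ :=
  ⟨le_rfl, div_nonneg hμ (sub_pos.mpr hba).le, Or.inr hκ⟩

lemma sq_div_two_mul_sub_eq (hb : 0 < b) (hba : b < a) :
    μ ^ 2 / (2 * (a - b)) = μ ^ 2 / (2 * a) + b / 2 * (μ / a) ^ 2 +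
      μ ^ 2 * b ^ 2 / (2 * a ^ 2 * (a - b)) := by
  have hab : a - b ≠ 0 := (sub_pos.mpr hba).ne'
  have ha : a ≠ 0 := (hb.trans hba).ne'
  field_simp
  ring

/-- The competitor (0, μ/(a-b)) has energy at most -μ²/(2(a-b)). If ay < μ, the mean-field part is
at least -μ²/(2a) and the counter term gains at most (b/2)(μ/a)². The ideal gas contributes at least
-p₀(β,0), too little to make up the difference under `hlarge`. -/
lemma IsGroundState.le_snd (hβ : 0 < β) (hb : 0 < b) (hba : b < a) (hμ : 0 ≤ μ)
    (hκ : κ ≤ ENNReal.ofReal (μ / (a - b)))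
    (hlarge : idealPressure d β 0 < μ ^ 2 * b ^ 2 / (2 * a ^ 2 * (a - b))) {z : ℝ × ℝ}
    (hz : IsGroundState d β a b μ κ z) : μ ≤ a * z.2 := by
  have ha := hb.trans hba
  by_contra! hlt
  have h1 := (hz.le _ (mem_rateDomain_candidate hba hμ hκ)).trans (rateEnergy_zero_le hβ hba)
  have h2 := neg_idealPressure_zero_le (d := d) hβ hz.mem.1
  have h3 : 0 ≤ a / 2 * (z.1 + z.2 - μ / a) ^ 2 := by positivity
  have h4 : a / 2 * (z.1 + z.2 - μ / a) ^ 2 =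
      a / 2 * (z.1 + z.2) ^ 2 - μ * (z.1 + z.2) + μ ^ 2 / (2 * a) := by
    field_simp
    ring
  have h5 : b / 2 * z.2 ^ 2 ≤ b / 2 * (μ / a) ^ 2 := by
    have : z.2 ≤ μ / a := by rw [le_div_iff₀ ha]; linarith
    have := hz.mem.2.1
    gcongr
  rw [sq_div_two_mul_sub_eq hb hba] at h1
  simp only [rateEnergy] at h1
  linarith

/-- Once ay ≥ μ, the terms x(ay - μ) and ax²/2 are nonnegative, so short cycles lower the energy by
at most p₀(β,0). This bounds (a-b)/2 times the squared distance of y from the bottom of the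
parabola. -/
lemma IsGroundState.abs_sub_le (hβ : 0 < β) (hb : 0 < b) (hba : b < a) (hμ : 0 ≤ μ)
    (hκ : κ ≤ ENNReal.ofReal (μ / (a - b)))
    (hlarge : idealPressure d β 0 < μ ^ 2 * b ^ 2 / (2 * a ^ 2 * (a - b))) {z : ℝ × ℝ}
    (hz : IsGroundState d β a b μ κ z) :
    |z.2 - μ / (a - b)| ≤ √(2 * idealPressure d β 0 / (a - b)) := by
  have ha := hb.trans hba
  have hab : 0 < a - b := sub_pos.mpr hba
  have h0 := hz.le_snd hβ hb hba hμ hκ hlarge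
  have h1 := (hz.le _ (mem_rateDomain_candidate hba hμ hκ)).trans (rateEnergy_zero_le hβ hba)
  have h2 := neg_idealPressure_zero_le (d := d) hβ hz.mem.1
  have h3 : 0 ≤ z.1 * (a * z.2 - μ) := mul_nonneg hz.mem.1 (sub_nonneg.mpr h0)
  have h4 : 0 ≤ a / 2 * z.1 ^ 2 := by positivity
  have h5 : (a - b) / 2 * (z.2 - μ / (a - b)) ^ 2 =
      (a - b) / 2 * z.2 ^ 2 - μ * z.2 + μ ^ 2 / (2 * (a - b)) := by
    field_simp
    ring
  simp only [rateEnergy] at h1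
  refine Real.abs_le_sqrt ?_
  rw [le_div_iff₀ hab]
  nlinarith

lemma eventually_large {p c : ℝ} (hc : 0 < c) : ∀ᶠ μ : ℝ in atTop, p < μ ^ 2 * c := by
  have : Tendsto (fun μ : ℝ => μ ^ 2 * c) atTop atTop :=
    (tendsto_pow_atTop (two_ne_zero)).atTop_mul_const hc
  exact this.eventually_gt_atTop p

lemma eventually_le_candidate (hba : b < a) (hκ : κ ≠ ⊤) :
    ∀ᶠ μ : ℝ in atTop, κ ≤ ENNReal.ofReal (μ / (a - b)) := by
  have hab : 0 < a - b := sub_pos.mpr hba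
  filter_upwards [eventually_ge_atTop (κ.toReal * (a - b))] with μ hμ
  rw [← ENNReal.ofReal_toReal hκ]
  exact ENNReal.ofReal_le_ofReal ((le_div_iff₀ hab).mpr hμ)

lemma eventually_groundState_pos (hβ : 0 < β) (hb : 0 < b) (hba : b < a) (hκ : κ ≠ ⊤) :
    ∀ᶠ μ : ℝ in atTop, 0 < μ ∧ κ ≤ ENNReal.ofReal (μ / (a - b)) ∧
      idealPressure d β 0 < μ ^ 2 * b ^ 2 / (2 * a ^ 2 * (a - b)) ∧
      ∀ z, IsGroundState d β a b μ κ z → 0 < z.2 := by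
  have ha := hb.trans hba
  have hab : 0 < a - b := sub_pos.mpr hba
  have hc : 0 < b ^ 2 / (2 * a ^ 2 * (a - b)) := by positivity
  filter_upwards [eventually_gt_atTop 0, eventually_le_candidate hba hκ,
    eventually_large (p := idealPressure d β 0) hc] with μ h1 h2 h3
  rw [← mul_div_assoc] at h3
  refine ⟨h1, h2, h3, fun z hz => ?_⟩
  have := hz.le_snd hβ hb hba h1.le h2 h3
  by_contra! h
  nlinarith

/-- The transition potential exists for every finite `κ`. -/
theorem exists_isTransitionPotential (hd : 1 ≤ d) (hβ : 0 < β) (hb : 0 < b) (hba : b < a)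
    (hκ : κ ≠ ⊤) : ∃ ν, IsTransitionPotential d β a b κ ν := by
  have ha := hb.trans hba
  -- These are the potentials at which having no long cycles is optimal. The set is downward closed,
  -- contains 0 and is bounded above; its supremum is the transition.
  set A : Set ℝ := {μ | ∀ y, 0 < y → κ ≤ ENNReal.ofReal y →
    reducedEnergy d β a b μ 0 ≤ reducedEnergy d β a b μ y} with hA
  have h0A : (0 : ℝ) ∈ A := fun y hy _ =>
    (reducedEnergy_zero_lt_of_nonpos hd hβ hb hba le_rfl hy).le
  have hground : ∀ μ ∈ A, IsGroundState d β a b μ κ (meanFieldDensity d β a (μ - a * 0), 0) := by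
    intro μ hμ
    refine isGroundState_of_reduced hd hβ ha le_rfl (Or.inl rfl) fun y hy hκy => ?_
    rcases hy.eq_or_lt with rfl | hy
    · exact le_rfl
    · exact hμ y hy (hκy.resolve_left hy.ne')
  have hdown : ∀ μ ∈ A, ∀ μ' < μ, μ' ∈ A := fun μ hμ μ' hlt y hy hκy =>
    (reducedEnergy_zero_lt_of_lt hd hβ hb ha hlt hy (hμ y hy hκy)).le
  have hbdd : BddAbove A := by
    obtain ⟨μ, -, -, -, h⟩ := (eventually_groundState_pos (d := d) hβ hb hba hκ).exists
    refine ⟨μ, fun ν hν => ?_⟩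
    by_contra! hlt
    exact lt_irrefl _ (h _ (hground μ (hdown ν hν μ hlt)))
  have hzero : ∀ μ, (rateZeroes d β a b μ κ).Nonempty := fun μ => by
    obtain ⟨z, hz⟩ := exists_isGroundState (d := d) hd hβ hb hba μ κ
    exact ⟨z, (mem_rateZeroes_iff hβ hb.le hba).mpr hz⟩
  refine ⟨sSup A, fun μ hμ => ⟨hzero μ, fun z hz => ?_⟩, fun μ hμ => ⟨hzero μ, fun z hz => ?_⟩⟩
  · rw [mem_rateZeroes_iff hβ hb.le hba] at hz
    obtain ⟨ν, hν, hlt⟩ := exists_lt_of_lt_csSup ⟨0, h0A⟩ hμ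
    by_contra hne
    have hpos : 0 < z.2 := lt_of_le_of_ne hz.mem.2.1 (Ne.symm hne)
    have h1 := reducedEnergy_zero_lt_of_lt hd hβ hb ha hlt hpos
      (hν z.2 hpos (hz.mem.2.2.resolve_left hne))
    have h2 := hz.reduced_le hd hβ ha le_rfl (Or.inl rfl)
    linarith
  · rw [mem_rateZeroes_iff hβ hb.le hba] at hz
    refine lt_of_le_of_ne hz.mem.2.1 fun h0 => ?_
    have hmem : μ ∈ A := fun y hy hκy => by
      have := hz.reduced_le hd hβ ha hy.le (Or.inr hκy)
      rwa [← h0] at this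
    exact absurd (le_csSup hbdd hmem) (not_le.mpr hμ)

lemma IsGroundState.snd_eq_zero_of_nonpos (hd : 1 ≤ d) (hβ : 0 < β) (hb : 0 < b) (hba : b < a)
    (hμ : μ ≤ 0) {z : ℝ × ℝ} (hz : IsGroundState d β a b μ κ z) : z.2 = 0 := by
  by_contra hne
  have hpos : 0 < z.2 := lt_of_le_of_ne hz.mem.2.1 (Ne.symm hne)
  have h1 := reducedEnergy_zero_lt_of_nonpos (d := d) hd hβ hb hba hμ hpos
  have h2 := hz.reduced_le hd hβ (hb.trans hba) le_rfl (Or.inl rfl)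
  linarith

end Transition

/-! ### Saturation -/

/-- The cycle lengths `1, …, K`. -/
def cyclesUpTo (K : ℕ) : Finset ℕ+ :=
  (Finset.range K).map ⟨Nat.succPNat, Nat.succPNat_injective⟩

lemma mem_cyclesUpTo {K : ℕ} {k : ℕ+} : k ∈ cyclesUpTo K ↔ (k : ℕ) ≤ K := by
  simp only [cyclesUpTo, Finset.mem_map, Finset.mem_range, Function.Embedding.coeFn_mk]
  constructor
  · rintro ⟨j, hj, rfl⟩
    simpa using hj
  · intro h
    have := k.pos
    refine ⟨k.natPred, ?_, PNat.succPNat_natPred k⟩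
    have := PNat.natPred_add_one k
    omega

lemma tendsto_cyclesUpTo : Tendsto cyclesUpTo atTop atTop := by
  refine tendsto_atTop_finset_of_monotone (fun K K' h k hk => ?_) fun k => ⟨k, ?_⟩
  · rw [mem_cyclesUpTo] at hk ⊢; omega
  · rw [mem_cyclesUpTo]

section Saturation

variable {d : ℕ} {β a b μ : ℝ} {κ : ℝ≥0∞}

/-- Increasing y is admissible even at the boundary y = κ, so the derivative -s - by cannot be
negative. With s = 0 it would be -by < 0. -/
lemma IsGroundState.effectivePotential_neg (hd : 1 ≤ d) (hβ : 0 < β) (hb : 0 < b) (hba : b < a)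
    {z : ℝ × ℝ} (hz : IsGroundState d β a b μ κ z) (hz0 : 0 < z.2) :
    effectivePotential d β a (μ - a * z.2) < 0 := by
  have ha := hb.trans hba
  refine (effectivePotential_nonpos hd hβ ha _).lt_of_ne fun h0 => ?_
  have hder := hasDerivAt_reducedEnergy (d := d) (b := b) (μ := μ) hd hβ ha z.2
  have hκz : κ ≤ ENNReal.ofReal z.2 := hz.mem.2.2.resolve_left hz0.ne'
  rw [h0] at hder
  have hneg : -0 - b * z.2 < 0 := by have := mul_pos hb hz0; linarith
  have hev := (hasDerivAt_iff_tendsto_slope.mp hder).eventually_lt_const hneg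
  have hev2 : ∀ᶠ y in 𝓝[>] z.2, slope (reducedEnergy d β a b μ) z.2 y < 0 :=
    hev.filter_mono (nhdsWithin_mono z.2 fun y hy => ne_of_gt hy)
  obtain ⟨y, hy, hlt⟩ := (hev2.and self_mem_nhdsWithin).exists
  have hlt : z.2 < y := hlt
  rw [slope_def_field, div_neg_iff] at hy
  have := hz.reduced_le hd hβ ha (hz0.trans hlt).le
    (Or.inr (hκz.trans (ENNReal.ofReal_le_ofReal hlt.le)))
  rcases hy with h | h <;> linarith [h.1, h.2]

/-- Since s < 0, the short cycles carry exactly the ideal-gas density at s: the condensate is in the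
long cycles alone. -/
lemma IsGroundState.hasSum_of_pos (hd : 1 ≤ d) (hβ : 0 < β) (hb : 0 < b) (hba : b < a)
    {z : ℝ × ℝ} (hz : IsGroundState d β a b μ κ z) (hz0 : 0 < z.2) :
    HasSum (cycleDensity d β (μ - a * (z.1 + z.2))) z.1 := by
  have ha := hb.trans hba
  have h1 := (isConjugate_effectivePotential (d := d) hd hβ ha (μ - a * z.2)).hasSum
    (hz.effectivePotential_neg hd hβ hb hba hz0)
  have h2 := mul_meanFieldDensity (d := d) (β := β) ha (μ - a * z.2)
  rw [← hz.fst_eq hd hβ ha] at h1 h2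
  have : μ - a * (z.1 + z.2) = effectivePotential d β a (μ - a * z.2) := by linarith
  rwa [this]

/-- Suppose y = 0 is optimal among all y ≥ 0. Then s(μ - ay) < 0 for every y > 0, since s = 0 would
make y strictly better. The density at μ - ay is therefore a full series, and y ↓ 0 excludes an
excess at y = 0, even if s(μ) = 0. -/
lemma IsGroundState.hasSum_of_unrestricted (hd : 1 ≤ d) (hβ : 0 < β) (hb : 0 < b) (hba : b < a)
    {z : ℝ × ℝ} (hz : IsGroundState d β a b μ 0 z) :
    HasSum (cycleDensity d β (μ - a * (z.1 + z.2))) z.1 := by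
  have ha := hb.trans hba
  rcases hz.mem.2.1.eq_or_lt with h0 | h0
  swap
  · exact hz.hasSum_of_pos hd hβ hb hba h0
  have hz' := hz.eq_of_zero hd hβ ha h0.symm
  have hs : μ - a * (z.1 + z.2) = effectivePotential d β a μ := by
    rw [hz', add_zero, mul_meanFieldDensity ha]; ring
  rw [hs, hz']
  have hc := isConjugate_effectivePotential (d := d) hd hβ ha μ
  refine hasSum_of_isLUB_of_nonneg _ (fun k => (cycleDensity_pos hβ _ k).le) ⟨?_, fun B hB => ?_⟩
  · rintro _ ⟨F, rfl⟩
    exact hc.sum_le F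
  have hneg : ∀ y, 0 < y → effectivePotential d β a (μ - a * y) < 0 := by
    intro y hy
    refine (effectivePotential_nonpos hd hβ ha _).lt_of_ne fun h => ?_
    have h1 := reducedEnergy_lt_of_effectivePotential_eq_zero hd hβ hb ha hy h
    have h2 := hz.reduced_le hd hβ ha hy.le (Or.inr (by simp))
    rw [← h0] at h2
    linarith
  have hle : ∀ y, 0 < y → meanFieldDensity d β a (μ - a * y) ≤ B := by
    intro y hy
    refine le_of_tendsto ((isConjugate_effectivePotential hd hβ ha _).hasSum (hneg y hy))
      (Eventually.of_forall fun F => ?_)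
    refine (Finset.sum_le_sum fun k _ => cycleDensity_mono hβ k ?_).trans (hB ⟨F, rfl⟩)
    exact effectivePotential_mono hd hβ ha (by nlinarith)
  have hcont : Continuous fun y => meanFieldDensity d β a (μ - a * y) :=
    (continuous_meanFieldDensity hd hβ ha).comp (by fun_prop)
  have hlim : Tendsto (fun y => meanFieldDensity d β a (μ - a * y)) (𝓝[>] 0)
      (𝓝 (meanFieldDensity d β a μ)) := by
    have := (hcont.tendsto 0).mono_left (nhdsWithin_le_nhds (s := Set.Ioi 0))
    simpa using this
  refine le_of_tendsto hlim ?_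
  filter_upwards [self_mem_nhdsWithin] with y hy
  exact hle y hy

/-! ### The critical density -/

lemma cycleDensity_zero (d : ℕ) (β : ℝ) (k : ℕ+) :
    cycleDensity d β 0 k = 1 / (4 * Real.pi * β) ^ ((d : ℝ) / 2) * (1 / (k : ℝ) ^ ((d : ℝ) / 2)) := by
  have hk : (0 : ℝ) < k := by exact_mod_cast k.pos
  unfold cycleDensity cycleWeight
  rw [Real.rpow_add hk, Real.rpow_one]
  simp only [mul_zero, zero_mul, Real.exp_zero, mul_one]
  have : (k : ℝ) ^ ((d : ℝ) / 2) ≠ 0 := (Real.rpow_pos_of_pos hk _).ne'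
  field_simp

lemma summable_cycleDensity_zero_iff (hβ : 0 < β) :
    Summable (cycleDensity d β 0) ↔ 3 ≤ d := by
  have hC : 1 / (4 * Real.pi * β) ^ ((d : ℝ) / 2) ≠ 0 := by positivity
  have h1 : Summable (cycleDensity d β 0) ↔
      Summable fun k : ℕ+ => 1 / ((k : ℕ) : ℝ) ^ ((d : ℝ) / 2) := by
    rw [← summable_mul_left_iff (f := fun k : ℕ+ => 1 / ((k : ℕ) : ℝ) ^ ((d : ℝ) / 2)) hC]
    exact summable_congr fun k => cycleDensity_zero d β k
  rw [h1, summable_pnat_iff_summable_nat (f := fun k : ℕ => 1 / (k : ℝ) ^ ((d : ℝ) / 2)),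
    Real.summable_one_div_nat_rpow]
  constructor
  · intro h
    have : (2 : ℝ) < d := by linarith
    exact_mod_cast this
  · intro h
    have : (3 : ℝ) ≤ d := by exact_mod_cast h
    linarith

lemma tsum_cycleDensity_zero (d : ℕ) (β : ℝ) : ∑' k, cycleDensity d β 0 k =
    1 / (4 * Real.pi * β) ^ ((d : ℝ) / 2) * ∑' k : ℕ+, 1 / (k : ℝ) ^ ((d : ℝ) / 2) := by
  rw [← tsum_mul_left]
  exact tsum_congr (cycleDensity_zero d β)

lemma meanFieldExcess_of_le (h : 3 ≤ d → μ / a ≤ ∑' k, cycleDensity d β 0 k) :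
    meanFieldExcess d β a μ = 0 := by
  unfold meanFieldExcess criticalDensity
  split_ifs with h3
  · rw [← tsum_cycleDensity_zero, ← EReal.coe_sub]
    have h' := h h3
    have : max ((μ / a - ∑' k, cycleDensity d β 0 k : ℝ) : EReal) 0 = 0 :=
      max_eq_right (by exact_mod_cast sub_nonpos.mpr h')
    rw [this, EReal.toReal_zero]
  · simp

lemma meanFieldExcess_of_ge (h3 : 3 ≤ d) (h : ∑' k, cycleDensity d β 0 k ≤ μ / a) :
    meanFieldExcess d β a μ = μ / a - ∑' k, cycleDensity d β 0 k := by
  unfold meanFieldExcess criticalDensity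
  rw [if_pos h3, ← tsum_cycleDensity_zero, ← EReal.coe_sub]
  have : max ((μ / a - ∑' k, cycleDensity d β 0 k : ℝ) : EReal) 0 =
      ((μ / a - ∑' k, cycleDensity d β 0 k : ℝ) : EReal) :=
    max_eq_left (by exact_mod_cast sub_nonneg.mpr h)
  rw [this, EReal.toReal_coe]

/-- The excess over the saturation density in the mean-field gas. -/
lemma tendsto_meanFieldExcess (hd : 1 ≤ d) (hβ : 0 < β) (ha : 0 < a) (μ : ℝ) :
    Tendsto (fun K => meanFieldDensity d β a μ -
      ∑ k ∈ cyclesUpTo K, cycleDensity d β (effectivePotential d β a μ) k) atTop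
      (𝓝 (meanFieldExcess d β a μ)) := by
  have hc := isConjugate_effectivePotential (d := d) hd hβ ha μ
  rcases hc.nonpos.lt_or_eq with hs | hs
  · have hsum := hc.hasSum hs
    have : meanFieldExcess d β a μ = 0 := by
      refine meanFieldExcess_of_le fun h3 => ?_
      have h0 := (summable_cycleDensity_zero_iff hβ).mpr h3
      calc μ / a ≤ meanFieldDensity d β a μ :=
            div_le_div_of_nonneg_right (by linarith) ha.le
        _ = ∑' k, cycleDensity d β (effectivePotential d β a μ) k := hsum.tsum_eq.symm
        _ ≤ _ := hsum.summable.tsum_le_tsum (fun k => cycleDensity_mono hβ k hs.le) h0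
    rw [this, ← sub_self (meanFieldDensity d β a μ)]
    exact tendsto_const_nhds.sub (hsum.comp tendsto_cyclesUpTo)
  · have hX : meanFieldDensity d β a μ = μ / a := by rw [meanFieldDensity, hs, sub_zero]
    have hle := hc.sum_le
    rw [hs, hX] at *
    -- Bounded partial sums make the series at s = 0 converge, which forces 3 ≤ d and hence a finite
    -- ϱ_c.
    have hsum : Summable (cycleDensity d β 0) :=
      summable_of_sum_le (fun k => (cycleDensity_pos hβ 0 k).le) hle
    rw [meanFieldExcess_of_ge ((summable_cycleDensity_zero_iff hβ).mp hsum)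
      (hsum.tsum_le_of_sum_le hle)]
    exact tendsto_const_nhds.sub (hsum.hasSum.comp tendsto_cyclesUpTo)

end Saturation

/-! ### Summability and the lower bound on the partition function -/

lemma ThermoSeq.volume_eq {d : ℕ} {κ : ℝ≥0∞} (S : ThermoSeq d κ) (n : ℕ) :
    volume (Set.Icc (fun i => -(S.side n i) / 2) (fun i => S.side n i / 2)) =
      ENNReal.ofReal (S.vol n) := by
  rw [ThermoSeq.vol, ENNReal.ofReal_toReal]
  rw [Real.volume_Icc_pi]
  exact ENNReal.prod_ne_top fun i _ => ENNReal.ofReal_ne_top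

lemma ThermoSeq.vol_pos {d : ℕ} {κ : ℝ≥0∞} (S : ThermoSeq d κ) (n : ℕ) : 0 < S.vol n := by
  rw [ThermoSeq.vol, Real.volume_Icc_pi, ENNReal.toReal_prod]
  refine Finset.prod_pos fun i _ => ?_
  have := S.side_pos n i
  rw [ENNReal.toReal_ofReal (by linarith)]
  linarith

lemma ThermoSeq.tendsto_vol {d : ℕ} {κ : ℝ≥0∞} (S : ThermoSeq d κ) :
    Tendsto S.vol atTop atTop := S.tendsto_volume

lemma ThermoSeq.tendsto_ofReal_ratio {d : ℕ} {κ : ℝ≥0∞} (S : ThermoSeq d κ) :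
    Tendsto (fun n => ENNReal.ofReal (S.cutoff n / S.vol n)) atTop (𝓝 κ) := by
  refine S.tendsto_ratio.congr fun n => ?_
  rw [S.volume_eq, ENNReal.ofReal_div_of_pos (S.vol_pos n), ENNReal.ofReal_natCast]

lemma ThermoSeq.tendsto_toReal_ratio {d : ℕ} {κ : ℝ≥0∞} (S : ThermoSeq d κ) (hκ : κ ≠ ⊤) :
    Tendsto (fun n => (S.cutoff n / S.vol n : ℝ)) atTop (𝓝 κ.toReal) := by
  refine ((ENNReal.tendsto_toReal hκ).comp S.tendsto_ofReal_ratio).congr fun n => ?_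
  have := S.vol_pos n
  exact ENNReal.toReal_ofReal (by positivity)

section LowerBound

variable {d : ℕ} {β a b μ V : ℝ}

lemma summable_gibbsWeight_mul (hd : 1 ≤ d) (hβ : 0 < β) (hV : 0 < V) (hb : 0 ≤ b) (hba : b < a)
    (μ : ℝ) (m : ℕ) :
    Summable fun n => gibbsWeight d β a b μ V m n * (1 + totalDensity V n) := by
  refine summable_of_sum_le (fun n => mul_nonneg (gibbsWeight_pos hβ hV m n).le
    (add_nonneg zero_le_one (totalDensity_nonneg hV n)))
    (fun T => sum_gibbsWeight_mul_le (m := m)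
      (e := -idealPressure d β 0 - 1 - (μ + 1) ^ 2 / (2 * (a - b))) hd hβ hV hb one_pos T
      fun n _ => ?_)
  rw [totalDensity_eq V m]
  exact linear_le_rateEnergy hβ hb hba 1 (by positivity) (by positivity)

lemma summable_gibbsWeight (hd : 1 ≤ d) (hβ : 0 < β) (hV : 0 < V) (hb : 0 ≤ b) (hba : b < a)
    (μ : ℝ) (m : ℕ) : Summable (gibbsWeight d β a b μ V m) := by
  refine Summable.of_nonneg_of_le (fun n => (gibbsWeight_pos hβ hV m n).le) (fun n => ?_)
    (summable_gibbsWeight_mul hd hβ hV hb hba μ m)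
  have := gibbsWeight_pos (d := d) (a := a) (b := b) (μ := μ) hβ hV m n
  have := totalDensity_nonneg hV n
  nlinarith

lemma partitionFunction_pos (hd : 1 ≤ d) (hβ : 0 < β) (hV : 0 < V) (hb : 0 ≤ b) (hba : b < a)
    (μ : ℝ) (m : ℕ) : 0 < partitionFunction d β a b μ V m :=
  (summable_gibbsWeight hd hβ hV hb hba μ m).tsum_pos
    (fun n => (gibbsWeight_pos hβ hV m n).le) 0 (gibbsWeight_pos hβ hV m 0)

/-- The Stirling sequence is antitone and starts at e/√2, so n! ≤ e √n (n/e)^n. -/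
lemma log_factorial_le {n : ℕ} (hn : n ≠ 0) :
    Real.log n.factorial ≤ n * Real.log n - n + (Real.log n + 1) := by
  obtain ⟨j, rfl⟩ := Nat.exists_eq_succ_of_ne_zero hn
  have h := Stirling.log_stirlingSeq'_antitone (Nat.zero_le j)
  simp only [Function.comp] at h
  rw [Stirling.log_stirlingSeq_formula, Stirling.stirlingSeq_one,
    Real.log_div (Real.exp_pos _).ne' (by positivity), Real.log_exp,
    Real.log_sqrt (by norm_num)] at h
  have hj : (0 : ℝ) < (j.succ : ℝ) := by positivity
  have hj1 : (1 : ℝ) ≤ (j.succ : ℝ) := by exact_mod_cast Nat.succ_le_succ (Nat.zero_le j)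
  rw [Real.log_mul (by norm_num) hj.ne', Real.log_div hj.ne' (Real.exp_pos _).ne',
    Real.log_exp] at h
  have := Real.log_nonneg hj1
  nlinarith

/-- Stirling's bound with n/V → c gives the exponential rate c log(q/c) + c; the logarithmic error
vanishes per volume. -/
lemma eventually_exp_le_pow_div_factorial {q c ε : ℝ} (hq : 0 < q) (hc : 0 < c) (hε : 0 < ε) :
    ∀ᶠ V : ℝ in atTop, Real.exp (V * (c * Real.log (q / c) + c - ε)) ≤
      (V * q) ^ ⌊c * V⌋₊ / (⌊c * V⌋₊.factorial : ℝ) := by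
  have hr : Tendsto (fun V : ℝ => (⌊c * V⌋₊ : ℝ) / V) atTop (𝓝 c) :=
    tendsto_nat_floor_mul_div_atTop hc.le
  have hlog : Tendsto (fun V : ℝ => (Real.log V + (Real.log c + 1)) / V) atTop (𝓝 0) := by
    have h1 : Tendsto (fun V : ℝ => Real.log V / V) atTop (𝓝 0) :=
      Real.isLittleO_log_id_atTop.tendsto_div_nhds_zero
    have h2 : Tendsto (fun V : ℝ => (Real.log c + 1) / V) atTop (𝓝 0) :=
      tendsto_const_nhds.div_atTop tendsto_id
    simpa [add_div] using h1.add h2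
  have hlim : Tendsto (fun V : ℝ => (⌊c * V⌋₊ : ℝ) / V * Real.log (q / ((⌊c * V⌋₊ : ℝ) / V)) +
      (⌊c * V⌋₊ : ℝ) / V - (Real.log V + (Real.log c + 1)) / V) atTop
      (𝓝 (c * Real.log (q / c) + c - 0)) := by
    refine ((hr.mul ?_).add hr).sub hlog
    exact (Tendsto.div tendsto_const_nhds hr hc.ne').log (div_pos hq hc).ne'
  have hlt : c * Real.log (q / c) + c - ε < c * Real.log (q / c) + c - 0 := by linarith
  filter_upwards [hlim.eventually_const_lt hlt, eventually_gt_atTop 0,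
    eventually_ge_atTop (1 / c)] with V hV hV0 hVc
  set n := ⌊c * V⌋₊ with hn
  have hcV : 1 ≤ c * V := by rwa [div_le_iff₀' hc] at hVc
  have hn1 : 1 ≤ n := Nat.one_le_floor_iff _ |>.mpr hcV
  have hn0 : (0 : ℝ) < n := by exact_mod_cast hn1
  have hnle : (n : ℝ) ≤ c * V := Nat.floor_le (by positivity)
  rw [← Real.le_log_iff_exp_le (by positivity), Real.log_div (x := (V * q) ^ n) (by positivity)
    (by positivity), Real.log_pow]
  have h1 := log_factorial_le (n := n) (by omega)
  have h2 : Real.log n ≤ Real.log c + Real.log V := by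
    rw [← Real.log_mul hc.ne' hV0.ne']
    exact Real.log_le_log hn0 hnle
  have h3 : q / ((n : ℝ) / V) = (V * q) / n := by field_simp
  rw [h3, Real.log_div (by positivity) hn0.ne'] at hV
  have h4 := mul_lt_mul_of_pos_left hV hV0
  have h5 : V * ((n : ℝ) / V * (Real.log (V * q) - Real.log n) + (n : ℝ) / V -
      (Real.log V + (Real.log c + 1)) / V) =
      n * (Real.log (V * q) - Real.log n) + n - (Real.log V + (Real.log c + 1)) := by
    field_simp
  rw [h5] at h4
  nlinarith

/-- The weight of one cycle of length O(V) decays only polynomially, so it is free on the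
exponential scale. -/
lemma eventually_exp_le_cycleWeight (hβ : 0 < β) {ι : Type*} {l : Filter ι} {V : ι → ℝ}
    (hV : Tendsto V l atTop) {k : ι → ℕ+} {C : ℝ} (hk : ∀ᶠ i in l, (k i : ℝ) ≤ C * V i)
    {ε : ℝ} (hε : 0 < ε) :
    ∀ᶠ i in l, Real.exp (-(V i * ε)) ≤ V i * cycleWeight d β (k i) := by
  set p : ℝ := 1 + (d : ℝ) / 2 with hp
  set C₀ : ℝ := (4 * Real.pi * β) ^ ((d : ℝ) / 2) with hC₀
  have hC₀0 : 0 < C₀ := by positivity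
  have hexp := (tendsto_exp_mul_div_rpow_atTop p ε hε).comp hV
  filter_upwards [hexp.eventually_ge_atTop (C₀ * (max C 0) ^ p), hk, hV.eventually_ge_atTop 1]
    with i h1 h2 h3
  have hV0 : 0 < V i := by linarith
  have hk0 : (0 : ℝ) < k i := by exact_mod_cast (k i).pos
  simp only [Function.comp] at h1
  rw [le_div_iff₀ (Real.rpow_pos_of_pos hV0 _), mul_assoc,
    ← Real.mul_rpow (le_max_right _ _) hV0.le] at h1
  have h4 : (k i : ℝ) ^ p ≤ (max C 0 * V i) ^ p := by
    refine Real.rpow_le_rpow hk0.le (h2.trans ?_) (by positivity)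
    exact mul_le_mul_of_nonneg_right (le_max_left _ _) hV0.le
  have hkp : 0 < (k i : ℝ) ^ p := Real.rpow_pos_of_pos hk0 _
  have h5 : C₀ * (k i : ℝ) ^ p ≤ Real.exp (ε * V i) :=
    (mul_le_mul_of_nonneg_left h4 hC₀0.le).trans h1
  unfold cycleWeight
  rw [Real.exp_neg, mul_comm (V i) ε, ← hp, ← hC₀, mul_one_div, inv_eq_one_div]
  exact div_le_div₀ hV0.le h3 (by positivity) h5

/-- Configurations with `f k` cycles of each length `k ≤ K`, and one further cycle of length `l`. -/
def testConfig (K : ℕ) (f : ℕ+ → ℕ) (l : ℕ+) : Counts :=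
  Finsupp.indicator (insert l (cyclesUpTo K)) fun k _ => if k = l then 1 else f k

lemma testConfig_self (K : ℕ) (f : ℕ+ → ℕ) (l : ℕ+) : testConfig K f l l = 1 := by
  unfold testConfig
  rw [Finsupp.indicator_of_mem (Finset.mem_insert_self _ _)]
  simp

lemma testConfig_of_mem {K : ℕ} (f : ℕ+ → ℕ) {l k : ℕ+} (hl : K < (l : ℕ))
    (hk : k ∈ cyclesUpTo K) : testConfig K f l k = f k := by
  unfold testConfig
  rw [Finsupp.indicator_of_mem (Finset.mem_insert_of_mem hk)]
  have : k ≠ l := by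
    rintro rfl
    rw [mem_cyclesUpTo] at hk
    omega
  simp [this]

lemma testConfig_notMem {K : ℕ} {l : ℕ+} (hl : K < (l : ℕ)) : l ∉ cyclesUpTo K := by
  rw [mem_cyclesUpTo]; omega

lemma testConfig_prod {K : ℕ} (f : ℕ+ → ℕ) {l : ℕ+} (hl : K < (l : ℕ)) (g : ℕ+ → ℕ → ℝ)
    (hg : ∀ k, g k 0 = 1) :
    (testConfig K f l).prod g = g l 1 * ∏ k ∈ cyclesUpTo K, g k (f k) := by
  rw [Finsupp.prod_of_support_subset (testConfig K f l) (s := insert l (cyclesUpTo K))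
    (Finsupp.support_indicator_subset _ _) _ fun k _ => hg k,
    Finset.prod_insert (testConfig_notMem hl)]
  congr 1
  · congr 1; exact testConfig_self K f l
  · exact Finset.prod_congr rfl fun k hk => congrArg _ (testConfig_of_mem f hl hk)

lemma testConfig_sum {K : ℕ} (f : ℕ+ → ℕ) {l : ℕ+} (hl : K < (l : ℕ)) (g : ℕ+ → ℕ → ℝ)
    (hg : ∀ k, g k 0 = 0) :
    (testConfig K f l).sum g = g l 1 + ∑ k ∈ cyclesUpTo K, g k (f k) := by
  rw [Finsupp.sum_of_support_subset (testConfig K f l) (s := insert l (cyclesUpTo K))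
    (Finsupp.support_indicator_subset _ _) _ fun k _ => hg k,
    Finset.sum_insert (testConfig_notMem hl)]
  congr 1
  · congr 1; exact testConfig_self K f l
  · exact Finset.sum_congr rfl fun k hk => congrArg _ (testConfig_of_mem f hl hk)

/-- One test configuration bounds the whole sum from below. Here z is the density in the extra cycle
and y the part credited in the counter term: y = z if the cycle is certainly long, y = 0 if its sign
alone is used. Short cycles, the extra cycle and the interaction each lose at most δ/4. -/
lemma eventually_le_partitionFunction (hd : 1 ≤ d) (hβ : 0 < β) (hb : 0 ≤ b) (hba : b < a)
    (μ s z y : ℝ) (K : ℕ) {V : ℕ → ℝ} (hV : Tendsto V atTop atTop) (m : ℕ → ℕ) (l : ℕ → ℕ+)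
    (hl : ∀ᶠ i in atTop, K < (l i : ℕ)) (hlz : Tendsto (fun i => (l i : ℝ) / V i) atTop (𝓝 z))
    (hy : y = 0 ∨ (y = z ∧ ∀ᶠ i in atTop, m i ≤ (l i : ℕ))) {δ : ℝ} (hδ : 0 < δ) :
    ∀ᶠ i in atTop, Real.exp (V i * (∑ k ∈ cyclesUpTo K,
        (cycleWeight d β k * Real.exp (β * s * k) - β * s * cycleDensity d β s k) +
        β * (μ * (∑ k ∈ cyclesUpTo K, cycleDensity d β s k + z) -
          a / 2 * (∑ k ∈ cyclesUpTo K, cycleDensity d β s k + z) ^ 2 + b / 2 * y ^ 2) - δ)) ≤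
      partitionFunction d β a b μ (V i) (m i) := by
  set c : ℕ+ → ℝ := fun k => cycleWeight d β k * Real.exp (β * s * k) with hc
  have hc0 : ∀ k, 0 < c k := fun k => by
    have := cycleWeight_pos (d := d) hβ k; simp only [hc]; positivity
  have hkc : ∀ k, cycleDensity d β s k = k * c k := fun k => by
    simp only [cycleDensity, hc]; ring
  -- With this choice the K short lengths together lose at most δ/4.
  set ε : ℝ := δ / (4 * (K + 1)) with hε
  have hε0 : 0 < ε := by positivity
  have e1 : ∀ᶠ i in atTop, ∀ k ∈ cyclesUpTo K,
      Real.exp (V i * (c k - β * s * cycleDensity d β s k - ε)) ≤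
      (V i * cycleWeight d β k) ^ ⌊c k * V i⌋₊ / (⌊c k * V i⌋₊.factorial : ℝ) := by
    rw [Filter.eventually_all_finset]
    intro k _
    have hq := cycleWeight_pos (d := d) hβ k
    have h := hV.eventually (eventually_exp_le_pow_div_factorial hq (hc0 k) hε0)
    have hlog : Real.log (cycleWeight d β k / c k) = -(β * s * k) := by
      simp only [hc]
      rw [div_mul_cancel_left₀ hq.ne', ← Real.exp_neg, Real.log_exp]
    rw [hlog] at h
    filter_upwards [h] with i hi
    refine le_trans (le_of_eq ?_) hi
    rw [hkc]
    congr 1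
    ring
  have e2 : ∀ᶠ i in atTop, Real.exp (-(V i * (δ / 4))) ≤ V i * cycleWeight d β (l i) := by
    refine eventually_exp_le_cycleWeight hβ hV (C := z + 1) ?_ (by positivity)
    filter_upwards [hlz.eventually_lt_const (lt_add_one z), hV.eventually_gt_atTop 0] with i h1 h2
    rw [div_lt_iff₀ h2] at h1
    exact h1.le
  set ρ : ℕ → ℝ := fun i => (l i : ℝ) * ((1 : ℕ) / V i) +
    ∑ k ∈ cyclesUpTo K, (k : ℝ) * ((⌊c k * V i⌋₊ : ℝ) / V i) with hρ
  have hρlim : Tendsto ρ atTop (𝓝 (z + ∑ k ∈ cyclesUpTo K, cycleDensity d β s k)) := by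
    refine Tendsto.add ?_ (tendsto_finsetSum _ fun k _ => ?_)
    · simpa [div_eq_mul_inv] using hlz
    · rw [hkc]
      exact ((tendsto_nat_floor_mul_div_atTop (hc0 k).le).comp hV).const_mul _
  have e3 : ∀ᶠ i in atTop, β * (μ * (z + ∑ k ∈ cyclesUpTo K, cycleDensity d β s k) -
      a / 2 * (z + ∑ k ∈ cyclesUpTo K, cycleDensity d β s k) ^ 2 + b / 2 * y ^ 2) - δ / 4 <
      β * (μ * ρ i - a / 2 * ρ i ^ 2 + b / 2 * counterTerm (V i) (m i)
        (testConfig K (fun k => ⌊c k * V i⌋₊) (l i))) := by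
    have hbase : Tendsto (fun i => β * (μ * ρ i - a / 2 * ρ i ^ 2)) atTop
        (𝓝 (β * (μ * (z + ∑ k ∈ cyclesUpTo K, cycleDensity d β s k) -
          a / 2 * (z + ∑ k ∈ cyclesUpTo K, cycleDensity d β s k) ^ 2))) :=
      (((hρlim.const_mul μ).sub ((hρlim.pow 2).const_mul (a / 2))).const_mul β)
    have hnn : ∀ i, ∀ k ∈ (testConfig K (fun k => ⌊c k * V i⌋₊) (l i)).support,
        0 ≤ if m i ≤ (k : ℕ) then (k : ℝ) ^ 2 *
          ((testConfig K (fun k => ⌊c k * V i⌋₊) (l i) k : ℝ) / V i) ^ 2 else 0 := by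
      intro i k _
      split_ifs <;> positivity
    rcases hy with rfl | ⟨rfl, hm⟩
    · filter_upwards [hbase.eventually_const_lt (sub_lt_self _ (by positivity : 0 < δ / 4))]
        with i h1
      have h2 : 0 ≤ counterTerm (V i) (m i) (testConfig K (fun k => ⌊c k * V i⌋₊) (l i)) :=
        Finset.sum_nonneg (hnn i)
      have h3 : 0 ≤ β * (b / 2 * counterTerm (V i) (m i)
        (testConfig K (fun k => ⌊c k * V i⌋₊) (l i))) := by positivity
      linarith
    · have hb2 := hbase.add (((hlz.pow 2).const_mul (b / 2)).const_mul β)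
      filter_upwards [hb2.eventually_const_lt (sub_lt_self _ (by positivity : 0 < δ / 4)), hm]
        with i h1 hmi
      have h2 : ((l i : ℝ) / V i) ^ 2 ≤
          counterTerm (V i) (m i) (testConfig K (fun k => ⌊c k * V i⌋₊) (l i)) := by
        have hmem : l i ∈ (testConfig K (fun k => ⌊c k * V i⌋₊) (l i)).support := by
          rw [Finsupp.mem_support_iff, testConfig_self]; norm_num
        refine le_trans (le_of_eq ?_) (Finset.single_le_sum (hnn i) hmem)
        rw [if_pos hmi, testConfig_self]
        push_cast
        ring
      have h3 : β * (b / 2 * ((l i : ℝ) / V i) ^ 2) ≤ β * (b / 2 * counterTerm (V i) (m i)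
        (testConfig K (fun k => ⌊c k * V i⌋₊) (l i))) := by gcongr
      linarith
  filter_upwards [e1, e2, e3, hl, hV.eventually_gt_atTop 0] with i h1 h2 h3 hli hVi
  set n := testConfig K (fun k => ⌊c k * V i⌋₊) (l i) with hn
  have hZ : gibbsWeight d β a b μ (V i) (m i) n ≤ partitionFunction d β a b μ (V i) (m i) :=
    (summable_gibbsWeight hd hβ hVi hb hba μ (m i)).le_tsum n
      fun n' _ => (gibbsWeight_pos hβ hVi _ n').le
  refine le_trans ?_ hZ
  have hρi : totalDensity (V i) n = ρ i := testConfig_sum _ hli _ (by simp)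
  have hP : poissonWeight (fun k => V i * cycleWeight d β k) n =
      (V i * cycleWeight d β (l i)) ^ 1 / (Nat.factorial 1 : ℝ) * ∏ k ∈ cyclesUpTo K,
        (V i * cycleWeight d β k) ^ ⌊c k * V i⌋₊ / (⌊c k * V i⌋₊.factorial : ℝ) :=
    testConfig_prod _ hli _ (by simp)
  rw [gibbsWeight, hρi, hP, pow_one, Nat.factorial_one, Nat.cast_one, div_one]
  have hprod : Real.exp (V i * (∑ k ∈ cyclesUpTo K,
      (c k - β * s * cycleDensity d β s k) - δ / 4)) ≤ ∏ k ∈ cyclesUpTo K,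
        (V i * cycleWeight d β k) ^ ⌊c k * V i⌋₊ / (⌊c k * V i⌋₊.factorial : ℝ) := by
    refine le_trans ?_ (Finset.prod_le_prod (fun k _ => (Real.exp_pos _).le) h1)
    rw [← Real.exp_sum, Real.exp_le_exp, ← Finset.mul_sum]
    refine mul_le_mul_of_nonneg_left ?_ hVi.le
    rw [Finset.sum_sub_distrib (s := cyclesUpTo K) (fun k => c k - β * s * cycleDensity d β s k)
      (fun _ => ε), Finset.sum_const, nsmul_eq_mul]
    have hcard : ((cyclesUpTo K).card : ℝ) = K := by simp [cyclesUpTo]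
    rw [hcard, hε]
    have : (K : ℝ) * (δ / (4 * (K + 1))) ≤ δ / 4 := by
      have h4 : δ / 4 = (K + 1) * (δ / (4 * (K + 1))) := by field_simp
      rw [h4]
      have : 0 ≤ δ / (4 * ((K : ℝ) + 1)) := by positivity
      nlinarith
    linarith
  have hmul := mul_le_mul h2 hprod (Real.exp_pos _).le ((Real.exp_pos _).le.trans h2)
  refine le_trans ?_ (mul_le_mul_of_nonneg_right hmul (Real.exp_pos _).le)
  rw [← Real.exp_add, ← Real.exp_add, Real.exp_le_exp]
  have h4 := mul_lt_mul_of_pos_left h3 hVi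
  have h5 : 0 < V i * (δ / 4) := by positivity
  rw [add_comm (∑ k ∈ cyclesUpTo K, cycleDensity d β s k) z]
  nlinarith

end LowerBound

/-! ### The lower bound at ground states -/

section Concentration

variable {d : ℕ} {β a b μ : ℝ} {κ : ℝ≥0∞}

/-- Supplies the extra cycle: the maximum with u makes it longer than K or the cut-off, without
changing its density z since r ≤ z. -/
lemma tendsto_toPNat_max_ceil_div {V : ℕ → ℝ} (hV : Tendsto V atTop atTop) {u : ℕ → ℕ}
    (hu : ∀ i, 0 < u i) {r z : ℝ} (hur : Tendsto (fun i => (u i : ℝ) / V i) atTop (𝓝 r))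
    (hrz : r ≤ z) (hz : 0 ≤ z) :
    Tendsto (fun i => (((max (u i) ⌈z * V i⌉₊).toPNat' : ℕ+) : ℝ) / V i) atTop (𝓝 z) := by
  have h1 := hur.max ((tendsto_nat_ceil_mul_div_atTop hz).comp hV)
  rw [max_eq_right hrz] at h1
  refine h1.congr' ?_
  filter_upwards [hV.eventually_gt_atTop 0] with i hi
  have hpos : 0 < max (u i) ⌈z * V i⌉₊ := lt_max_of_lt_left (hu i)
  simp only [Function.comp]
  rw [Nat.toPNat'_coe, if_pos hpos, Nat.cast_max, max_div_div_right hi.le]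

lemma IsGroundState.eventually_le_partitionFunction (hd : 1 ≤ d) (hβ : 0 < β) (hb : 0 < b)
    (hba : b < a) {z : ℝ × ℝ} (hz : IsGroundState d β a b μ κ z) (S : ThermoSeq d κ) {δ : ℝ}
    (hδ : 0 < δ) :
    ∀ᶠ i in atTop, Real.exp (-(β * S.vol i * (rateEnergy d β a b μ z + δ))) ≤
      partitionFunction d β a b μ (S.vol i) (S.cutoff i) := by
  have ha := hb.trans hba
  obtain ⟨x, y⟩ := z
  have hx := hz.fst_eq hd hβ ha
  have hconj := isConjugate_effectivePotential (d := d) hd hβ ha (μ - a * y)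
  dsimp only at hx
  rw [← hx] at hconj
  set s := effectivePotential d β a (μ - a * y) with hs
  have hf := hconj.freeEnergy_eq hd hβ
  have hW : Tendsto (fun K => ∑ k ∈ cyclesUpTo K, cycleWeight d β k * Real.exp (β * s * k)) atTop
      (𝓝 (β * idealPressure d β s)) := by
    rw [beta_mul_idealPressure hβ]
    exact (summable_cycleWeight_mul_exp hd hβ hconj.nonpos).hasSum.comp tendsto_cyclesUpTo
  have hV := S.tendsto_vol
  have hKV : ∀ K : ℕ, Tendsto (fun i => ((K + 1 : ℕ) : ℝ) / S.vol i) atTop (𝓝 0) := fun K =>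
    tendsto_const_nhds.div_atTop hV
  have hβδ : 0 < β * δ / 2 := by positivity
  -- it suffices to find `K` and an admissible long cycle
  suffices h : ∃ K z, ∃ l : ℕ → ℕ+, (∀ᶠ i in atTop, K < (l i : ℕ)) ∧
      Tendsto (fun i => (l i : ℝ) / S.vol i) atTop (𝓝 z) ∧
      (y = 0 ∨ (y = z ∧ ∀ᶠ i in atTop, S.cutoff i ≤ (l i : ℕ))) ∧
      -(β * rateEnergy d β a b μ (x, y)) - β * δ / 2 < ∑ k ∈ cyclesUpTo K,
        (cycleWeight d β k * Real.exp (β * s * k) - β * s * cycleDensity d β s k) +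
        β * (μ * (∑ k ∈ cyclesUpTo K, cycleDensity d β s k + z) -
          a / 2 * (∑ k ∈ cyclesUpTo K, cycleDensity d β s k + z) ^ 2 + b / 2 * y ^ 2) by
    obtain ⟨K, z, l, h1, h2, h3, h4⟩ := h
    filter_upwards [CycleHYL.eventually_le_partitionFunction (d := d) hd hβ hb.le hba μ s z y K hV
      S.cutoff l h1 h2 h3 hβδ] with i hi
    refine le_trans (Real.exp_le_exp.mpr ?_) hi
    have := mul_lt_mul_of_pos_left h4 (S.vol_pos i)
    nlinarith
  rcases hz.mem.2.1.eq_or_lt with hy0 | hy0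
  · dsimp only at hy0
    -- If s = 0 the partial sums need not reach x, but multiplied by s they do no harm.
    have hsx : Tendsto (fun K => s * ∑ k ∈ cyclesUpTo K, cycleDensity d β s k) atTop
        (𝓝 (s * x)) := by
      rcases hconj.nonpos.lt_or_eq with h | h
      · exact ((hconj.hasSum h).comp tendsto_cyclesUpTo).const_mul s
      · simp [h]
    have hL := (hW.sub (hsx.const_mul β)).add_const (β * (μ * x - a / 2 * x ^ 2))
    have hE : β * idealPressure d β s - β * (s * x) + β * (μ * x - a / 2 * x ^ 2) =
        -(β * rateEnergy d β a b μ (x, y)) := by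
      simp only [rateEnergy, hf, ← hy0]; ring
    rw [hE] at hL
    obtain ⟨K, hK⟩ := (hL.eventually_const_lt (sub_lt_self _ hβδ)).exists
    have hz0 : 0 ≤ x - ∑ k ∈ cyclesUpTo K, cycleDensity d β s k :=
      sub_nonneg.mpr (hconj.sum_le _)
    -- The extra cycle takes the density missing from lengths up to K, condensate included, so the
    -- total is exactly x for every K.
    refine ⟨K, x - ∑ k ∈ cyclesUpTo K, cycleDensity d β s k, _, Eventually.of_forall fun i => ?_,
      tendsto_toPNat_max_ceil_div hV (fun _ => K.succ_pos) (hKV K) hz0 hz0, Or.inl hy0.symm, ?_⟩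
    · rw [Nat.toPNat'_coe, if_pos (lt_max_of_lt_left K.succ_pos)]
      exact lt_max_of_lt_left K.lt_succ_self
    · rw [Finset.sum_sub_distrib, ← Finset.mul_sum, add_sub_cancel, ← hy0]
      rw [← hy0] at hK
      linarith
  · dsimp only at hy0
    have hκ := hz.mem.2.2.resolve_left hy0.ne'
    dsimp only at hκ
    have hκtop : κ ≠ ⊤ := ne_top_of_le_ne_top ENNReal.ofReal_ne_top hκ
    have hsum := (hconj.hasSum (hz.effectivePotential_neg hd hβ hb hba hy0)).comp tendsto_cyclesUpTo
    have hρ := hsum.add_const y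
    have hL := (hW.sub (hsum.const_mul (β * s))).add
      ((((hρ.const_mul μ).sub ((hρ.pow 2).const_mul (a / 2))).add_const
        (b / 2 * y ^ 2)).const_mul β)
    have hE : β * idealPressure d β s - β * s * x +
        β * (μ * (x + y) - a / 2 * (x + y) ^ 2 + b / 2 * y ^ 2) =
        -(β * rateEnergy d β a b μ (x, y)) := by
      simp only [rateEnergy, hf]; ring
    rw [hE] at hL
    obtain ⟨K, hK⟩ := (hL.eventually_const_lt (sub_lt_self _ hβδ)).exists
    have hκy : max 0 κ.toReal ≤ y := by
      refine max_le hy0.le ?_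
      exact (ENNReal.toReal_mono ENNReal.ofReal_ne_top hκ).trans_eq (ENNReal.toReal_ofReal hy0.le)
    have hur : Tendsto (fun i => ((max (K + 1) (S.cutoff i) : ℕ) : ℝ) / S.vol i) atTop
        (𝓝 (max 0 κ.toReal)) := by
      refine ((hKV K).max (S.tendsto_toReal_ratio hκtop)).congr fun i => ?_
      rw [Nat.cast_max, max_div_div_right (S.vol_pos i).le]
    have hpos : ∀ i, 0 < max (K + 1) (S.cutoff i) := fun i => lt_max_of_lt_left K.succ_pos
    refine ⟨K, y, _, Eventually.of_forall fun i => ?_,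
      tendsto_toPNat_max_ceil_div hV hpos hur hκy hy0.le,
      Or.inr ⟨rfl, Eventually.of_forall fun i => ?_⟩, ?_⟩
    · rw [Nat.toPNat'_coe, if_pos (lt_max_of_lt_left (hpos i))]
      exact lt_max_of_lt_left (lt_max_of_lt_left K.lt_succ_self)
    · rw [Nat.toPNat'_coe, if_pos (lt_max_of_lt_left (hpos i))]
      exact le_max_of_le_left (le_max_right _ _)
    · rw [Finset.sum_sub_distrib, ← Finset.mul_sum]
      exact hK

/-! ### Concentration on the ground states -/

/-- Lower semicontinuity: the free energy is a supremum of affine functions and the rest is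
continuous. -/
lemma rateEnergy_le_of_tendsto (hβ : 0 < β) {u : ℕ → ℝ × ℝ} {z : ℝ × ℝ}
    (hu : Tendsto u atTop (𝓝 z)) (hu0 : ∀ j, 0 ≤ (u j).1) {e : ℕ → ℝ} {E : ℝ}
    (he : Tendsto e atTop (𝓝 E)) (hle : ∀ j, rateEnergy d β a b μ (u j) ≤ e j) :
    rateEnergy d β a b μ z ≤ E := by
  have h1 : Tendsto (fun j => (u j).1) atTop (𝓝 z.1) := (continuous_fst.tendsto z).comp hu
  have h2 : Tendsto (fun j => (u j).2) atTop (𝓝 z.2) := (continuous_snd.tendsto z).comp hu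
  have hf : freeEnergy d β z.1 ≤
      E + μ * (z.1 + z.2) - a / 2 * (z.1 + z.2) ^ 2 + b / 2 * z.2 ^ 2 := by
    refine ciSup_le fun s => ?_
    have hl : Tendsto (fun j => (s : ℝ) * (u j).1 - idealPressure d β s) atTop
        (𝓝 ((s : ℝ) * z.1 - idealPressure d β s)) := (h1.const_mul _).sub_const _
    have hr := ((he.add ((h1.add h2).const_mul μ)).sub (((h1.add h2).pow 2).const_mul (a / 2))).add
      ((h2.pow 2).const_mul (b / 2))
    refine le_of_tendsto_of_tendsto hl hr (Eventually.of_forall fun j => ?_)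
    have h3 := le_freeEnergy (d := d) hβ s.2 (hu0 j)
    have h4 := hle j
    simp only [rateEnergy] at h4
    dsimp only
    linarith
  simp only [rateEnergy]
  linarith

/-- Away from the ground states, the rate energy exceeds its minimum by a linear amount. -/
lemma IsGroundState.energy_gap (hβ : 0 < β) (hb : 0 < b) (hba : b < a) {z₀ : ℝ × ℝ}
    (hz₀ : IsGroundState d β a b μ κ z₀) (S : ThermoSeq d κ) {g : ℝ × ℝ → ℝ} (hg : Continuous g)
    (hg0 : ∀ z, IsGroundState d β a b μ κ z → g z = 0) {ε : ℝ} (hε : 0 < ε) :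
    ∃ η > 0, ∀ᶠ i in atTop, ∀ x y : ℝ, 0 ≤ x → 0 ≤ y → (y = 0 ∨ S.cutoff i / S.vol i ≤ y) →
      ε ≤ |g (x, y)| →
      rateEnergy d β a b μ z₀ + η * (1 + (x + y)) ≤ rateEnergy d β a b μ (x, y) := by
  by_contra! hcon
  have hex : ∀ j : ℕ, ∃ i, j ≤ i ∧ ∃ z : ℝ × ℝ, 0 ≤ z.1 ∧ 0 ≤ z.2 ∧
      (z.2 = 0 ∨ S.cutoff i / S.vol i ≤ z.2) ∧ ε ≤ |g z| ∧
      rateEnergy d β a b μ z < rateEnergy d β a b μ z₀ + 1 / ((j : ℝ) + 1) * (1 + (z.1 + z.2)) := by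
    intro j
    obtain ⟨i, hi, x, y, h⟩ := frequently_atTop.mp (hcon (1 / ((j : ℝ) + 1)) (by positivity)) j
    exact ⟨i, hi, (x, y), h⟩
  choose i hi u hu1 hu2 hu3 hu4 hu5 using hex
  -- Slope 2 exceeds the allowed slack, which is at most 1 per unit of 1 + x + y, so the sequence
  -- stays bounded.
  set e := -idealPressure d β 0 - 2 - (μ + 2) ^ 2 / (2 * (a - b)) with he
  set B := rateEnergy d β a b μ z₀ - e with hB
  have hbound : ∀ j, 1 + ((u j).1 + (u j).2) ≤ B := by
    intro j
    have h1 := linear_le_rateEnergy (d := d) (μ := μ) hβ hb.le hba 2 (hu1 j) (hu2 j)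
    have h2 := hu5 j
    have h3 : 1 / ((j : ℝ) + 1) ≤ 1 := by
      rw [div_le_one (by positivity)]; linarith [Nat.cast_nonneg (α := ℝ) j]
    have h4 : 1 / ((j : ℝ) + 1) * (1 + ((u j).1 + (u j).2)) ≤ 1 * (1 + ((u j).1 + (u j).2)) :=
      mul_le_mul_of_nonneg_right h3 (by linarith [hu1 j, hu2 j])
    have h5 : rateEnergy d β a b μ (u j) = rateEnergy d β a b μ ((u j).1, (u j).2) := rfl
    linarith
  have hmem : ∀ j, u j ∈ Set.Icc (0 : ℝ × ℝ) (B, B) := fun j =>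
    ⟨⟨hu1 j, hu2 j⟩, ⟨by linarith [hbound j, hu2 j], by linarith [hbound j, hu1 j]⟩⟩
  obtain ⟨z, -, φ, hφ, hlim⟩ := isCompact_Icc.tendsto_subseq hmem
  have hlim2 : Tendsto (fun j => (u (φ j)).2) atTop (𝓝 z.2) :=
    (continuous_snd.tendsto z).comp hlim
  have hlim1 : Tendsto (fun j => (u (φ j)).1) atTop (𝓝 z.1) :=
    (continuous_fst.tendsto z).comp hlim
  have hz1 : 0 ≤ z.1 := ge_of_tendsto' hlim1 fun j => hu1 _
  have hz2 : 0 ≤ z.2 := ge_of_tendsto' hlim2 fun j => hu2 _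
  have hitend : Tendsto (fun j => i (φ j)) atTop atTop :=
    tendsto_atTop_mono (fun j => hi (φ j)) hφ.tendsto_atTop
  -- Either y vanishes infinitely often along the subsequence, or eventually y ≥ m/V, and m/V tends
  -- to κ.
  have hdom : z.2 = 0 ∨ κ ≤ ENNReal.ofReal z.2 := by
    by_cases hfreq : ∃ᶠ j in atTop, (u (φ j)).2 = 0
    · left
      exact (isClosed_singleton (x := (0 : ℝ))).mem_of_frequently_of_tendsto hfreq hlim2
    · right
      rw [not_frequently] at hfreq
      refine le_of_tendsto_of_tendsto (S.tendsto_ofReal_ratio.comp hitend)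
        ((ENNReal.continuous_ofReal.tendsto _).comp hlim2) ?_
      filter_upwards [hfreq] with j hj
      exact ENNReal.ofReal_le_ofReal ((hu3 (φ j)).resolve_left hj)
  have hE : rateEnergy d β a b μ z ≤ rateEnergy d β a b μ z₀ := by
    have hz : Tendsto (fun j : ℕ => 1 / ((φ j : ℝ) + 1)) atTop (𝓝 0) :=
      tendsto_one_div_add_atTop_nhds_zero_nat.comp hφ.tendsto_atTop
    have h1 : Tendsto (fun j => rateEnergy d β a b μ z₀ + 1 / ((φ j : ℝ) + 1) * B) atTop
        (𝓝 (rateEnergy d β a b μ z₀)) := by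
      simpa using (hz.mul_const B).const_add (rateEnergy d β a b μ z₀)
    refine rateEnergy_le_of_tendsto hβ hlim (fun j => hu1 _) h1 fun j => ?_
    have h2 := hu5 (φ j)
    have h3 : 1 / ((φ j : ℝ) + 1) * (1 + ((u (φ j)).1 + (u (φ j)).2)) ≤ 1 / ((φ j : ℝ) + 1) * B :=
      mul_le_mul_of_nonneg_left (hbound _) (by positivity)
    simp only [Function.comp]
    linarith
  have hground : IsGroundState d β a b μ κ z :=
    ⟨⟨hz1, hz2, hdom⟩, fun w hw => hE.trans (hz₀.le w hw)⟩
  have hgz : ε ≤ |g z| :=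
    ge_of_tendsto' ((hg.abs.tendsto z).comp hlim) fun j => hu4 (φ j)
  rw [hg0 z hground, abs_zero] at hgz
  linarith

/-- The densities of short and of long cycles. -/
def densityPair (V : ℝ) (m : ℕ) (n : Counts) : ℝ × ℝ :=
  ((shortMass m n : ℝ) / V, (longMass m n : ℝ) / V)

lemma summable_gibbsWeight_mul_abs (hd : 1 ≤ d) (hβ : 0 < β) {V : ℝ} (hV : 0 < V) (hb : 0 ≤ b)
    (hba : b < a) (μ : ℝ) (m : ℕ) {f : Counts → ℝ} {C : ℝ}
    (hf : ∀ n, |f n| ≤ C * (1 + totalDensity V n)) :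
    Summable fun n => gibbsWeight d β a b μ V m n * |f n| := by
  refine Summable.of_nonneg_of_le
    (fun n => mul_nonneg (gibbsWeight_pos hβ hV m n).le (abs_nonneg _)) (fun n => ?_)
    ((summable_gibbsWeight_mul hd hβ hV hb hba μ m).mul_left C)
  have := mul_le_mul_of_nonneg_left (hf n)
    (gibbsWeight_pos (d := d) (a := a) (b := b) (μ := μ) hβ hV m n).le
  linarith

lemma integrable_gibbs_of_le (hd : 1 ≤ d) (hβ : 0 < β) {V : ℝ} (hV : 0 < V) (hb : 0 ≤ b)
    (hba : b < a) (α μ : ℝ) (m : ℕ) {f : Counts → ℝ} {C : ℝ}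
    (hf : ∀ n, |f n| ≤ C * (1 + totalDensity V n)) :
    Integrable f (gibbsMeasure d β α a b μ V m) :=
  integrable_gibbs hβ hV (summable_gibbsWeight hd hβ hV hb hba μ m)
    (summable_gibbsWeight_mul_abs hd hβ hV hb hba μ m hf)

/-- Under the Gibbs distribution, the pair of densities concentrates on the ground states. -/
theorem tendsto_integral_gibbs_zero (hd : 1 ≤ d) (hβ : 0 < β) (hb : 0 < b) (hba : b < a) (α : ℝ)
    (S : ThermoSeq d κ) {g : ℝ × ℝ → ℝ} (hg : Continuous g) {C : ℝ}
    (hgC : ∀ x y, 0 ≤ x → 0 ≤ y → |g (x, y)| ≤ C * (1 + (x + y)))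
    (hg0 : ∀ z, IsGroundState d β a b μ κ z → g z = 0) :
    Tendsto (fun i => ∫ n, g (densityPair (S.vol i) (S.cutoff i) n) ∂(S.gibbs β α a b μ i)) atTop
      (𝓝 0) := by
  obtain ⟨z₀, hz₀⟩ := exists_isGroundState (d := d) hd hβ hb hba μ κ
  have hC0 : 0 ≤ C := by
    have := (abs_nonneg _).trans (hgC 0 0 le_rfl le_rfl)
    linarith
  rw [Metric.tendsto_nhds]
  intro ε₀ hε₀
  set ε := ε₀ / 2 with hε
  have hε0 : 0 < ε := by positivity
  obtain ⟨η, hη, hgap⟩ := hz₀.energy_gap hβ hb hba S hg hg0 hε0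
  set c := (1 - Real.exp (-(β * η / 2)))⁻¹ ^ 2 with hc
  have hc0 : 0 ≤ c := by positivity
  have hV := S.tendsto_vol
  -- The energy gap yields e^{-βηV/2}. The tail weight and the lower bound on the partition function
  -- each use up a rate βη/8, and e^{-βηV/4} remains.
  have hβη : 0 < β * η / 8 := by positivity
  have htail := ((tendsto_tailWeight (d := d) (β := β) hd hβ).comp S.tendsto_cutoff)
    |>.eventually_lt_const hβη
  have hlow := hz₀.eventually_le_partitionFunction hd hβ hb hba S (by positivity : 0 < η / 8)
  have hsmall : Tendsto (fun i => C * (2 / (β * η) * c) * Real.exp (-(β * η / 4 * S.vol i))) atTop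
      (𝓝 0) := by
    have h1 : Tendsto (fun i => β * η / 4 * S.vol i) atTop atTop :=
      hV.const_mul_atTop (by positivity)
    simpa using (Real.tendsto_exp_neg_atTop_nhds_zero.comp h1).const_mul (C * (2 / (β * η) * c))
  filter_upwards [hgap, htail, hlow, hsmall.eventually_lt_const hε0, hV.eventually_ge_atTop 1]
    with i h1 h2 h3 h4 h5
  set V := S.vol i with hVi
  set m := S.cutoff i with hm
  have hV0 : 0 < V := by linarith
  set w := gibbsWeight d β a b μ V m with hw
  have hw0 : ∀ n, 0 < w n := fun n => gibbsWeight_pos hβ hV0 m n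
  set Z := partitionFunction d β a b μ V m with hZ
  have hZ0 : 0 < Z := partitionFunction_pos hd hβ hV0 hb.le hba μ m
  set G : Counts → ℝ := fun n => g (densityPair V m n) with hG
  have hGC : ∀ n, |G n| ≤ C * (1 + totalDensity V n) := fun n => by
    rw [totalDensity_eq V m]
    exact hgC _ _ (by positivity) (by positivity)
  have hsumw : Summable w := summable_gibbsWeight hd hβ hV0 hb.le hba μ m
  have hsumρ : Summable fun n => w n * (1 + totalDensity V n) :=
    summable_gibbsWeight_mul hd hβ hV0 hb.le hba μ m
  -- Configurations with |G| < ε contribute at most εZ; F collects the others, weighted by the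
  -- growth bound on G.
  set F : Counts → ℝ := fun n => if ε ≤ |G n| then w n * (1 + totalDensity V n) else 0 with hF
  have hρ0 : ∀ n, 0 ≤ w n * (1 + totalDensity V n) := fun n =>
    mul_nonneg (hw0 n).le (by linarith [totalDensity_nonneg hV0 n])
  have hF0 : ∀ n, 0 ≤ F n := fun n => by
    simp only [hF]; split_ifs <;> [exact hρ0 n; exact le_rfl]
  have hFsum : Summable F := Summable.of_nonneg_of_le hF0 (fun n => by
    simp only [hF]; split_ifs <;> [exact le_rfl; exact hρ0 n]) hsumρ
  have hFle : ∑' n, F n ≤ Real.exp (-(β * V * rateEnergy d β a b μ z₀) + V * tailWeight d β m) *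
      (2 / (β * η * V) * Real.exp (-(β * η / 2 * V)) * c) := by
    refine hFsum.tsum_le_of_sum_le fun T => ?_
    simp only [hF]
    rw [← Finset.sum_filter]
    refine sum_gibbsWeight_mul_le hd hβ hV0 hb.le hη _ fun n hn => ?_
    rw [totalDensity_eq V m]
    refine h1 _ _ (by positivity) (by positivity) ?_ (Finset.mem_filter.mp hn).2
    rcases le_longMass m n with h | h
    · left; rw [h]; simp
    · right
      have : (m : ℝ) ≤ longMass m n := by exact_mod_cast h
      exact div_le_div_of_nonneg_right this hV0.le
  have hFZ : C * ∑' n, F n ≤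
      (C * (2 / (β * η) * c) * Real.exp (-(β * η / 4 * V))) * Z := by
    have h6 : 2 / (β * η * V) ≤ 2 / (β * η) := by
      refine div_le_div_of_nonneg_left (by norm_num) (by positivity) ?_
      have : 0 < β * η := by positivity
      nlinarith
    calc C * ∑' n, F n
        ≤ C * (Real.exp (-(β * V * rateEnergy d β a b μ z₀) + V * (β * η / 8)) *
          (2 / (β * η) * Real.exp (-(β * η / 2 * V)) * c)) := by
          refine mul_le_mul_of_nonneg_left (hFle.trans ?_) hC0
          have h7 : V * tailWeight d β m ≤ V * (β * η / 8) :=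
            mul_le_mul_of_nonneg_left h2.le hV0.le
          gcongr
      _ = (C * (2 / (β * η) * c) * Real.exp (-(β * η / 4 * V))) *
          Real.exp (-(β * V * (rateEnergy d β a b μ z₀ + η / 8))) := by
          rw [mul_assoc (C * (2 / (β * η) * c)), ← Real.exp_add]
          have : -(β * η / 4 * V) + -(β * V * (rateEnergy d β a b μ z₀ + η / 8)) =
            (-(β * V * rateEnergy d β a b μ z₀) + V * (β * η / 8)) + -(β * η / 2 * V) := by ring
          rw [this, Real.exp_add (_ + V * (β * η / 8))]
          ring
      _ ≤ _ := mul_le_mul_of_nonneg_left h3 (by positivity)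
  have hint : ∫ n, G n ∂(S.gibbs β α a b μ i) = (∑' n, w n * G n) / Z := integral_gibbs hβ hV0 G
  have habs : |∑' n, w n * G n| ≤ ε * Z + C * ∑' n, F n := by
    have hs := summable_gibbsWeight_mul_abs hd hβ hV0 hb.le hba μ m hGC
    have hs' : Summable fun n => ‖w n * G n‖ := by
      refine hs.congr fun n => ?_
      rw [Real.norm_eq_abs, abs_mul, abs_of_pos (hw0 n)]
    refine (norm_tsum_le_tsum_norm hs').trans ?_
    rw [hZ, partitionFunction, ← tsum_mul_left, ← tsum_mul_left,
      ← (hsumw.mul_left ε).tsum_add (hFsum.mul_left C)]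
    refine hs'.tsum_le_tsum (fun n => ?_) ((hsumw.mul_left ε).add (hFsum.mul_left C))
    rw [Real.norm_eq_abs, abs_mul, abs_of_pos (hw0 n)]
    by_cases hn : ε ≤ |G n|
    · simp only [hF, if_pos hn]
      have := mul_le_mul_of_nonneg_left (hGC n) (hw0 n).le
      have := mul_pos hε0 (hw0 n)
      linarith
    · simp only [hF, if_neg hn]
      have := mul_le_mul_of_nonneg_left (not_le.mp hn).le (hw0 n).le
      linarith
  rw [hint, Real.dist_eq, sub_zero, abs_div, abs_of_pos hZ0, div_lt_iff₀ hZ0]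
  have h8 := mul_lt_mul_of_pos_right h4 hZ0
  have h9 : ε₀ * Z = ε * Z + ε * Z := by rw [hε]; ring
  linarith

end Concentration

/-! ### Condensate densities -/

section Observables

variable {d : ℕ} {β a b μ : ℝ} {κ : ℝ≥0∞}

lemma abs_totalDensity_le {V : ℝ} (hV : 0 < V) (n : Counts) :
    |totalDensity V n| ≤ 1 * (1 + totalDensity V n) := by
  rw [abs_of_nonneg (totalDensity_nonneg hV n)]; linarith

lemma abs_densityFrom_le {V : ℝ} (hV : 0 < V) (m : ℕ) (n : Counts) :
    |densityFrom V m n| ≤ 1 * (1 + totalDensity V n) := by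
  rw [densityFrom_eq, totalDensity_eq V m, abs_of_nonneg (by positivity)]
  have : 0 ≤ (shortMass m n : ℝ) / V := by positivity
  linarith

lemma densityAbove_eq (V : ℝ) (K : ℕ) (n : Counts) :
    densityAbove V K n = totalDensity V n - ∑ k ∈ cyclesUpTo K, (k : ℝ) / V * n k := by
  have h : ∑ k ∈ cyclesUpTo K, (k : ℝ) / V * n k =
      n.sum fun k j => if (k : ℕ) ≤ K then (k : ℝ) * ((j : ℝ) / V) else 0 := by
    rw [Finsupp.sum_of_support_subset n (s := n.support ∪ cyclesUpTo K)
      Finset.subset_union_left _ (by simp)]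
    rw [← Finset.sum_filter]
    have hfil : (n.support ∪ cyclesUpTo K).filter (fun k : ℕ+ => (k : ℕ) ≤ K) = cyclesUpTo K := by
      ext k
      simp only [Finset.mem_filter, Finset.mem_union, mem_cyclesUpTo]
      tauto
    rw [hfil]
    exact Finset.sum_congr rfl fun k _ => by ring
  rw [h, eq_sub_iff_add_eq]
  simp only [densityAbove, totalDensity, Finsupp.sum, ← Finset.sum_add_distrib]
  refine Finset.sum_congr rfl fun k _ => ?_
  by_cases hk : (k : ℕ) ≤ K
  · simp [hk, not_lt.mpr hk]
  · simp [hk, not_le.mp hk]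

lemma count_le {V : ℝ} (hV : 0 < V) (n : Counts) (k : ℕ+) :
    |(n k : ℝ)| ≤ V * (1 + totalDensity V n) := by
  rw [abs_of_nonneg (Nat.cast_nonneg _)]
  have h1 : (k : ℝ) * ((n k : ℝ) / V) ≤ totalDensity V n := by
    by_cases hk : k ∈ n.support
    · exact Finset.single_le_sum (f := fun k : ℕ+ => (k : ℝ) * ((n k : ℝ) / V))
        (fun _ _ => by positivity) hk
    · rw [Finsupp.notMem_support_iff.mp hk]
      simpa using totalDensity_nonneg hV n
  have h2 : (n k : ℝ) / V ≤ (k : ℝ) * ((n k : ℝ) / V) :=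
    le_mul_of_one_le_left (by positivity) (one_le_cast k)
  have h3 := h2.trans h1
  rw [div_le_iff₀ hV] at h3
  linarith

lemma abs_densityAbove_le {V : ℝ} (hV : 0 < V) (K : ℕ) (n : Counts) :
    |densityAbove V K n| ≤ 1 * (1 + totalDensity V n) := by
  have h0 : 0 ≤ densityAbove V K n :=
    Finset.sum_nonneg fun k _ => by dsimp only; split_ifs <;> positivity
  have h1 : 0 ≤ ∑ k ∈ cyclesUpTo K, (k : ℝ) / V * n k :=
    Finset.sum_nonneg fun k _ => by positivity
  rw [abs_of_nonneg h0, densityAbove_eq]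
  linarith

/-- The factor `e^{βk(μ - aρ)}` of a cycle of length `k` at particle density `ρ`. -/
def cycleFactor (β a μ : ℝ) (k : ℕ+) (ρ : ℝ) : ℝ :=
  Real.exp (β * (μ - a * ρ) * k)

lemma cycleFactor_le (hβ : 0 < β) (ha : 0 < a) (k : ℕ+) {ρ : ℝ} (hρ : 0 ≤ ρ) :
    cycleFactor β a μ k ρ ≤ Real.exp (β * μ * k) := by
  unfold cycleFactor
  have : 0 ≤ a * ρ := by positivity
  have hk := one_le_cast k
  gcongr
  linarith

lemma integral_one_gibbs (hd : 1 ≤ d) (hβ : 0 < β) {V : ℝ} (hV : 0 < V) (hb : 0 ≤ b)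
    (hba : b < a) (α μ : ℝ) (m : ℕ) (c : ℝ) :
    ∫ _, c ∂(gibbsMeasure d β α a b μ V m) = c := by
  have hZ := partitionFunction_pos hd hβ hV hb hba μ m
  rw [integral_gibbs hβ hV, tsum_mul_right]
  rw [partitionFunction] at *
  field_simp

lemma integral_count (hβ : 0 < β) {V : ℝ} (hV : 0 < V) (α μ : ℝ) {m : ℕ} {k : ℕ+}
    (hk : (k : ℕ) < m) :
    ∫ n, (n k : ℝ) ∂(gibbsMeasure d β α a b μ V m) =
      V * cycleWeight d β k * Real.exp (-(β * a * k ^ 2 / (2 * V))) *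
        ∫ n, cycleFactor β a μ k (totalDensity V n) ∂(gibbsMeasure d β α a b μ V m) := by
  have h : ∑' n, gibbsWeight d β a b μ V m n *
      Real.exp (β * k * (μ - a * totalDensity V n) - β * a * k ^ 2 / (2 * V)) =
      Real.exp (-(β * a * k ^ 2 / (2 * V))) *
        ∑' n, gibbsWeight d β a b μ V m n * cycleFactor β a μ k (totalDensity V n) := by
    rw [← tsum_mul_left]
    refine tsum_congr fun n => ?_
    rw [cycleFactor, mul_left_comm, ← Real.exp_add]
    congr 2
    ring
  rw [integral_gibbs hβ hV, integral_gibbs hβ hV, tsum_gibbsWeight_mul_count hV hk, h]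
  ring

/-- The density in cycles longer than `K`, if the particle density is `z.1 + z.2`. -/
def saturatedExcess (d : ℕ) (β a μ : ℝ) (K : ℕ) (z : ℝ × ℝ) : ℝ :=
  z.1 + z.2 - ∑ k ∈ cyclesUpTo K, cycleDensity d β (μ - a * (z.1 + z.2)) k

lemma abs_cycleFactor_le (hβ : 0 < β) (ha : 0 < a) {V : ℝ} (hV : 0 < V) (k : ℕ+) (n : Counts) :
    |cycleFactor β a μ k (totalDensity V n)| ≤
      Real.exp (β * μ * k) * (1 + totalDensity V n) := by
  have h := totalDensity_nonneg hV n
  rw [abs_of_nonneg (show 0 ≤ cycleFactor β a μ k _ from (Real.exp_pos _).le)]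
  have := cycleFactor_le (μ := μ) hβ ha k h
  have := Real.exp_pos (β * μ * k)
  nlinarith

lemma integral_saturatedExcess (hd : 1 ≤ d) (hβ : 0 < β) {V : ℝ} (hV : 0 < V) (hb : 0 < b)
    (hba : b < a) (α μ : ℝ) (m K : ℕ) (A B : ℝ) :
    ∫ n, (saturatedExcess d β a μ K (densityPair V m n) - A - B * (densityPair V m n).2)
        ∂(gibbsMeasure d β α a b μ V m) =
      ∫ n, totalDensity V n ∂(gibbsMeasure d β α a b μ V m) - ∑ k ∈ cyclesUpTo K,
        k * cycleWeight d β k *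
          ∫ n, cycleFactor β a μ k (totalDensity V n) ∂(gibbsMeasure d β α a b μ V m)
      - A - B * ∫ n, densityFrom V m n ∂(gibbsMeasure d β α a b μ V m) := by
  have ha := hb.trans hba
  have i1 := integrable_gibbs_of_le hd hβ hV hb.le hba α μ m (abs_totalDensity_le hV)
  have i2 := integrable_gibbs_of_le hd hβ hV hb.le hba α μ m (abs_densityFrom_le hV m)
  have i3 : ∀ k : ℕ+, Integrable (fun n => k * cycleWeight d β k *
      cycleFactor β a μ k (totalDensity V n)) (gibbsMeasure d β α a b μ V m) := fun k =>
    (integrable_gibbs_of_le hd hβ hV hb.le hba α μ m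
      (abs_cycleFactor_le (μ := μ) hβ ha hV k)).const_mul _
  have i4 : Integrable (fun _ : Counts => A) (gibbsMeasure d β α a b μ V m) :=
    integrable_gibbs_of_le (C := |A|) hd hβ hV hb.le hba α μ m fun n => by
      have := totalDensity_nonneg hV n
      have := abs_nonneg A
      nlinarith
  have i5 := integrable_finsetSum (cyclesUpTo K) fun k _ => i3 k
  have heq : ∀ n, saturatedExcess d β a μ K (densityPair V m n) - A -
      B * (densityPair V m n).2 = totalDensity V n -
      ∑ k ∈ cyclesUpTo K, k * cycleWeight d β k * cycleFactor β a μ k (totalDensity V n)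
      - A - B * densityFrom V m n := by
    intro n
    rw [totalDensity_eq V m, densityFrom_eq]
    rfl
  have i6 : Integrable (fun n => totalDensity V n - ∑ k ∈ cyclesUpTo K,
      k * cycleWeight d β k * cycleFactor β a μ k (totalDensity V n))
      (gibbsMeasure d β α a b μ V m) := i1.sub i5
  have i7 : Integrable (fun n => totalDensity V n - ∑ k ∈ cyclesUpTo K,
      k * cycleWeight d β k * cycleFactor β a μ k (totalDensity V n) - A)
      (gibbsMeasure d β α a b μ V m) := i6.sub i4
  rw [integral_congr_ae (Eventually.of_forall heq), integral_sub i7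
    (i2.const_mul B), integral_sub i6 i4, integral_sub i1 i5,
    integral_finsetSum _ fun k _ => i3 k, integral_one_gibbs hd hβ hV hb.le hba,
    integral_const_mul]
  simp only [integral_const_mul]

lemma integral_densityAbove (hd : 1 ≤ d) (hβ : 0 < β) {V : ℝ} (hV : 0 < V) (hb : 0 < b)
    (hba : b < a) (α μ : ℝ) {m K : ℕ} (hK : K < m) :
    ∫ n, densityAbove V K n ∂(gibbsMeasure d β α a b μ V m) =
      ∫ n, totalDensity V n ∂(gibbsMeasure d β α a b μ V m) - ∑ k ∈ cyclesUpTo K,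
        k * cycleWeight d β k * Real.exp (-(β * a * k ^ 2 / (2 * V))) *
          ∫ n, cycleFactor β a μ k (totalDensity V n) ∂(gibbsMeasure d β α a b μ V m) := by
  have i1 := integrable_gibbs_of_le hd hβ hV hb.le hba α μ m (abs_totalDensity_le hV)
  have i2 : ∀ k : ℕ+, Integrable (fun n : Counts => (k : ℝ) / V * n k)
      (gibbsMeasure d β α a b μ V m) := fun k =>
    (integrable_gibbs_of_le hd hβ hV hb.le hba α μ m fun n => count_le hV n k).const_mul _
  simp only [densityAbove_eq]
  rw [integral_sub i1 (integrable_finsetSum _ fun k _ => i2 k), integral_finsetSum _ fun k _ => i2 k]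
  congr 1
  refine Finset.sum_congr rfl fun k hk => ?_
  rw [mem_cyclesUpTo] at hk
  rw [integral_const_mul, integral_count hβ hV α μ (hk.trans_lt hK)]
  field_simp

lemma continuous_saturatedExcess (K : ℕ) : Continuous (saturatedExcess d β a μ K) := by
  unfold saturatedExcess cycleDensity
  fun_prop

lemma abs_saturatedExcess_le (hβ : 0 < β) (ha : 0 < a) (K : ℕ) (A B : ℝ) {x y : ℝ} (hx : 0 ≤ x)
    (hy : 0 ≤ y) : |saturatedExcess d β a μ K (x, y) - A - B * y| ≤
      (1 + ∑ k ∈ cyclesUpTo K, cycleDensity d β μ k + |A| + |B|) * (1 + (x + y)) := by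
  have hs : ∑ k ∈ cyclesUpTo K, cycleDensity d β (μ - a * (x + y)) k ≤
      ∑ k ∈ cyclesUpTo K, cycleDensity d β μ k := by
    refine Finset.sum_le_sum fun k _ => cycleDensity_mono hβ k ?_
    have : 0 ≤ a * (x + y) := by positivity
    linarith
  have hs0 : 0 ≤ ∑ k ∈ cyclesUpTo K, cycleDensity d β (μ - a * (x + y)) k :=
    Finset.sum_nonneg fun k _ => (cycleDensity_pos hβ _ k).le
  set P := ∑ k ∈ cyclesUpTo K, cycleDensity d β μ k
  have h1 : |saturatedExcess d β a μ K (x, y) - A - B * y| ≤ (x + y) + P + |A| + |B| * y := by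
    have hA := abs_le.mp (le_refl |A|)
    have hB := abs_le.mp (le_refl |B * y|)
    rw [abs_mul, abs_of_nonneg hy] at hB
    simp only [saturatedExcess]
    rw [abs_le]
    constructor <;> linarith [hA.1, hA.2, hB.1, hB.2]
  refine h1.trans ?_
  have hA := abs_nonneg A
  have hB := abs_nonneg B
  have hP : 0 ≤ P := hs0.trans hs
  nlinarith [mul_nonneg hP (add_nonneg hx hy), mul_nonneg hA (add_nonneg hx hy),
    mul_nonneg hB hx]

/-- For fixed k the self-interaction factor tends to 1, and the expectation it multiplies is at most
e^{βμk}. -/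
lemma tendsto_cycleFactor_correction (hd : 1 ≤ d) (hβ : 0 < β) (hb : 0 < b) (hba : b < a)
    (α μ : ℝ) (S : ThermoSeq d κ) (k : ℕ+) :
    Tendsto (fun i => (1 - Real.exp (-(β * a * k ^ 2 / (2 * S.vol i)))) *
      ∫ n, cycleFactor β a μ k (totalDensity (S.vol i) n) ∂(S.gibbs β α a b μ i)) atTop (𝓝 0) := by
  have ha := hb.trans hba
  have h1 : Tendsto (fun i => β * a * (k : ℝ) ^ 2 / (2 * S.vol i)) atTop (𝓝 0) :=
    tendsto_const_nhds.div_atTop (S.tendsto_vol.const_mul_atTop (by norm_num))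
  have h2 : Tendsto (fun i => 1 - Real.exp (-(β * a * (k : ℝ) ^ 2 / (2 * S.vol i)))) atTop
      (𝓝 0) := by
    have := (Real.continuous_exp.tendsto _).comp h1.neg
    simpa using this.const_sub 1
  refine bdd_le_mul_tendsto_zero' (Real.exp (β * μ * k)) (Eventually.of_forall fun i => ?_) h2
    |>.congr fun i => mul_comm _ _
  have hV := S.vol_pos i
  have hint : Integrable (fun n => cycleFactor β a μ k (totalDensity (S.vol i) n))
      (S.gibbs β α a b μ i) :=
    integrable_gibbs_of_le hd hβ hV hb.le hba α μ _ (abs_cycleFactor_le hβ ha hV k)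
  have hc : Integrable (fun _ : Counts => Real.exp (β * μ * k)) (S.gibbs β α a b μ i) :=
    integrable_gibbs_of_le (C := Real.exp (β * μ * k)) hd hβ hV hb.le hba α μ _ fun n => by
      rw [abs_of_pos (Real.exp_pos _)]
      have := totalDensity_nonneg hV n
      have := Real.exp_pos (β * μ * k)
      nlinarith
  rw [abs_of_nonneg (integral_nonneg fun n => (Real.exp_pos _).le)]
  refine (integral_mono hint hc fun n => cycleFactor_le hβ ha k (totalDensity_nonneg hV n)).trans_eq
    ?_
  exact integral_one_gibbs hd hβ hV hb.le hba α μ _ _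

/-- If the saturated excess is an affine function of the density of long cycles at all ground
states, then so are the corresponding expectations in the limit. -/
lemma tendsto_integral_densityAbove_sub (hd : 1 ≤ d) (hβ : 0 < β) (hb : 0 < b) (hba : b < a)
    (α : ℝ) (S : ThermoSeq d κ) (K : ℕ) (A B : ℝ)
    (h : ∀ z, IsGroundState d β a b μ κ z → saturatedExcess d β a μ K z = A + B * z.2) :
    Tendsto (fun i => ∫ n, densityAbove (S.vol i) K n ∂(S.gibbs β α a b μ i) -
      (A + B * ∫ n, densityFrom (S.vol i) (S.cutoff i) n ∂(S.gibbs β α a b μ i))) atTop (𝓝 0) := by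
  have ha := hb.trans hba
  have h1 := tendsto_integral_gibbs_zero (μ := μ) (g := fun z => saturatedExcess d β a μ K z - A -
    B * z.2) hd hβ hb hba α S
    (((continuous_saturatedExcess K).sub continuous_const).sub (by fun_prop))
    (fun x y hx hy => abs_saturatedExcess_le hβ ha K A B hx hy)
    (fun z hz => by rw [h z hz]; ring)
  have h2 := tendsto_finsetSum (cyclesUpTo K) fun k _ =>
    (tendsto_cycleFactor_correction hd hβ hb hba α μ S k).const_mul
      ((k : ℝ) * cycleWeight d β k)
  have h3 := h1.add h2
  simp only [mul_zero, Finset.sum_const_zero, add_zero] at h3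
  refine h3.congr' ?_
  filter_upwards [S.tendsto_cutoff.eventually_gt_atTop K] with i hi
  have hV := S.vol_pos i
  rw [ThermoSeq.gibbs, integral_saturatedExcess hd hβ hV hb hba,
    integral_densityAbove hd hβ hV hb hba α μ hi]
  have h4 : ∀ k : ℕ+, (k : ℝ) * cycleWeight d β k *
      ((1 - Real.exp (-(β * a * k ^ 2 / (2 * S.vol i)))) *
      ∫ n, cycleFactor β a μ k (totalDensity (S.vol i) n)
        ∂(gibbsMeasure d β α a b μ (S.vol i) (S.cutoff i))) =
      k * cycleWeight d β k * ∫ n, cycleFactor β a μ k (totalDensity (S.vol i) n)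
        ∂(gibbsMeasure d β α a b μ (S.vol i) (S.cutoff i)) -
      k * cycleWeight d β k * Real.exp (-(β * a * k ^ 2 / (2 * S.vol i))) *
        ∫ n, cycleFactor β a μ k (totalDensity (S.vol i) n)
        ∂(gibbsMeasure d β α a b μ (S.vol i) (S.cutoff i)) := fun k => by ring
  simp only [h4, Finset.sum_sub_distrib]
  ring

lemma integrable_densityFrom (hd : 1 ≤ d) (hβ : 0 < β) (hb : 0 < b) (hba : b < a) (α : ℝ)
    (S : ThermoSeq d κ) (i : ℕ) :
    Integrable (densityFrom (S.vol i) (S.cutoff i)) (S.gibbs β α a b μ i) :=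
  integrable_gibbs_of_le hd hβ (S.vol_pos i) hb.le hba α μ _ (abs_densityFrom_le (S.vol_pos i) _)

lemma integrable_densityAbove (hd : 1 ≤ d) (hβ : 0 < β) (hb : 0 < b) (hba : b < a) (α : ℝ)
    (S : ThermoSeq d κ) (i K : ℕ) :
    Integrable (densityAbove (S.vol i) K) (S.gibbs β α a b μ i) :=
  integrable_gibbs_of_le hd hβ (S.vol_pos i) hb.le hba α μ _ (abs_densityAbove_le (S.vol_pos i) _)

lemma hasLongCycleDensity_of_unique (hd : 1 ≤ d) (hβ : 0 < β) (hb : 0 < b) (hba : b < a) (α : ℝ)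
    {z₀ : ℝ × ℝ} (h : ∀ z, IsGroundState d β a b μ κ z → z = z₀) (S : ThermoSeq d κ) :
    HasLongCycleDensity S β α a b μ z₀.2 := by
  refine ⟨integrable_densityFrom hd hβ hb hba α S, ?_⟩
  have h1 := tendsto_integral_gibbs_zero (μ := μ) (g := fun z => z.2 - z₀.2) (C := 1 + |z₀.2|)
    hd hβ hb hba α S (by fun_prop) (fun x y hx hy => ?_) (fun z hz => by rw [h z hz, sub_self])
  · rw [← tendsto_sub_nhds_zero_iff]
    refine h1.congr fun i => ?_
    have hV := S.vol_pos i
    have hc : Integrable (fun _ : Counts => z₀.2) (S.gibbs β α a b μ i) :=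
      integrable_gibbs_of_le (C := |z₀.2|) hd hβ hV hb.le hba α μ _ fun n => by
        have := totalDensity_nonneg hV n
        have := abs_nonneg z₀.2
        nlinarith
    have h2 := integral_sub (integrable_densityFrom (μ := μ) hd hβ hb hba α S i) hc
    rw [ThermoSeq.gibbs, integral_one_gibbs hd hβ hV hb.le hba] at h2
    rw [ThermoSeq.gibbs, ← h2]
    simp only [densityFrom_eq]
    rfl
  · have h1 : |y - z₀.2| ≤ y + |z₀.2| := by
      have := abs_sub y z₀.2
      rwa [abs_of_nonneg hy] at this
    have := abs_nonneg z₀.2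
    dsimp only
    nlinarith [mul_nonneg this (add_nonneg hx hy)]

lemma hasCondensateDensity_of_unique (hd : 1 ≤ d) (hβ : 0 < β) (hb : 0 < b) (hba : b < a) (α : ℝ)
    {z₀ : ℝ × ℝ} (h : ∀ z, IsGroundState d β a b μ κ z → z = z₀) {r : ℝ}
    (hr : Tendsto (fun K => saturatedExcess d β a μ K z₀) atTop (𝓝 r)) (S : ThermoSeq d κ) :
    HasCondensateDensity S β α a b μ r := by
  refine ⟨integrable_densityAbove hd hβ hb hba α S, _, fun K => ?_, hr⟩
  have h1 := tendsto_integral_densityAbove_sub hd hβ hb hba α S K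
    (saturatedExcess d β a μ K z₀) 0 fun z hz => by rw [h z hz]; ring
  rw [← tendsto_sub_nhds_zero_iff]
  simpa using h1

lemma tendsto_saturatedExcess {z : ℝ × ℝ}
    (h : HasSum (cycleDensity d β (μ - a * (z.1 + z.2))) z.1) :
    Tendsto (fun K => saturatedExcess d β a μ K z) atTop (𝓝 z.2) := by
  have := (h.comp tendsto_cyclesUpTo).const_sub (z.1 + z.2)
  simpa [saturatedExcess] using this

/-- There are at most two ground states, and two of them have distinct second components, one being
0. Any function on them is thus affine in z.2, and the coefficients converge because the excess
tends to z.2 at each. -/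
lemma exists_affine_saturatedExcess (hd : 1 ≤ d) (hβ : 0 < β) (hb : 0 < b) (hba : b < a) (μ : ℝ) :
    ∃ A B : ℕ → ℝ, Tendsto A atTop (𝓝 0) ∧ Tendsto B atTop (𝓝 1) ∧
      ∀ K z, IsGroundState d β a b μ 0 z → saturatedExcess d β a μ K z = A K + B K * z.2 := by
  have ha := hb.trans hba
  have hlim : ∀ z, IsGroundState d β a b μ 0 z →
      Tendsto (fun K => saturatedExcess d β a μ K z) atTop (𝓝 z.2) := fun z hz =>
    tendsto_saturatedExcess (hz.hasSum_of_unrestricted hd hβ hb hba)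
  by_cases huniq : ∃ z₀, IsGroundState d β a b μ 0 z₀ ∧ ∀ z, IsGroundState d β a b μ 0 z → z = z₀
  · obtain ⟨z₀, hz₀, h⟩ := huniq
    refine ⟨fun K => saturatedExcess d β a μ K z₀ - z₀.2, fun _ => 1, ?_, tendsto_const_nhds,
      fun K z hz => by rw [h z hz]; ring⟩
    simpa using (hlim z₀ hz₀).sub_const z₀.2
  · push Not at huniq
    have hex : ∃ z₀ z₁, IsGroundState d β a b μ 0 z₀ ∧ IsGroundState d β a b μ 0 z₁ ∧
        z₀.2 = 0 ∧ 0 < z₁.2 := by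
      obtain ⟨z, hz⟩ := exists_isGroundState (d := d) hd hβ hb hba μ 0
      obtain ⟨w, hw, hne⟩ := huniq z hz
      rcases hz.mem.2.1.eq_or_lt with h0 | h0 <;> rcases hw.mem.2.1.eq_or_lt with h1 | h1
      · exact absurd ((hw.eq_of_zero hd hβ ha h1.symm).trans (hz.eq_of_zero hd hβ ha h0.symm).symm)
          hne
      · exact ⟨z, w, hz, hw, h0.symm, h1⟩
      · exact ⟨w, z, hw, hz, h1.symm, h0⟩
      · exact absurd (hw.eq_of_pos hd hβ hb ha hz h1 h0) hne
    obtain ⟨z₀, z₁, hz₀, hz₁, h0, h1⟩ := hex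
    have l0 := hlim z₀ hz₀
    rw [h0] at l0
    refine ⟨fun K => saturatedExcess d β a μ K z₀,
      fun K => (saturatedExcess d β a μ K z₁ - saturatedExcess d β a μ K z₀) / z₁.2, l0, ?_, ?_⟩
    · have := ((hlim z₁ hz₁).sub l0).div_const z₁.2
      rwa [sub_zero, div_self h1.ne'] at this
    · intro K z hz
      rcases hz.mem.2.1.eq_or_lt with h | h
      · rw [(hz.eq_of_zero hd hβ ha h.symm).trans (hz₀.eq_of_zero hd hβ ha h0).symm, h0]
        ring
      · rw [hz.eq_of_pos hd hβ hb ha hz₁ h h1]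
        field_simp
        ring

/-- Without a gap in the cut-off, condensate and long cycles have the same density. -/
theorem hasCondensateDensity_iff (hd : 1 ≤ d) (hβ : 0 < β) (hb : 0 < b) (hba : b < a) (α μ : ℝ)
    (S : ThermoSeq d 0) (r : ℝ) :
    HasCondensateDensity S β α a b μ r ↔ HasLongCycleDensity S β α a b μ r := by
  obtain ⟨A, B, hA, hB, hAB⟩ := exists_affine_saturatedExcess (d := d) hd hβ hb hba μ
  have hdiff := fun K => tendsto_integral_densityAbove_sub hd hβ hb hba α S K (A K) (B K) (hAB K)
  constructor
  · rintro ⟨-, D, hD, hDr⟩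
    refine ⟨integrable_densityFrom hd hβ hb hba α S, ?_⟩
    have hBe : ∀ K, Tendsto (fun i => B K * ∫ n, densityFrom (S.vol i) (S.cutoff i) n
        ∂(S.gibbs β α a b μ i)) atTop (𝓝 (D K - A K)) := fun K => by
      have := ((hD K).sub (hdiff K)).sub_const (A K)
      rw [sub_zero] at this
      exact this.congr fun i => by ring
    -- As B tends to 1, one nonzero B K₀ already recovers the limiting long-cycle density from D K₀.
    obtain ⟨K₀, hK₀⟩ := (hB.eventually_ne one_ne_zero).exists
    have he : Tendsto (fun i => ∫ n, densityFrom (S.vol i) (S.cutoff i) n ∂(S.gibbs β α a b μ i))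
        atTop (𝓝 ((D K₀ - A K₀) / B K₀)) :=
      ((hBe K₀).div_const (B K₀)).congr fun i => by field_simp
    set e := (D K₀ - A K₀) / B K₀
    have hDe : ∀ K, D K = A K + B K * e := fun K => by
      have := tendsto_nhds_unique (hBe K) (he.const_mul (B K))
      linarith
    have hlim : Tendsto D atTop (𝓝 (0 + 1 * e)) :=
      (hA.add (hB.mul_const e)).congr fun K => (hDe K).symm
    have hre := tendsto_nhds_unique hDr hlim
    rw [zero_add, one_mul] at hre
    rwa [hre]
  · rintro ⟨-, hr⟩
    refine ⟨integrable_densityAbove hd hβ hb hba α S, fun K => A K + B K * r, fun K => ?_, ?_⟩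
    · have := (hdiff K).add ((hr.const_mul (B K)).const_add (A K))
      rw [zero_add] at this
      exact this.congr fun i => by ring
    · simpa using hA.add (hB.mul_const r)

end Observables

/-! ### Phases -/

section Phases

variable {d : ℕ} {β a b μ : ℝ} {κ : ℝ≥0∞}

lemma IsTransitionPotential.snd_pos (hβ : 0 < β) (hb : 0 < b) (hba : b < a) {ν : ℝ}
    (h : IsTransitionPotential d β a b κ ν) (hμ : ν < μ) {z : ℝ × ℝ}
    (hz : IsGroundState d β a b μ κ z) : 0 < z.2 :=
  (h.2 μ hμ).2 z ((mem_rateZeroes_iff hβ hb.le hba).mpr hz)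

lemma IsTransitionPotential.snd_eq_zero (hβ : 0 < β) (hb : 0 < b) (hba : b < a) {ν : ℝ}
    (h : IsTransitionPotential d β a b κ ν) (hμ : μ < ν) {z : ℝ × ℝ}
    (hz : IsGroundState d β a b μ κ z) : z.2 = 0 :=
  (h.1 μ hμ).2 z ((mem_rateZeroes_iff hβ hb.le hba).mpr hz)

lemma hasCondensateDensity_meanFieldExcess (hd : 1 ≤ d) (hβ : 0 < β) (hb : 0 < b) (hba : b < a)
    (α : ℝ) (h : ∀ z, IsGroundState d β a b μ κ z → z.2 = 0) (S : ThermoSeq d κ) :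
    HasCondensateDensity S β α a b μ (meanFieldExcess d β a μ) := by
  have ha := hb.trans hba
  refine hasCondensateDensity_of_unique hd hβ hb hba α
    (fun z hz => hz.eq_of_zero hd hβ ha (h z hz)) ?_ S
  refine (tendsto_meanFieldExcess hd hβ ha μ).congr fun K => ?_
  simp only [saturatedExcess, add_zero, mul_meanFieldDensity ha, sub_sub_cancel]

lemma hasCondensateDensity_of_pos (hd : 1 ≤ d) (hβ : 0 < β) (hb : 0 < b) (hba : b < a)
    (α : ℝ) (h : ∀ z, IsGroundState d β a b μ κ z → 0 < z.2) {z₀ : ℝ × ℝ}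
    (hz₀ : IsGroundState d β a b μ κ z₀) (S : ThermoSeq d κ) :
    HasCondensateDensity S β α a b μ z₀.2 ∧ HasLongCycleDensity S β α a b μ z₀.2 := by
  have huniq : ∀ z, IsGroundState d β a b μ κ z → z = z₀ := fun z hz =>
    hz.eq_of_pos hd hβ hb (hb.trans hba) hz₀ (h z hz) (h z₀ hz₀)
  exact ⟨hasCondensateDensity_of_unique hd hβ hb hba α huniq
    (tendsto_saturatedExcess (hz₀.hasSum_of_pos hd hβ hb hba (h z₀ hz₀))) S,
    hasLongCycleDensity_of_unique hd hβ hb hba α huniq S⟩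

theorem exists_densities_of_ne (hd : 1 ≤ d) (hβ : 0 < β) (hb : 0 < b) (hba : b < a) (α : ℝ) {ν : ℝ}
    (h : IsTransitionPotential d β a b 0 ν) (hμ : μ ≠ ν) :
    ∃ r : ℝ, ∀ S : ThermoSeq d 0,
      HasCondensateDensity S β α a b μ r ∧ HasLongCycleDensity S β α a b μ r := by
  have ha := hb.trans hba
  obtain ⟨z₀, hz₀⟩ := exists_isGroundState (d := d) hd hβ hb hba μ 0
  refine ⟨z₀.2, fun S => ?_⟩
  rcases hμ.lt_or_gt with hlt | hlt
  · have huniq : ∀ z, IsGroundState d β a b μ 0 z → z = z₀ := fun z hz =>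
      (hz.eq_of_zero hd hβ ha (h.snd_eq_zero hβ hb hba hlt hz)).trans
        (hz₀.eq_of_zero hd hβ ha (h.snd_eq_zero hβ hb hba hlt hz₀)).symm
    have hL := hasLongCycleDensity_of_unique hd hβ hb hba α huniq S
    exact ⟨(hasCondensateDensity_iff hd hβ hb hba α μ S _).mpr hL, hL⟩
  · exact hasCondensateDensity_of_pos hd hβ hb hba α
      (fun z hz => h.snd_pos hβ hb hba hlt hz) hz₀ S

lemma snd_eq_zero_of_top {z : ℝ × ℝ} (hz : IsGroundState d β a b μ ⊤ z) : z.2 = 0 :=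
  hz.mem.2.2.resolve_right fun h => ENNReal.ofReal_ne_top (top_le_iff.mp h)

/-- The density of long cycles in a ground state. -/
def groundDensity (d : ℕ) (β a b μ : ℝ) (κ : ℝ≥0∞) : ℝ :=
  (Classical.epsilon fun z => IsGroundState d β a b μ κ z).2

lemma exists_groundDensity_eq (hd : 1 ≤ d) (hβ : 0 < β) (hb : 0 < b) (hba : b < a) (μ : ℝ)
    (κ : ℝ≥0∞) : ∃ z, IsGroundState d β a b μ κ z ∧ z.2 = groundDensity d β a b μ κ :=
  ⟨_, Classical.epsilon_spec (exists_isGroundState (d := d) hd hβ hb hba μ κ), rfl⟩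

/-- Conditions on the parameters that force condensation. -/
structure IsCondensing (d : ℕ) (β a b μ : ℝ) (κ : ℝ≥0∞) : Prop where
  pos : 0 < b
  lt : b < a
  potential_pos : 0 < μ
  ratio_le : κ ≤ ENNReal.ofReal (μ / (a - b))
  large : idealPressure d β 0 < μ ^ 2 * b ^ 2 / (2 * a ^ 2 * (a - b))

lemma IsCondensing.snd_pos (hβ : 0 < β) (h : IsCondensing d β a b μ κ) {z : ℝ × ℝ}
    (hz : IsGroundState d β a b μ κ z) : 0 < z.2 := by
  have h1 := hz.le_snd hβ h.pos h.lt h.potential_pos.le h.ratio_le h.large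
  exact pos_of_mul_pos_right (h.potential_pos.trans_le h1) (h.pos.trans h.lt).le

lemma IsCondensing.hasCondensateDensity (hd : 1 ≤ d) (hβ : 0 < β) (h : IsCondensing d β a b μ κ)
    (α : ℝ) (S : ThermoSeq d κ) :
    HasCondensateDensity S β α a b μ (groundDensity d β a b μ κ) := by
  obtain ⟨z, hz, he⟩ := exists_groundDensity_eq (d := d) hd hβ h.pos h.lt μ κ
  rw [← he]
  exact (hasCondensateDensity_of_pos hd hβ h.pos h.lt α (fun z hz => h.snd_pos hβ hz) hz S).1

lemma IsCondensing.norm_sub_le (hd : 1 ≤ d) (hβ : 0 < β) (h : IsCondensing d β a b μ κ) :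
    ‖groundDensity d β a b μ κ - μ / (a - b)‖ ≤
      √(2 * idealPressure d β 0 * (a - b)) / μ * ‖μ / (a - b)‖ := by
  obtain ⟨z, hz, he⟩ := exists_groundDensity_eq (d := d) hd hβ h.pos h.lt μ κ
  have hab : 0 < a - b := sub_pos.mpr h.lt
  have hμ := h.potential_pos
  rw [← he]
  refine (hz.abs_sub_le hβ h.pos h.lt h.potential_pos.le h.ratio_le h.large).trans_eq ?_
  have h1 : 2 * idealPressure d β 0 * (a - b) =
      2 * idealPressure d β 0 / (a - b) * (a - b) ^ 2 := by field_simp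
  rw [h1, Real.sqrt_mul' _ (sq_nonneg _), Real.sqrt_sq hab.le, Real.norm_eq_abs,
    abs_of_pos (div_pos hμ hab)]
  field_simp

/-- The filter on pairs (b, μ) covers both b ↑ a and μ → ∞: in either case the relative error
√(2p₀(β,0)(a-b))/μ tends to 0. -/
lemma isEquivalent_groundDensity (hd : 1 ≤ d) (hβ : 0 < β) {l : Filter (ℝ × ℝ)}
    (hl : ∀ᶠ p in l, IsCondensing d β a p.1 p.2 κ)
    (hlim : Tendsto (fun p : ℝ × ℝ => √(2 * idealPressure d β 0 * (a - p.1)) / p.2) l (𝓝 0)) :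
    (fun p : ℝ × ℝ => groundDensity d β a p.1 p.2 κ) ~[l] fun p => p.2 / (a - p.1) := by
  refine IsLittleO.of_bound fun c hc => ?_
  filter_upwards [hl, hlim.eventually_lt_const hc] with p h1 h2
  exact (h1.norm_sub_le hd hβ).trans (mul_le_mul_of_nonneg_right h2.le (norm_nonneg _))

lemma eventually_isCondensing_atTop (hβ : 0 < β) (hb : 0 < b) (hba : b < a) (hκ : κ ≠ ⊤) :
    ∀ᶠ μ in atTop, IsCondensing d β a b μ κ := by
  filter_upwards [eventually_groundState_pos (d := d) hβ hb hba hκ] with μ h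
  exact ⟨hb, hba, h.1, h.2.1, h.2.2.1⟩

lemma tendsto_inv_sub_nhdsLT (a : ℝ) : Tendsto (fun b => (a - b)⁻¹) (𝓝[<] a) atTop := by
  refine tendsto_inv_nhdsGT_zero.comp (tendsto_nhdsWithin_iff.mpr ⟨?_, ?_⟩)
  · have : Tendsto (fun b => a - b) (𝓝 a) (𝓝 (a - a)) := (continuous_const.sub continuous_id).tendsto a
    rw [sub_self] at this
    exact this.mono_left nhdsWithin_le_nhds
  · filter_upwards [self_mem_nhdsWithin] with b hb
    exact sub_pos.mpr (Set.mem_Iio.mp hb)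

/-- Both μ/(a-b) and the threshold for `large` blow up like (a-b)⁻¹. -/
lemma eventually_isCondensing_nhdsLT (ha : 0 < a) (hμ : 0 < μ) (hκ : κ ≠ ⊤) :
    ∀ᶠ b in 𝓝[<] a, IsCondensing d β a b μ κ := by
  have h1 : Tendsto (fun b => μ * (a - b)⁻¹) (𝓝[<] a) atTop :=
    (tendsto_inv_sub_nhdsLT a).const_mul_atTop hμ
  have h2 : Tendsto (fun b : ℝ => μ ^ 2 * b ^ 2 / (2 * a ^ 2)) (𝓝[<] a)
      (𝓝 (μ ^ 2 * a ^ 2 / (2 * a ^ 2))) := by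
    have : Continuous fun b : ℝ => μ ^ 2 * b ^ 2 / (2 * a ^ 2) := by fun_prop
    exact (this.tendsto a).mono_left nhdsWithin_le_nhds
  have h3 := h2.pos_mul_atTop (by positivity) (tendsto_inv_sub_nhdsLT a)
  filter_upwards [h1.eventually_ge_atTop κ.toReal, h3.eventually_gt_atTop (idealPressure d β 0),
    Ioo_mem_nhdsLT ha] with b e1 e2 hb
  refine ⟨hb.1, hb.2, hμ, ?_, ?_⟩
  · rw [← ENNReal.ofReal_toReal hκ, div_eq_mul_inv]
    exact ENNReal.ofReal_le_ofReal e1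
  · rwa [← div_eq_mul_inv, div_div] at e2

theorem exists_equivalent_nhdsLT (hd : 1 ≤ d) (hβ : 0 < β) (α : ℝ) (ha : 0 < a) (μ : ℝ)
    (hκ : κ ≠ ⊤) :
    ∃ Δ : ℝ → ℝ,
      (∀ᶠ b in 𝓝[<] a, ∀ S : ThermoSeq d κ, HasCondensateDensity S β α a b μ (Δ b)) ∧
      Δ ~[𝓝[<] a] fun b => max (μ / (a - b)) 0 := by
  rcases lt_or_ge 0 μ with hμ | hμ
  · have hev := eventually_isCondensing_nhdsLT (d := d) (β := β) ha hμ hκ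
    refine ⟨fun b => groundDensity d β a b μ κ, hev.mono fun b h S =>
      h.hasCondensateDensity hd hβ α S, ?_⟩
    have hpair : Tendsto (fun b : ℝ => (b, μ)) (𝓝[<] a) (map (fun b => (b, μ)) (𝓝[<] a)) :=
      tendsto_map
    have hlim : Tendsto (fun p : ℝ × ℝ => √(2 * idealPressure d β 0 * (a - p.1)) / p.2)
        (map (fun b => (b, μ)) (𝓝[<] a)) (𝓝 0) := by
      rw [tendsto_map'_iff]
      have hc : Continuous fun b : ℝ => √(2 * idealPressure d β 0 * (a - b)) / μ := by fun_prop
      have := (hc.tendsto a).mono_left (nhdsWithin_le_nhds (s := Set.Iio a))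
      simpa [Function.comp_def] using this
    have := (isEquivalent_groundDensity (a := a) (κ := κ) hd hβ
      (eventually_map.mpr hev) hlim).comp_tendsto hpair
    refine this.congr_right ?_
    filter_upwards [self_mem_nhdsWithin] with b hb
    have hb : b < a := hb
    exact (max_eq_left (div_pos hμ (sub_pos.mpr hb)).le).symm
  · refine ⟨fun _ => 0, ?_, ?_⟩
    · filter_upwards [Ioo_mem_nhdsLT ha] with b hb S
      have h0 : meanFieldExcess d β a μ = 0 := meanFieldExcess_of_le fun _ =>
        (div_nonpos_of_nonpos_of_nonneg hμ ha.le).trans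
          (tsum_nonneg fun k => (cycleDensity_pos hβ 0 k).le)
      rw [← h0]
      exact hasCondensateDensity_meanFieldExcess hd hβ hb.1 hb.2 α
        (fun z hz => hz.snd_eq_zero_of_nonpos hd hβ hb.1 hb.2 hμ) S
    · refine IsEquivalent.refl.congr_right ?_
      filter_upwards [self_mem_nhdsWithin] with b hb
      have hb : b < a := hb
      exact (max_eq_right (div_nonpos_of_nonpos_of_nonneg hμ (sub_pos.mpr hb).le)).symm

theorem exists_equivalent_atTop (hd : 1 ≤ d) (hβ : 0 < β) (α : ℝ) (hb : 0 < b) (hba : b < a)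
    (hκ : κ ≠ ⊤) :
    ∃ Δ : ℝ → ℝ,
      (∀ᶠ μ in atTop, ∀ S : ThermoSeq d κ, HasCondensateDensity S β α a b μ (Δ μ)) ∧
      Δ ~[atTop] fun μ => μ / (a - b) := by
  have hev := eventually_isCondensing_atTop (d := d) hβ hb hba hκ
  refine ⟨fun μ => groundDensity d β a b μ κ, hev.mono fun μ h S =>
    h.hasCondensateDensity hd hβ α S, ?_⟩
  have hpair : Tendsto (fun μ : ℝ => (b, μ)) atTop (map (fun μ => (b, μ)) atTop) := tendsto_map
  have hlim : Tendsto (fun p : ℝ × ℝ => √(2 * idealPressure d β 0 * (a - p.1)) / p.2)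
      (map (fun μ => (b, μ)) atTop) (𝓝 0) := by
    rw [tendsto_map'_iff]
    exact (tendsto_const_nhds (x := √(2 * idealPressure d β 0 * (a - b)))).div_atTop tendsto_id
  exact (isEquivalent_groundDensity (a := a) (κ := κ) hd hβ
    (eventually_map.mpr hev) hlim).comp_tendsto hpair

end Phases

end CycleHYL

end

theorem mainTheorem3 (d : ℕ) (hd : 1 ≤ d) (β α : ℝ) (hβ : 0 < β) (hα : α < 0) :
    -- (a)
    (∀ a b : ℝ, 0 < b → b < a →
      -- κ = 0
      ((∀ (μ : ℝ) (S : CycleHYL.ThermoSeq d 0) (r : ℝ),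
          CycleHYL.HasCondensateDensity S β α a b μ r ↔
            CycleHYL.HasLongCycleDensity S β α a b μ r) ∧
        ∃ ν : ℝ, CycleHYL.IsTransitionPotential d β a b 0 ν ∧
          ∀ μ : ℝ, μ ≠ ν → ∃ r : ℝ, ∀ S : CycleHYL.ThermoSeq d 0,
            CycleHYL.HasCondensateDensity S β α a b μ r ∧
              CycleHYL.HasLongCycleDensity S β α a b μ r) ∧
      -- κ = ∞
      (∀ (μ : ℝ) (S : CycleHYL.ThermoSeq d ⊤),
        CycleHYL.HasCondensateDensity S β α a b μ (CycleHYL.meanFieldExcess d β a μ)) ∧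
      -- κ ∈ (0, ∞)
      (∀ κ : ℝ, 0 < κ →
        ∃ ν : ℝ, CycleHYL.IsTransitionPotential d β a b (ENNReal.ofReal κ) ν ∧
          ∃ νhat ∈ Set.Icc ν (max ν (CycleHYL.muR d β a b κ)),
            (∀ μ < νhat, ∀ S : CycleHYL.ThermoSeq d (ENNReal.ofReal κ),
              CycleHYL.HasCondensateDensity S β α a b μ (CycleHYL.meanFieldExcess d β a μ)) ∧
            (∀ μ > νhat, ∃ r : ℝ, ∀ S : CycleHYL.ThermoSeq d (ENNReal.ofReal κ),
              CycleHYL.HasCondensateDensity S β α a b μ r ∧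
                CycleHYL.HasLongCycleDensity S β α a b μ r))) ∧
    -- (b)
    (∀ a μ κ : ℝ, 0 < a → 0 ≤ κ →
      ∃ Δ : ℝ → ℝ,
        (∀ᶠ b in 𝓝[<] a, ∀ S : CycleHYL.ThermoSeq d (ENNReal.ofReal κ),
          CycleHYL.HasCondensateDensity S β α a b μ (Δ b)) ∧
        Δ ~[𝓝[<] a] fun b => max (μ / (a - b)) 0) ∧
    -- (c)
    (∀ a b κ : ℝ, 0 < b → b < a → 0 ≤ κ →
      ∃ Δ : ℝ → ℝ,
        (∀ᶠ μ in atTop, ∀ S : CycleHYL.ThermoSeq d (ENNReal.ofReal κ),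
          CycleHYL.HasCondensateDensity S β α a b μ (Δ μ)) ∧
        Δ ~[atTop] fun μ => μ / (a - b)) := by
  refine ⟨fun a b hb hba => ⟨⟨fun μ S r => CycleHYL.hasCondensateDensity_iff hd hβ hb hba α μ S r, ?_⟩,
    fun μ S => CycleHYL.hasCondensateDensity_meanFieldExcess hd hβ hb hba α
      (fun z hz => CycleHYL.snd_eq_zero_of_top hz) S, fun κ _ => ?_⟩,
    fun a μ κ ha _ => CycleHYL.exists_equivalent_nhdsLT hd hβ α ha μ ENNReal.ofReal_ne_top,
    fun a b κ hb hba _ => CycleHYL.exists_equivalent_atTop hd hβ α hb hba ENNReal.ofReal_ne_top⟩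
  · obtain ⟨ν, hν⟩ := CycleHYL.exists_isTransitionPotential (d := d) (κ := 0) hd hβ hb hba
      ENNReal.zero_ne_top
    exact ⟨ν, hν, fun μ hμ => CycleHYL.exists_densities_of_ne hd hβ hb hba α hν hμ⟩
  · obtain ⟨ν, hν⟩ := CycleHYL.exists_isTransitionPotential (d := d) (κ := ENNReal.ofReal κ)
      hd hβ hb hba ENNReal.ofReal_ne_top
    refine ⟨ν, hν, ν, ⟨le_rfl, le_max_left _ _⟩, fun μ hμ S => ?_, fun μ hμ => ?_⟩
    · exact CycleHYL.hasCondensateDensity_meanFieldExcess hd hβ hb hba α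
        (fun z hz => hν.snd_eq_zero hβ hb hba hμ hz) S
    · obtain ⟨z, hz⟩ := CycleHYL.exists_isGroundState (d := d) hd hβ hb hba μ (ENNReal.ofReal κ)
      exact ⟨z.2, fun S => CycleHYL.hasCondensateDensity_of_pos hd hβ hb hba α
        (fun z hz => hν.snd_pos hβ hb hba hμ hz) hz S⟩
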